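/- **Setting.** Let $d,r\in\mathbb N$, $r>12$, and write $m$ for Lebesgue measure on $\mathbb T^d=\mathbb R^d/\mathbb Z^d$. For $h\in C^r(\mathbb T^d)'$ and $\varphi\in C^r(\mathbb T^d)$ (real valued) write $\int\varphi h:=h(\varphi)$; functions $f\in C^r$ are identified with the distributions $\varphi\mapsto\int f\varphi\,dm$, and products $ah$ and derivatives $\partial_{x_k}h$ are taken in the sense of distributions. For a $C^r$ map $S:\mathbb T^d\to\mathbb T^d$ the transfer operator is $\int g\,\mathcal L_Sh=\int (g\circ S)\,h$. Let $T:\mathbb T^d\to\mathbb T^d$, $\alpha:\mathbb T^d\to\mathbb R$, $\beta=(\beta_1,\dots,\beta_d):\mathbb T^d\to\mathbb R^d$ be $C^\infty$ and $$T_{\nu,h}(x)=T(x)+\nu\,\beta(x)\,h(\alpha)\quad\text{mod }1 .$$ Let $\mathcal T$ be a set of surjective $C^r$ maps of $\mathbb T^d$ closed under composition, and $\nu_*>0$ such that $T_{\nu,h}\in\mathcal T$ for all $\nu\in[0,\nu_*]$ and all probability measures $h$. Let $C^r(\mathbb T^d)'\supset\mathcal B_0\supset\mathcal B_1\supset\mathcal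 B_2\supset\mathcal B_3\supset C^r(\mathbb T^d)$ be real Banach spaces, continuously embedded in $C^r(\mathbb T^d)'$, with $\|\cdot\|_{\mathcal B_i}\le\|\cdot\|_{\mathcal B_{i+1}}$, such that $C^r(\mathbb T^d)$ is dense in every $\mathcal B_i$ and in every dual $\mathcal B_i'$. Assume that for some $K,C_*\ge1$, integers $\bar c,\hat c>0$ and $\vartheta\in(0,1)$: 1. $\mathcal L_S\in L(\mathcal B_i,\mathcal B_i)$ for $S\in\mathcal T$, $0\le i\le3$. 2. $\partial_{x_k}\in L(\mathcal B_{i+1},\mathcal B_i)$ for $1\le k\le d$, $0\le i\le2$. 3. $\|ah\|_{\mathcal B_i}\le C_*\|a\|_{C^{\bar ci+\hat c}}\|h\|_{\mathcal B_i}$ for $a\in C^{\bar ci+\hat c}\cap C^r$, $h\in\mathcal B_i$, $0\le i\le 3$, and $|\int h|\le C_*\|h\|_{\mathcal B_0}$ for $h\in\mathcal B_0$. 4. The unit ball of $\mathcal B_{i+1}$ is relatively compact in $\mathcal B_i$, $0\le i\le2$. 5. For all $n\in\mathbb N$ and $S_1,\dots,S_n\in\mathcal T$: $\|\mathcal L_{S_n}\cdots\mathcal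 L_{S_1}\phi\|_{\mathcal B_0}\le C_*\|\phi\|_{\mathcal B_0}$ for $\phi\in\mathcal B_0$, and $\|\mathcal L_{S_n}\cdots\mathcal L_{S_1}\phi\|_{\mathcal B_i}\le C_*\vartheta^n\|\phi\|_{\mathcal B_i}+K\|\phi\|_{\mathcal B_{i-1}}$ for $\phi\in\mathcal B_i$, $1\le i\le3$. 6. There is $\bar n$ such that for all $n\ge\bar n$, $S_1,\dots,S_n\in\mathcal T$ and $1\le i\le3$, the operator norm of $\mathcal L_{S_n}\cdots\mathcal L_{S_1}$ on $\{\phi\in\mathcal B_i:\int\phi=0\}$ is smaller than $\vartheta^n$. Put $\mathbb V=\{f\in\mathcal B_1:\int f=0\}$ and, for $K_\star>0$, $\mathbb W=\{h\in\mathcal B_1:\|h\|_{\mathcal B_1}\le K_\star,\ h\ge0,\ \int h=1\}$, where $h\ge 0$ means $\int\varphi h\ge 0$ for all $0\le\varphi\in C^r$. For $\nu\in[0,\nu_*]$, $h\in\mathbb W$ let $H(\nu,h)$ be the fixed point of $\mathcal L_{T_{\nu,h}}$ in $\mathbb W$ (for $K_\star$ large it exists and is unique), and $$F(\nu,h)=h-H(\nu,h)\in\mathbb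 V,\qquad \Theta(\nu,h)=-(\mathrm{Id}-\mathcal L_{T_{\nu,h}})^{-1}\sum_{k=1}^d\partial_{x_k}\mathcal L_{T_{\nu,h}}\bigl(\beta_kH(\nu,h)\bigr)\in\mathbb V,$$ the inverse being taken on $\mathbb V$. Derivatives of $F$ are taken within $[0,\nu_*]\times\mathbb W$: $D_hF(\nu,h):\mathbb V\to\mathbb V$ is the Fréchet derivative in the $\mathcal B_1$ topology along directions in $\mathbb V$, $D_\nu F\in\mathbb V$ is the derivative in $\nu$, and $D_h^2F(\nu,h):\mathbb V\times\mathbb V\to\mathcal B_0$ is the second derivative of $F$ regarded as a $\mathcal B_0$-valued map. **Theorem.** If $K_\star$ is large enough, the following holds. Let $\nu_0\in[0,\nu_*)$ and $h_0\in\mathbb W$ satisfy $F(\nu_0,h_0)=0$, and suppose that either $D_hF(\nu_0,h_0):\mathbb V\to\mathbb V$ is invertible, or the following three conditions hold: - (H1) $\operatorname{Range}(D_hF(\nu_0,h_0))\oplus\operatorname{span}\{D_\nu F(\nu_0,h_0)\}=\mathbb V$; - (H2) $\int\alpha\,D_h^2F(\nu_0,h_0)\bigl(\Theta(\nu_0,h_0),\Theta(\nu_0,h_0)\bigr)\ne0$;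 - (H3) $\int\alpha h_0\ne0$. Then there are $\delta>0$ and a map $(G,\mathbf h):(-\delta,\delta)\to[0,\nu_*]\times\mathbb W$, differentiable in the $\mathbb R\times\mathcal B_1$ topology, with $(G(0),\mathbf h(0))=(\nu_0,h_0)$ and $F(G(\tau),\mathbf h(\tau))=0$ for all $\tau$, such that every $(\nu,h)\in[0,\nu_*]\times\mathbb W$ with $F(\nu,h)=0$ and $|\nu-\nu_0|+\|h-h_0\|_{\mathcal B_1}\le\delta$ equals $(G(\tau),\mathbf h(\tau))$ for some $\tau\in(-\delta,\delta)$. Moreover: - if $D_hF(\nu_0,h_0)$ is invertible, then for every $\nu\in[0,\nu_*]$ close enough to $\nu_0$ there is exactly one $h\in\mathbb W$ with $|\nu-\nu_0|+\|h-h_0\|_{\mathcal B_1}\le\delta$ and $F(\nu,h)=0$; - if $\nu_0>0$ and $D_hF(\nu_0,h_0)$ is not invertible, then there is $\nu\in(0,\nu_*)$ for which $F(\nu,\cdot)=0$ has at least two solutions in $\mathbb W$. -/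

import Mathlib

open Set MeasureTheory
open scoped ContDiff BoundedContinuousFunction

universe u

namespace MeanField

noncomputable section

/-! ### Functions and maps on the torus `ℝ^d / ℤ^d` -/

/-- The torus `𝕋^d = ℝ^d / ℤ^d`. -/
abbrev Torus (d : ℕ) : Type := UnitAddTorus (Fin d)

/-- The covering map `ℝ^d → 𝕋^d` (reduction mod `1`). -/
def proj {d : ℕ} (x : Fin d → ℝ) : Torus d := fun i => (x i : UnitAddCircle)

theorem proj_add {d : ℕ} (x y : Fin d → ℝ) : proj (x + y) = proj x + proj y := by
  funext i; simp [proj]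

theorem proj_surjective {d : ℕ} : Function.Surjective (proj (d := d)) := by
  intro p
  choose x hx using fun i => QuotientAddGroup.mk_surjective (p i)
  exact ⟨x, funext hx⟩

/-- Every point of `ℝ^d` is an integer translate of a point of the unit cube. -/
theorem exists_cube {d : ℕ} (x : Fin d → ℝ) :
    ∃ n : Fin d → ℝ, proj n = 0 ∧ x + n ∈ Icc (0 : Fin d → ℝ) 1 := by
  refine ⟨fun i => -(⌊x i⌋ : ℝ), ?_, ?_, ?_⟩
  · funext i
    simp [proj]
  · intro i
    have := Int.floor_le (x i)
    simp only [Pi.zero_apply, Pi.add_apply]; linarith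
  · intro i
    have := Int.lt_floor_add_one (x i)
    simp only [Pi.one_apply, Pi.add_apply]; linarith

/-- The linear space `C^n(𝕋^d, ℝ)`: the functions whose `ℤ^d`-periodic lift is `C^n`. -/
def cSubmodule (d : ℕ) (n : ℕ∞) : Submodule ℝ (Torus d → ℝ) where
  carrier := {f | ContDiff ℝ n (f ∘ proj)}
  add_mem' {f g} hf hg := by
    simp only [mem_ofPred_eq] at hf hg ⊢
    exact ContDiff.add hf hg
  zero_mem' := by
    simp only [mem_ofPred_eq]
    exact contDiff_const
  smul_mem' c f hf := by
    simp only [mem_ofPred_eq] at hf ⊢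
    exact ContDiff.const_smul c hf

/-- Smooth functions on the torus. -/
abbrev SmoothFn (d : ℕ) : Type := cSubmodule d ⊤

/-- The space `C^r(𝕋^d, ℝ)` for finite `r`; its norm is defined below. -/
def TestFn (d r : ℕ) : Type := cSubmodule d (r : ℕ∞)

instance (d r : ℕ) : AddCommGroup (TestFn d r) := inferInstanceAs (AddCommGroup (cSubmodule d r))
instance (d r : ℕ) : Module ℝ (TestFn d r) := inferInstanceAs (Module ℝ (cSubmodule d r))
instance (d r : ℕ) : CoeFun (TestFn d r) (fun _ => Torus d → ℝ) := ⟨fun f => f.1⟩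

theorem TestFn.ext {d r : ℕ} {f g : TestFn d r} (h : ∀ x, f x = g x) : f = g :=
  Subtype.ext (funext h)

/-- A smooth function as a `C^r` function. -/
def SmoothFn.toTest {d : ℕ} (r : ℕ) (a : SmoothFn d) : TestFn d r :=
  ⟨a.1, by
    have h : ContDiff ℝ ((⊤ : ℕ∞) : WithTop ℕ∞) (a.1 ∘ proj) := a.2
    have h' : ContDiff ℝ ((r : ℕ∞) : WithTop ℕ∞) (a.1 ∘ proj) :=
      h.of_le (by exact_mod_cast le_top)
    exact h'⟩

/-- The constant function `1`. -/
def oneFn (d r : ℕ) : TestFn d r :=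
  ⟨fun _ => 1, by
    have h' : ContDiff ℝ ((r : ℕ∞) : WithTop ℕ∞) ((fun _ : Torus d => (1 : ℝ)) ∘ proj) :=
      contDiff_const
    exact h'⟩

/-- The periodic lift of a `C^r` function. -/
def lift {d r : ℕ} (f : TestFn d r) : (Fin d → ℝ) → ℝ := f.1 ∘ proj

theorem contDiff_lift {d r : ℕ} (f : TestFn d r) : ContDiff ℝ r (lift f) := f.2

theorem iteratedFDeriv_cube {d r : ℕ} (f : TestFn d r) (k : ℕ) (x : Fin d → ℝ) :
    ∃ y ∈ Icc (0 : Fin d → ℝ) 1, iteratedFDeriv ℝ k (lift f) x = iteratedFDeriv ℝ k (lift f) y := by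
  obtain ⟨n, hn, hx⟩ := exists_cube x
  refine ⟨x + n, hx, ?_⟩
  rw [← iteratedFDeriv_comp_add_right]
  congr 1
  funext z
  simp [lift, proj_add, hn]

theorem continuous_deriv {d r : ℕ} (k : Fin (r + 1)) (f : TestFn d r) :
    Continuous (iteratedFDeriv ℝ (k : ℕ) (lift f)) :=
  (contDiff_lift f).continuous_iteratedFDeriv (by exact_mod_cast Nat.lt_succ_iff.mp k.2)

theorem deriv_bounded {d r : ℕ} (k : Fin (r + 1)) (f : TestFn d r) :
    ∃ C : ℝ, ∀ x, ‖iteratedFDeriv ℝ (k : ℕ) (lift f) x‖ ≤ C := by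
  obtain ⟨C, hC⟩ := (isCompact_Icc (a := (0 : Fin d → ℝ)) (b := 1)).exists_bound_of_continuousOn
    (continuous_deriv k f).continuousOn
  refine ⟨C, fun x => ?_⟩
  obtain ⟨y, hy, hxy⟩ := iteratedFDeriv_cube f k x
  rw [hxy]; exact hC y hy

/-- Bounded continuous functions on `ℝ^d` with values in the `k`-linear forms. -/
abbrev DerivSpace (d k : ℕ) : Type := (Fin d → ℝ) →ᵇ ((Fin d → ℝ) [×k]→L[ℝ] ℝ)

/-- Tuples of such functions for `k = 0, …, r`, with the maximum norm. -/
def JetSpace (d r : ℕ) : Type := (k : Fin (r + 1)) → DerivSpace d k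

instance (d k : ℕ) : NormedAddCommGroup (DerivSpace d k) := inferInstance
instance (d k : ℕ) : NormedSpace ℝ (DerivSpace d k) := inferInstance
instance (d r : ℕ) : NormedAddCommGroup (JetSpace d r) :=
  Pi.normedAddCommGroup (G := fun k : Fin (r + 1) => DerivSpace d k)
instance (d r : ℕ) : NormedSpace ℝ (JetSpace d r) :=
  Pi.normedSpace (E := fun k : Fin (r + 1) => DerivSpace d k)

/-- The `k`-th derivative of the lift, as a bounded continuous function on `ℝ^d`. -/
def derivBCF {d r : ℕ} (k : Fin (r + 1)) (f : TestFn d r) :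
    DerivSpace d k :=
  BoundedContinuousFunction.ofNormedAddCommGroup (iteratedFDeriv ℝ (k : ℕ) (lift f))
    (continuous_deriv k f) (deriv_bounded k f).choose (deriv_bounded k f).choose_spec

/-- All derivatives of order at most `r`; the `C^r` norm is the maximum of their sup norms. -/
def jet (d r : ℕ) : TestFn d r →ₗ[ℝ] JetSpace d r where
  toFun f k := derivBCF k f
  map_add' f g := by
    funext k
    ext1 x
    have hk : ((k : ℕ) : WithTop ℕ∞) ≤ r := by exact_mod_cast Nat.lt_succ_iff.mp k.2
    exact iteratedFDeriv_add_apply ((contDiff_lift f).of_le hk).contDiffAt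
      ((contDiff_lift g).of_le hk).contDiffAt
  map_smul' c f := by
    funext k
    ext1 x
    have hk : ((k : ℕ) : WithTop ℕ∞) ≤ r := by exact_mod_cast Nat.lt_succ_iff.mp k.2
    exact iteratedFDeriv_const_smul_apply ((contDiff_lift f).of_le hk).contDiffAt

theorem jet_injective (d r : ℕ) : Function.Injective (jet d r) := by
  intro f g h
  refine TestFn.ext fun p => ?_
  obtain ⟨x, rfl⟩ := proj_surjective p
  have h1 : iteratedFDeriv ℝ 0 (lift f) x = iteratedFDeriv ℝ 0 (lift g) x := by
    have := congrArg (fun F => F (0 : Fin (r + 1)) x) h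
    exact this
  have h2 := congrArg (fun m => m 0) h1
  simp only [iteratedFDeriv_zero_apply] at h2
  exact h2

instance (d r : ℕ) : NormedAddCommGroup (TestFn d r) :=
  NormedAddCommGroup.induced _ _ (jet d r) (jet_injective d r)

instance (d r : ℕ) : NormedSpace ℝ (TestFn d r) := NormedSpace.induced ℝ _ _ (jet d r)

theorem TestFn.norm_def {d r : ℕ} (f : TestFn d r) : ‖f‖ = ‖jet d r f‖ := rfl

theorem TestFn.norm_le {d r : ℕ} (f : TestFn d r) {M : ℝ} (hM : 0 ≤ M)
    (h : ∀ k ≤ r, ∀ y ∈ Icc (0 : Fin d → ℝ) 1, ‖iteratedFDeriv ℝ k (lift f) y‖ ≤ M) :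
    ‖f‖ ≤ M := by
  refine (pi_norm_le_iff_of_nonneg (G := fun k : Fin (r + 1) => DerivSpace d k) hM).2 fun k => ?_
  rw [BoundedContinuousFunction.norm_le hM]
  intro x
  obtain ⟨y, hy, hxy⟩ := iteratedFDeriv_cube f k x
  have : jet d r f k x = iteratedFDeriv ℝ (k : ℕ) (lift f) x := rfl
  rw [this, hxy]
  exact h k (Nat.lt_succ_iff.mp k.2) y hy

theorem TestFn.le_norm {d r : ℕ} (f : TestFn d r) {k : ℕ} (hk : k ≤ r) (x : Fin d → ℝ) :
    ‖iteratedFDeriv ℝ k (lift f) x‖ ≤ ‖f‖ := by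
  have h1 := norm_le_pi_norm (jet d r f) ⟨k, Nat.lt_succ_iff.mpr hk⟩
  have h2 := (jet d r f ⟨k, Nat.lt_succ_iff.mpr hk⟩).norm_coe_le_norm x
  exact h2.trans h1

/-- `C^n` maps of the torus to itself: those with a `C^n` lift to `ℝ^d`. -/
structure TorusMap (d : ℕ) (n : ℕ∞) where
  toFun : Torus d → Torus d
  exists_lift : ∃ L : (Fin d → ℝ) → (Fin d → ℝ), ContDiff ℝ n L ∧ ∀ x, toFun (proj x) = proj (L x)

instance (d : ℕ) (n : ℕ∞) : CoeFun (TorusMap d n) (fun _ => Torus d → Torus d) := ⟨TorusMap.toFun⟩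

/-- Composition `S ∘ S'`. -/
def TorusMap.comp {d : ℕ} {n : ℕ∞} (S S' : TorusMap d n) : TorusMap d n where
  toFun := S ∘ S'
  exists_lift := by
    obtain ⟨L, hL, h⟩ := S.exists_lift
    obtain ⟨L', hL', h'⟩ := S'.exists_lift
    exact ⟨L ∘ L', hL.comp hL', fun x => by simp [h, h']⟩

/-! ### Operations on test functions -/

/-- Composition with a torus map: `g ↦ g ∘ S`. -/
def pull {d r : ℕ} (S : TorusMap d r) : TestFn d r →L[ℝ] TestFn d r :=
  LinearMap.mkContinuousOfExistsBound
    { toFun := fun g => ⟨g.1 ∘ S.toFun, by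
        obtain ⟨L, hL, h⟩ := S.exists_lift
        have h1 : (g.1 ∘ S.toFun) ∘ proj = lift g ∘ L := by funext x; simp [lift, h]
        have h2 : ContDiff ℝ ((r : ℕ∞) : WithTop ℕ∞) ((g.1 ∘ S.toFun) ∘ proj) := by
          rw [h1]; exact (contDiff_lift g).comp hL
        exact h2⟩
      map_add' := fun _ _ => rfl
      map_smul' := fun _ _ => rfl } (by
    obtain ⟨L, hL, h⟩ := S.exists_lift
    have hL' : ContDiff ℝ r L := hL
    have hb : ∀ k : Fin (r + 1), ∃ C : ℝ, ∀ y ∈ Icc (0 : Fin d → ℝ) 1,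
        ‖iteratedFDeriv ℝ (k : ℕ) L y‖ ≤ C := fun k =>
      (isCompact_Icc (a := (0 : Fin d → ℝ)) (b := 1)).exists_bound_of_continuousOn
        (hL'.continuous_iteratedFDeriv
          (by exact_mod_cast Nat.lt_succ_iff.mp k.2)).continuousOn
    choose C hC using hb
    obtain ⟨D, hD1, hD⟩ : ∃ D : ℝ, 1 ≤ D ∧ ∀ k, C k ≤ D := by
      refine ⟨1 + ∑ k, |C k|, by
        have := Finset.sum_nonneg (fun k (_ : k ∈ Finset.univ) => abs_nonneg (C k)); linarith,
        fun k => ?_⟩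
      have := Finset.single_le_sum (fun k _ => abs_nonneg (C k)) (Finset.mem_univ k)
      have := le_abs_self (C k)
      linarith
    refine ⟨(r.factorial : ℝ) * D ^ r, fun g => ?_⟩
    have hD0 : (0 : ℝ) ≤ D := by linarith
    refine TestFn.norm_le _ (by positivity) fun k hk y hy => ?_
    have h1 : (g.1 ∘ S.toFun) ∘ proj = lift g ∘ L := by funext x; simp [lift, h]
    change ‖iteratedFDeriv ℝ k ((g.1 ∘ S.toFun) ∘ proj) y‖ ≤ _
    rw [h1]
    have h3 := norm_iteratedFDeriv_comp_le (contDiff_lift g) hL' (n := k) (by exact_mod_cast hk) y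
      (C := ‖g‖) (D := D) (fun i hi => TestFn.le_norm g (hi.trans hk) _) (fun i hi1 hi =>
        ((hC ⟨i, by omega⟩ y hy).trans (hD _)).trans (le_self_pow₀ hD1 (by omega)))
    refine h3.trans ?_
    have h4 : (k.factorial : ℝ) ≤ r.factorial := by exact_mod_cast Nat.factorial_le hk
    have h5 : D ^ k ≤ D ^ r := pow_le_pow_right₀ hD1 hk
    calc (k.factorial : ℝ) * ‖g‖ * D ^ k ≤ r.factorial * ‖g‖ * D ^ r := by gcongr
      _ = _ := by ring)

theorem pull_apply {d r : ℕ} (S : TorusMap d r) (g : TestFn d r) (x : Torus d) :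
    pull S g x = g (S x) := rfl

/-- Multiplication by `a`: `g ↦ a g`. -/
def mulFn {d r : ℕ} (a : TestFn d r) : TestFn d r →L[ℝ] TestFn d r :=
  LinearMap.mkContinuousOfExistsBound
    { toFun := fun g => ⟨fun x => a x * g x, by
        have h2 : ContDiff ℝ ((r : ℕ∞) : WithTop ℕ∞) (fun x => lift a x * lift g x) :=
          (contDiff_lift a).mul (contDiff_lift g)
        exact h2⟩
      map_add' := fun f g => TestFn.ext fun x => mul_add (a x) (f x) (g x)
      map_smul' := fun c g => TestFn.ext fun x => mul_left_comm (a x) c (g x) } (by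
    refine ⟨2 ^ r * ‖a‖, fun g => ?_⟩
    refine TestFn.norm_le _ (by positivity) fun k hk y _ => ?_
    change ‖iteratedFDeriv ℝ k (fun x => lift a x * lift g x) y‖ ≤ _
    refine (norm_iteratedFDeriv_mul_le (contDiff_lift a) (contDiff_lift g) y
      (by exact_mod_cast hk)).trans ?_
    have h1 : ∀ i ∈ Finset.range (k + 1),
        (k.choose i : ℝ) * ‖iteratedFDeriv ℝ i (lift a) y‖ * ‖iteratedFDeriv ℝ (k - i) (lift g) y‖
          ≤ k.choose i * ‖a‖ * ‖g‖ := by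
      intro i hi
      have hi' := Finset.mem_range.mp hi
      have := TestFn.le_norm a (k := i) (by omega) y
      have := TestFn.le_norm g (k := k - i) (by omega) y
      gcongr
    refine (Finset.sum_le_sum h1).trans ?_
    rw [← Finset.sum_mul, ← Finset.sum_mul]
    have h2 : (∑ i ∈ Finset.range (k + 1), (k.choose i : ℝ)) = 2 ^ k := by
      exact_mod_cast Nat.sum_range_choose k
    rw [h2]
    have h3 : (2 : ℝ) ^ k ≤ 2 ^ r := pow_le_pow_right₀ one_le_two hk
    gcongr)

theorem mulFn_apply {d r : ℕ} (a g : TestFn d r) (x : Torus d) : mulFn a g x = a x * g x := rfl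

/-- The inclusion `C^{r+1} ⊂ C^r`. -/
def lowerFn (d r : ℕ) : TestFn d (r + 1) →L[ℝ] TestFn d r :=
  LinearMap.mkContinuousOfExistsBound
    { toFun := fun g => ⟨g.1, by
        have h2 : ContDiff ℝ ((r : ℕ∞) : WithTop ℕ∞) (lift g) :=
          (contDiff_lift g).of_le (by exact_mod_cast Nat.le_succ r)
        exact h2⟩
      map_add' := fun _ _ => rfl
      map_smul' := fun _ _ => rfl } (by
    refine ⟨1, fun g => ?_⟩
    rw [one_mul]
    exact TestFn.norm_le _ (norm_nonneg _) fun k hk y _ => TestFn.le_norm g (by omega) y)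

/-- The `k`-th partial derivative of a function on the torus. -/
def partialDeriv {d : ℕ} (k : Fin d) (f : Torus d → ℝ) (p : Torus d) : ℝ :=
  deriv (fun t : ℝ => f (p + proj (t • (Pi.single k 1 : Fin d → ℝ)))) 0

theorem partialDeriv_lift {d r : ℕ} (k : Fin d) (f : TestFn d (r + 1)) :
    partialDeriv k f.1 ∘ proj = fun x => fderiv ℝ (lift f) x (Pi.single k 1) := by
  funext x
  have hd : DifferentiableAt ℝ (lift f) x :=
    (contDiff_lift f).differentiable (by simp) x
  rw [← hd.lineDeriv_eq_fderiv]
  simp only [Function.comp, partialDeriv, lineDeriv, lift, proj_add]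

/-- `∂_{x_k} : C^{r+1} → C^r`. -/
def partialFn {d : ℕ} (r : ℕ) (k : Fin d) : TestFn d (r + 1) →L[ℝ] TestFn d r :=
  LinearMap.mkContinuousOfExistsBound
    { toFun := fun g => ⟨partialDeriv k g.1, by
        have h2 : ContDiff ℝ ((r : ℕ∞) : WithTop ℕ∞) (partialDeriv k g.1 ∘ proj) := by
          rw [partialDeriv_lift]
          exact ((contDiff_lift g).fderiv_right (by norm_cast)).clm_apply contDiff_const
        exact h2⟩
      map_add' := fun f g => TestFn.ext fun p => by
        obtain ⟨x, rfl⟩ := proj_surjective p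
        have hf := congrFun (partialDeriv_lift k f) x
        have hg := congrFun (partialDeriv_lift k g) x
        have hfg := congrFun (partialDeriv_lift k (f + g)) x
        have e : lift (f + g) = lift f + lift g := rfl
        have df : DifferentiableAt ℝ (lift f) x := (contDiff_lift f).differentiable (by simp) x
        have dg : DifferentiableAt ℝ (lift g) x := (contDiff_lift g).differentiable (by simp) x
        rw [e, fderiv_add df dg] at hfg
        change partialDeriv k (f + g).1 (proj x) =
          partialDeriv k f.1 (proj x) + partialDeriv k g.1 (proj x)
        simp only [Function.comp_apply] at hf hg hfg
        rw [hf, hg, hfg]; rfl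
      map_smul' := fun c f => TestFn.ext fun p => by
        obtain ⟨x, rfl⟩ := proj_surjective p
        have hf := congrFun (partialDeriv_lift k f) x
        have hg := congrFun (partialDeriv_lift k (c • f)) x
        have e : lift (c • f) = c • lift f := rfl
        have df : DifferentiableAt ℝ (lift f) x := (contDiff_lift f).differentiable (by simp) x
        rw [e, fderiv_const_smul df] at hg
        change partialDeriv k (c • f).1 (proj x) = c * partialDeriv k f.1 (proj x)
        simp only [Function.comp_apply] at hf hg
        rw [hf, hg]; rfl } (by
    let A : ((Fin d → ℝ) →L[ℝ] ℝ) →L[ℝ] ℝ := ContinuousLinearMap.apply ℝ ℝ (Pi.single k 1)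
    refine ⟨‖A‖, fun g => ?_⟩
    refine TestFn.norm_le _ (by positivity) fun j hj y _ => ?_
    change ‖iteratedFDeriv ℝ j (partialDeriv k g.1 ∘ proj) y‖ ≤ _
    rw [partialDeriv_lift]
    have h1 : ContDiff ℝ r (fderiv ℝ (lift g)) :=
      (contDiff_lift g).fderiv_right (by norm_cast)
    have h2 := A.norm_iteratedFDeriv_comp_left (n := j) h1.contDiffAt (x := y)
      (by exact_mod_cast hj)
    rw [norm_iteratedFDeriv_fderiv] at h2
    exact h2.trans (mul_le_mul_of_nonneg_left (TestFn.le_norm g (by omega) y) (norm_nonneg _)))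

/-! ### Distributions of order `r`, transfer operators, derivatives -/

/-- The dual Banach space `C^r(𝕋^d, ℝ)'`. -/
abbrev Dist (d r : ℕ) : Type := StrongDual ℝ (TestFn d r)

/-- The transfer operator `∫ g · 𝓛_S h = ∫ (g ∘ S) h`. -/
def transfer {d r : ℕ} (S : TorusMap d r) : Dist d r →L[ℝ] Dist d r :=
  (pull S).precomp ℝ

/-- The product `a h` of a function and a distribution. -/
def mulDist {d r : ℕ} (a : TestFn d r) : Dist d r →L[ℝ] Dist d r :=
  (mulFn a).precomp ℝ

/-- A distribution of order `r` regarded as one of order `r + 1`. -/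
def raise (d r : ℕ) : Dist d r →L[ℝ] Dist d (r + 1) :=
  (lowerFn d r).precomp ℝ

/-- The distributional derivative `∫ g ∂_{x_k} h = -∫ (∂_{x_k} g) h`. -/
def partialDist {d : ℕ} (r : ℕ) (k : Fin d) : Dist d r →L[ℝ] Dist d (r + 1) :=
  -(partialFn r k).precomp ℝ

/-- `𝓛_{S_n} ⋯ 𝓛_{S_1}` (the maps are numbered from `0`). -/
def transferSeq {d r : ℕ} (S : ℕ → TorusMap d r) : ℕ → Dist d r →L[ℝ] Dist d r
  | 0 => ContinuousLinearMap.id ℝ _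
  | n + 1 => (transfer (S n)).comp (transferSeq S n)

/-- The coupled map `x ↦ T(x) + ν β(x) a mod 1`; with `a = h(α)` this is `T_{ν,h}`. -/
def coupledMap {d : ℕ} (r : ℕ) (T : TorusMap d ⊤) (β : Fin d → SmoothFn d) (ν a : ℝ) :
    TorusMap d r where
  toFun x := T x + proj (fun i => ν * (β i).1 x * a)
  exists_lift := by
    obtain ⟨L, hL, h⟩ := T.exists_lift
    refine ⟨fun x => L x + fun i => ν * (β i).1 (proj x) * a, ?_, fun x => by
      rw [proj_add, h]⟩
    have hle : ((r : ℕ∞) : WithTop ℕ∞) ≤ ((⊤ : ℕ∞) : WithTop ℕ∞) := by exact_mod_cast le_top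
    refine (hL.of_le hle).add (contDiff_pi.2 fun i => ?_)
    have hb : ContDiff ℝ ((⊤ : ℕ∞) : WithTop ℕ∞) ((β i).1 ∘ proj) := (β i).2
    exact (contDiff_const.mul (hb.of_le hle)).mul contDiff_const

/-! ### The scale of Banach spaces -/

/-- Banach spaces `C^r(𝕋^d)' ⊃ B 0 ⊃ B 1 ⊃ B 2 ⊃ B 3 ⊃ C^r(𝕋^d)`, with non-increasing norms,
such that `C^r(𝕋^d)` is dense in each `B i` and in each dual `(B i)'`. The inclusions are the
injective maps `ι i` (into the distributions) and `incl i`. -/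
structure BanachScale (d r : ℕ) where
  B : Fin 4 → Type u
  [normed : ∀ i, NormedAddCommGroup (B i)]
  [space : ∀ i, NormedSpace ℝ (B i)]
  [complete : ∀ i, CompleteSpace (B i)]
  ι : ∀ i, B i →L[ℝ] Dist d r
  ι_injective : ∀ i, Function.Injective (ι i)
  incl : ∀ i : Fin 3, B i.succ →L[ℝ] B i.castSucc
  ι_incl : ∀ i h, ι i.castSucc (incl i h) = ι i.succ h
  norm_incl_le : ∀ i h, ‖incl i h‖ ≤ ‖h‖
  exists_of_testFn : ∀ f : TestFn d r, ∃ h : B 3, ∀ g : TestFn d r, ι 3 h g = ∫ x, f x * g x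
  dense_testFn : ∀ i, Dense {h : B i | ∃ f : TestFn d r, ∀ g : TestFn d r,
    ι i h g = ∫ x, f x * g x}
  dense_testFn_dual : ∀ i, Dense {l : StrongDual ℝ (B i) | ∃ f : TestFn d r, ∀ h, l h = ι i h f}

attribute [instance] BanachScale.normed BanachScale.space BanachScale.complete

namespace BanachScale

variable {d r : ℕ} (X : BanachScale.{u} d r)

/-- `∫ φ h` for `h` in one of the spaces of the scale. -/
def pairing {i : Fin 4} (h : X.B i) (φ : TestFn d r) : ℝ := X.ι i h φ

/-- `∫ h`. -/
def integral {i : Fin 4} (h : X.B i) : ℝ := X.pairing h (oneFn d r)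

/-- The standing assumptions on the scale of spaces and on the set `𝒯` of maps. -/
structure Assumptions (𝒯 : Set (TorusMap d r)) (K C ϑ : ℝ) (c c' : ℕ) : Prop where
  one_le_K : 1 ≤ K
  one_le_C : 1 ≤ C
  c_pos : 0 < c
  c'_pos : 0 < c'
  ϑ_mem : ϑ ∈ Ioo (0 : ℝ) 1
  /-- `𝓛_S` is bounded on each `B i`. -/
  transfer_bounded : ∀ S ∈ 𝒯, ∀ i, ∃ A : X.B i →L[ℝ] X.B i, ∀ h,
    X.ι i (A h) = transfer S (X.ι i h)
  /-- `∂_{x_k}` is bounded from `B (i+1)` to `B i`. -/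
  partial_bounded : ∀ (k : Fin d) (i : Fin 3), ∃ A : X.B i.succ →L[ℝ] X.B i.castSucc, ∀ h,
    raise d r (X.ι i.castSucc (A h)) = partialDist r k (X.ι i.succ h)
  /-- Multiplication by `a` is bounded on `B i` in terms of the `C^{c i + c'}` norm of `a`. -/
  mul_bounded : ∀ (i : Fin 4) (a : TestFn d r) (a' : TestFn d (c * i + c')), (∀ x, a x = a' x) →
    ∀ h : X.B i, ∃ u : X.B i, X.ι i u = mulDist a (X.ι i h) ∧ ‖u‖ ≤ C * ‖a'‖ * ‖h‖
  integral_bounded : ∀ h : X.B 0, |X.integral h| ≤ C * ‖h‖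
  /-- The unit ball of `B (i+1)` is relatively compact in `B i`. -/
  compact_incl : ∀ i : Fin 3, IsCompact (closure (X.incl i '' Metric.closedBall 0 1))
  /-- Power bound on `B 0`, uniform along sequences of maps. -/
  weak_bound : ∀ (n : ℕ) (S : ℕ → TorusMap d r), (∀ j < n, S j ∈ 𝒯) → ∀ φ : X.B 0,
    ∃ u : X.B 0, X.ι 0 u = transferSeq S n (X.ι 0 φ) ∧ ‖u‖ ≤ C * ‖φ‖
  /-- Lasota-Yorke inequalities, uniform along sequences of maps. -/
  lasota_yorke : ∀ (n : ℕ) (S : ℕ → TorusMap d r), (∀ j < n, S j ∈ 𝒯) → ∀ (i : Fin 3)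
    (φ : X.B i.succ), ∃ u : X.B i.succ, X.ι i.succ u = transferSeq S n (X.ι i.succ φ) ∧
      ‖u‖ ≤ C * ϑ ^ n * ‖φ‖ + K * ‖X.incl i φ‖
  /-- Contraction on the mean-zero elements of `B 1`, `B 2`, `B 3`: the operator norm there of
  `n`-fold compositions is smaller than `ϑ ^ n` for all large `n`. -/
  contraction : ∃ N : ℕ, ∀ n ≥ N, ∀ S : ℕ → TorusMap d r, (∀ j < n, S j ∈ 𝒯) → ∀ i : Fin 3,
    ∃ q < ϑ ^ n, ∀ φ : X.B i.succ, X.integral φ = 0 →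
      ∃ u : X.B i.succ, X.ι i.succ u = transferSeq S n (X.ι i.succ φ) ∧ ‖u‖ ≤ q * ‖φ‖

/-- `𝕎`: the elements `h ≥ 0` of `B 1` with `∫ h = 1` and `‖h‖ ≤ R`. -/
def W (R : ℝ) : Set (X.B 1) :=
  {h | ‖h‖ ≤ R ∧ (∀ φ : TestFn d r, (∀ x, 0 ≤ φ x) → 0 ≤ X.pairing h φ) ∧ X.integral h = 1}

/-- `𝕍`: the elements of `B 1` with zero integral. -/
def V : Submodule ℝ (X.B 1) where
  carrier := {f | X.integral f = 0}
  add_mem' {f g} hf hg := by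
    simp only [mem_ofPred_eq, integral, pairing, map_add, _root_.add_apply] at *
    rw [hf, hg, add_zero]
  zero_mem' := by simp [integral, pairing]
  smul_mem' a f hf := by
    simp only [mem_ofPred_eq, integral, pairing, map_smul, _root_.smul_apply] at *
    rw [hf, smul_zero]

end BanachScale

/-! ### The mean field system -/

/-- The data of the problem: the site map `T`, the coupling functions `α`, `β`, the scale of
Banach spaces, and the maximal coupling strength `νmax`. The radius `R` of `𝕎` is an explicit
parameter below. -/
structure System (d r : ℕ) where
  T : TorusMap d ⊤
  α : SmoothFn d
  β : Fin d → SmoothFn d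
  X : BanachScale.{u} d r
  νmax : ℝ

namespace System

variable {d r : ℕ} (Y : System.{u} d r)

/-- The functional `h ↦ ∫ α h`. -/
def Z {i : Fin 4} (h : Y.X.B i) : ℝ := Y.X.pairing h (Y.α.toTest r)

/-- The map `T_{ν,h}`. -/
def map (ν : ℝ) (h : Y.X.B 1) : TorusMap d r := coupledMap r Y.T Y.β ν (Y.Z h)

/-- `H(ν,h)`: the invariant probability measure of `T_{ν,h}` that belongs to `𝕎`. -/
def H (R ν : ℝ) (h : Y.X.B 1) : Y.X.B 1 :=
  Classical.epsilon fun u => u ∈ Y.X.W R ∧ transfer (Y.map ν h) (Y.X.ι 1 u) = Y.X.ι 1 u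

/-- `F(ν,h) = h - H(ν,h)`. -/
def F (R ν : ℝ) (h : Y.X.B 1) : Y.X.B 1 := h - Y.H R ν h

/-- `Θ(ν,h) = -(Id - 𝓛)⁻¹ div (𝓛 (β H(ν,h)))`, where `𝓛` is the transfer operator of `T_{ν,h}` and
`Id - 𝓛` is inverted on `𝕍`. -/
def Θ (R ν : ℝ) (h : Y.X.B 1) : Y.X.V :=
  Classical.epsilon fun θ =>
    raise d r (Y.X.ι 1 θ - transfer (Y.map ν h) (Y.X.ι 1 θ)) =
      -∑ k, partialDist r k
        (transfer (Y.map ν h) (mulDist ((Y.β k).toTest r) (Y.X.ι 1 (Y.H R ν h))))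

/-- The directions `φ ∈ 𝕍` with `h + φ ∈ 𝕎`. -/
def directions (R : ℝ) (h : Y.X.B 1) : Set Y.X.V := {φ | h + (φ : Y.X.B 1) ∈ Y.X.W R}

/-- The Fréchet derivative `D_h F(ν,h)` along `𝕎`, a linear map on `𝕍`. -/
def DhF (R ν : ℝ) (h : Y.X.B 1) : Y.X.V →L[ℝ] Y.X.B 1 :=
  fderivWithin ℝ (fun φ : Y.X.V => Y.F R ν (h + φ)) (Y.directions R h) 0

/-- The derivative `D_ν F(ν,h)` along `[0, νmax]`. -/
def DνF (R ν : ℝ) (h : Y.X.B 1) : Y.X.B 1 :=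
  derivWithin (fun s => Y.F R s h) (Icc 0 Y.νmax) ν

/-- The inclusion of `B 1` in `B 0`. -/
def incl₁₀ : Y.X.B 1 →L[ℝ] Y.X.B 0 := Y.X.incl 0

/-- The second derivative `D_h² F(ν,h)` along `𝕎`, where `F` is regarded as taking values
in `B 0`. -/
def DhhF (R ν : ℝ) (h : Y.X.B 1) : Y.X.V →L[ℝ] Y.X.V →L[ℝ] Y.X.B 0 :=
  fderivWithin ℝ (fun φ : Y.X.V => Y.incl₁₀.comp (Y.DhF R ν (h + φ))) (Y.directions R h) 0

/-- `D_h F(ν,h)` is invertible: it is an isomorphism of `𝕍` onto `𝕍`. -/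
def DhFInvertible (R ν : ℝ) (h : Y.X.B 1) : Prop :=
  ∃ e : Y.X.V ≃L[ℝ] Y.X.V, ∀ φ, (e φ : Y.X.B 1) = Y.DhF R ν h φ

/-- Range transversality: `𝕍` is the direct sum of the range of `D_h F` and the line of `D_ν F`. -/
def H1 (R ν : ℝ) (h : Y.X.B 1) : Prop :=
  Disjoint (LinearMap.range (Y.DhF R ν h).toLinearMap) (Submodule.span ℝ {Y.DνF R ν h}) ∧
    LinearMap.range (Y.DhF R ν h).toLinearMap ⊔ Submodule.span ℝ {Y.DνF R ν h} = Y.X.V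

/-- Nonvanishing of `∫ α D_h² F (Θ, Θ)`. -/
def H2 (R ν : ℝ) (h : Y.X.B 1) : Prop := Y.Z (Y.DhhF R ν h (Y.Θ R ν h) (Y.Θ R ν h)) ≠ 0

/-- Nonvanishing of `∫ α h`. -/
def H3 (h : Y.X.B 1) : Prop := Y.Z h ≠ 0

end System

end

end MeanField

/-!
The invariant probability measure `H(ν, h)` depends on `(ν, h)` only through the real number
`s = ν ∫ α h`, because `T_{ν,h} = T + s β` (`coupledMap_eq`). Writing `η(s)` for the invariant
probability measure of `T + s β` and `g(s) = ∫ α η(s)`, the solutions of `F(ν, h) = 0` are the pairs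
with `h = η(s)` and `s = ν g(s)`, so the problem is a scalar one. The admissible values of `s` form
an interval `J`: the mean of `α` with respect to an element of `𝕎` is a value of `α`
(`System.exists_α_eq_Z`), and Dirac measures show that `T + s β` belongs to the given class of maps.

The analytic input is linear response (`Assumptions.exists_linear_response`): `η` satisfies a
uniform first-order Taylor formula in `B 1` on `J`, with derivative
`θ(s) = -(1 - 𝓛)⁻¹ ∑ ∂_{x_k} 𝓛 (β_k η(s))`. Exponential contraction on mean-zero elements gives
`η(s)` in `B 3` and bounds `(1 - 𝓛)⁻¹` on the mean-zero part of `B 1`, `B 2` and `B 3`. The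
dependence of `𝓛` on `s` is controlled, with a loss of one space of the scale per derivative, by
testing `C^r` densities against `C^{r+1}` functions (`Assumptions.norm_incl_transferOp_sub_le`).
Such functions determine the norms of the scale because `C^r` is dense in the duals and `C^{r+1}` is
dense in `C^r` by mollification (`denseRange_lowerFn`). That density also makes the equation that
defines `Θ` uniquely solvable, so that `Θ(ν, h) = θ(ν ∫ α h)`.

Derivatives along `𝕎` are unique since the smooth densities span a dense set of directions
(`System.uniqueDiffWithinAt_directions`). Hence `D_h F(ν, h) φ = φ - ν (∫ α φ) θ(s)`, which is
invertible iff `ν g'(s) ≠ 1` (`LinearResponse.DhFInvertible_iff`).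

Near a solution with `∫ α h₀ ≠ 0`, the solution set is the graph `ν = N(s) = s / g(s)`, `h = η(s)`,
and it is parametrized by `s` itself, or by `± τ²` if `ν₀ = 0`, where only one side of `s = 0` is
admissible. If `∫ α h₀ = 0`, then `D_h F` is invertible by assumption, and the solutions near
`(ν₀, h₀)` are the pairs `(ν, h₀)`. If `ν₀ g'(s₀) ≠ 1`, then `s = ν g(s)` has at most one solution
near `s₀` for each `ν` near `ν₀`, and one exists by the intermediate value theorem. If
`ν₀ g'(s₀) = 1`, the nondegeneracy of the second derivative gives `s ↦ ν₀ g'(ν₀ g(s))` a nonzero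
derivative at `s₀` (`LinearResponse.hasDerivAt_of_H2`), so `N` has a strict local extremum at `s₀`
and takes nearby values on one side twice (`eventually_fold`, `exists_two_preimages`).
-/

namespace MeanField

noncomputable section

open Filter Topology
open scoped Convolution

/-! ### Functions on the torus and their periodic lifts -/

theorem isOpenQuotientMap_proj {d : ℕ} : IsOpenQuotientMap (proj (d := d)) :=
  IsOpenQuotientMap.piMap fun _ => QuotientAddGroup.isOpenQuotientMap_mk

theorem continuous_proj {d : ℕ} : Continuous (proj (d := d)) :=
  isOpenQuotientMap_proj.continuous

theorem continuous_of_comp_proj {d : ℕ} {Y : Type*} [TopologicalSpace Y] {f : Torus d → Y}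
    (h : Continuous (f ∘ proj)) : Continuous f :=
  isOpenQuotientMap_proj.isQuotientMap.continuous_iff.2 h

theorem TestFn.continuous {d r : ℕ} (f : TestFn d r) : Continuous f.1 :=
  continuous_of_comp_proj (contDiff_lift f).continuous

theorem SmoothFn.continuous {d : ℕ} (a : SmoothFn d) : Continuous a.1 :=
  TestFn.continuous (a.toTest 0)

theorem TorusMap.continuous {d : ℕ} {n : ℕ∞} (S : TorusMap d n) : Continuous S.toFun := by
  obtain ⟨L, hL, h⟩ := S.exists_lift
  refine continuous_of_comp_proj ?_
  have : S.toFun ∘ proj = proj ∘ L := funext h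
  rw [this]
  exact continuous_proj.comp hL.continuous

theorem integrable_of_continuous {d : ℕ} {f : Torus d → ℝ} (hf : Continuous f) :
    Integrable f volume :=
  hf.integrable_of_hasCompactSupport (HasCompactSupport.of_compactSpace f)

theorem TestFn.abs_le_norm {d r : ℕ} (f : TestFn d r) (p : Torus d) : |f p| ≤ ‖f‖ := by
  obtain ⟨x, rfl⟩ := proj_surjective p
  have h := TestFn.le_norm f (Nat.zero_le r) x
  rwa [norm_iteratedFDeriv_zero] at h

/-! ### Mollification: `C^{r+1}` is dense in `C^r` -/

section Mollify

variable {d : ℕ} {F : Type*} [NormedAddCommGroup F] [NormedSpace ℝ F]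

/-- The convolution of `f` with a normalized smooth bump. -/
def mollify (φ : ContDiffBump (0 : Fin d → ℝ)) (f : (Fin d → ℝ) → F) : (Fin d → ℝ) → F :=
  φ.normed volume ⋆[ContinuousLinearMap.lsmul ℝ ℝ, volume] f

theorem mollify_apply (φ : ContDiffBump (0 : Fin d → ℝ)) (f : (Fin d → ℝ) → F) (x : Fin d → ℝ) :
    mollify φ f x = ∫ t, φ.normed volume t • f (x - t) := rfl

theorem integrable_normed_smul (φ : ContDiffBump (0 : Fin d → ℝ)) {f : (Fin d → ℝ) → F}
    (hf : Continuous f) (x : Fin d → ℝ) :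
    Integrable fun t => φ.normed volume t • f (x - t) := by
  refine Continuous.integrable_of_hasCompactSupport ?_ ?_
  · exact φ.continuous_normed.smul (hf.comp (continuous_const.sub continuous_id))
  · exact φ.hasCompactSupport_normed.smul_right

theorem hasFDerivAt_mollify (φ : ContDiffBump (0 : Fin d → ℝ)) {f : (Fin d → ℝ) → F}
    (hf : ContDiff ℝ 1 f) {M : ℝ} (hM : ∀ x, ‖fderiv ℝ f x‖ ≤ M) (x : Fin d → ℝ) :
    HasFDerivAt (mollify φ f) (mollify φ (fderiv ℝ f) x) x := by
  have hf' : Continuous (fderiv ℝ f) := hf.continuous_fderiv one_ne_zero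
  refine hasFDerivAt_integral_of_dominated_of_fderiv_le (μ := volume) (s := univ)
    (F := fun x t => φ.normed volume t • f (x - t))
    (F' := fun x t => φ.normed volume t • fderiv ℝ f (x - t))
    (bound := fun t => ‖φ.normed volume t‖ * M) univ_mem ?_ ?_ ?_ ?_ ?_ ?_
  · exact Eventually.of_forall fun y =>
      (integrable_normed_smul φ hf.continuous y).aestronglyMeasurable
  · exact integrable_normed_smul φ hf.continuous x
  · exact (integrable_normed_smul φ hf' x).aestronglyMeasurable
  · refine Eventually.of_forall fun t y _ => ?_
    rw [norm_smul]
    exact mul_le_mul_of_nonneg_left (hM _) (norm_nonneg _)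
  · exact φ.integrable_normed.norm.mul_const M
  · refine Eventually.of_forall fun t y _ => ?_
    have h1 : HasFDerivAt f (fderiv ℝ f (y - t)) (y - t) :=
      (hf.differentiable one_ne_zero _).hasFDerivAt
    have h2 : HasFDerivAt (fun y => f (y - t)) (fderiv ℝ f (y - t)) y :=
      hasFDerivAt_comp_sub t |>.2 h1
    exact h2.const_smul _

theorem mollify_comp {G : Type*} [NormedAddCommGroup G] [NormedSpace ℝ G]
    (φ : ContDiffBump (0 : Fin d → ℝ)) (A : F ≃ₗᵢ[ℝ] G) (f : (Fin d → ℝ) → F) (x : Fin d → ℝ) :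
    A (mollify φ f x) = mollify φ (A ∘ f) x := by
  rw [mollify_apply, mollify_apply]
  refine (A.toContinuousLinearEquiv.integral_comp_comm _).symm.trans ?_
  exact integral_congr_ae (Eventually.of_forall fun t => map_smul A _ _)

theorem contDiff_mollify (φ : ContDiffBump (0 : Fin d → ℝ)) {f : (Fin d → ℝ) → ℝ}
    (hf : Continuous f) (n : ℕ) : ContDiff ℝ n (mollify φ f) :=
  φ.hasCompactSupport_normed.contDiff_convolution_left _ (φ.contDiff_normed)
    hf.locallyIntegrable

theorem iteratedFDeriv_mollify {r : ℕ} (φ : ContDiffBump (0 : Fin d → ℝ)) (f : TestFn d r)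
    (k : ℕ) (hk : k ≤ r) :
    iteratedFDeriv ℝ k (mollify φ (lift f)) = mollify φ (iteratedFDeriv ℝ k (lift f)) := by
  induction k with
  | zero =>
    funext x
    rw [iteratedFDeriv_zero_eq_comp, iteratedFDeriv_zero_eq_comp, Function.comp_apply,
      ← mollify_comp φ (continuousMultilinearCurryFin0 ℝ (Fin d → ℝ) ℝ).symm]
  | succ k ih =>
    have hk' : k ≤ r := by omega
    have hc : ContDiff ℝ 1 (iteratedFDeriv ℝ k (lift f)) := by
      refine (contDiff_lift f).iteratedFDeriv_right ?_
      exact_mod_cast (by omega : 1 + k ≤ r)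
    have hb : ∀ x, ‖fderiv ℝ (iteratedFDeriv ℝ k (lift f)) x‖ ≤ ‖f‖ := fun x => by
      rw [norm_fderiv_iteratedFDeriv]
      exact TestFn.le_norm f hk x
    funext x
    rw [iteratedFDeriv_succ_eq_comp_left, iteratedFDeriv_succ_eq_comp_left, ih hk',
      Function.comp_apply, (hasFDerivAt_mollify φ hc hb x).fderiv]
    exact mollify_comp (F := (Fin d → ℝ) →L[ℝ] ((Fin d → ℝ) [×k]→L[ℝ] ℝ))
      (G := (Fin d → ℝ) [×(k + 1)]→L[ℝ] ℝ) φ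
      (continuousMultilinearCurryLeftEquiv ℝ (fun _ : Fin (k + 1) => Fin d → ℝ) ℝ).symm _ x

/-- The mollified function descends to the torus. -/
theorem mollify_factors {r : ℕ} (φ : ContDiffBump (0 : Fin d → ℝ)) (f : TestFn d r) :
    (fun p : Torus d => ∫ t, φ.normed volume t • f.1 (p - proj t)) ∘ proj =
      mollify φ (lift f) := by
  funext x
  rw [mollify_apply]
  have h (t : Fin d → ℝ) : proj (x - t) = proj x - proj t := by
    funext i
    simp [proj]
  simp only [Function.comp_apply, lift, h]

theorem denseRange_lowerFn (d r : ℕ) : DenseRange (lowerFn d r) := by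
  intro f
  rw [Metric.mem_closure_iff]
  intro ε hε
  -- one modulus of continuity serves all derivatives of order at most `r`
  have huc : ∃ δ > 0, ∀ k ≤ r, ∀ x ∈ Icc (0 : Fin d → ℝ) 1, ∀ y, dist y x < δ →
      dist (iteratedFDeriv ℝ k (lift f) y) (iteratedFDeriv ℝ k (lift f) x) < ε / 2 := by
    have h1 : ∀ k : Fin (r + 1), ∃ δ > 0, ∀ x ∈ Icc (0 : Fin d → ℝ) 1, ∀ y, dist y x < δ →
        dist (iteratedFDeriv ℝ k (lift f) y) (iteratedFDeriv ℝ k (lift f) x) < ε / 2 := by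
      intro k
      have hK : IsCompact (Icc (0 : Fin d → ℝ) 1) := isCompact_Icc
      have h2 := hK.uniformContinuousAt_of_continuousAt
        (iteratedFDeriv ℝ k (lift f)) (fun x _ => (continuous_deriv k f).continuousAt)
        (Metric.dist_mem_uniformity (half_pos hε))
      obtain ⟨δ, hδ, h⟩ := Metric.mem_uniformity_dist.1 h2
      refine ⟨δ, hδ, fun x hx y hy => ?_⟩
      rw [dist_comm] at hy ⊢
      exact h hy hx
    choose δ hδ h using h1
    obtain ⟨k₀, -, hk₀⟩ := Finset.exists_min_image Finset.univ δ ⟨0, Finset.mem_univ _⟩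
    exact ⟨δ k₀, hδ k₀, fun k hk x hx y hy => h ⟨k, by omega⟩ x hx y
      (hy.trans_le (hk₀ _ (Finset.mem_univ _)))⟩
  obtain ⟨δ, hδ, h⟩ := huc
  let φ : ContDiffBump (0 : Fin d → ℝ) := ⟨δ / 2, δ, half_pos hδ, half_lt_self hδ⟩
  let g : TestFn d (r + 1) := ⟨fun p => ∫ t, φ.normed volume t • f.1 (p - proj t), by
    have h2 : ContDiff ℝ (((r + 1 : ℕ) : ℕ∞) : WithTop ℕ∞)
        ((fun p : Torus d => ∫ t, φ.normed volume t • f.1 (p - proj t)) ∘ proj) := by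
      rw [mollify_factors]
      exact contDiff_mollify φ (contDiff_lift f).continuous (r + 1)
    exact h2⟩
  have hg : lift (lowerFn d r g) = mollify φ (lift f) := mollify_factors φ f
  refine ⟨_, ⟨g, rfl⟩, ?_⟩
  rw [dist_comm, dist_eq_norm]
  refine (TestFn.norm_le _ (half_pos hε).le fun k hk y hy => ?_).trans_lt (half_lt_self hε)
  have hk' : ((k : ℕ) : WithTop ℕ∞) ≤ r := by exact_mod_cast hk
  have e : lift (lowerFn d r g - f) = lift (lowerFn d r g) - lift f := rfl
  rw [e, iteratedFDeriv_sub_apply ((contDiff_lift _).of_le hk').contDiffAt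
    ((contDiff_lift f).of_le hk').contDiffAt, hg, iteratedFDeriv_mollify φ f k hk, ← dist_eq_norm]
  have hc : Continuous (iteratedFDeriv ℝ k (lift f)) := continuous_deriv ⟨k, by omega⟩ f
  exact φ.dist_normed_convolution_le hc.aestronglyMeasurable
    fun z hz => (h k hk y hy z hz).le

end Mollify

/-! ### The family of maps `T + s β` and its transfer operators on smooth densities -/

section Family

variable {d : ℕ}

/-- The coupled map depends on the coupling strength and on the mean only through their
product. -/
theorem coupledMap_eq (r : ℕ) (T : TorusMap d ⊤) (β : Fin d → SmoothFn d) (ν a : ℝ) :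
    coupledMap r T β ν a = coupledMap r T β 1 (ν * a) := by
  unfold coupledMap
  congr 1
  funext x
  congr 2
  funext i
  ring

theorem hasDerivAt_comp_coupledMap {r : ℕ} (T : TorusMap d ⊤) (β : Fin d → SmoothFn d)
    (f : TestFn d (r + 1)) (p : Torus d) (t : ℝ) :
    HasDerivAt (fun t => f (coupledMap r T β 1 t p))
      (∑ k, (β k).1 p * partialFn r k f (coupledMap r T β 1 t p)) t := by
  obtain ⟨x, hx⟩ := proj_surjective (T p)
  let b : Fin d → ℝ := fun i => (β i).1 p
  have h1 (t : ℝ) : coupledMap r T β 1 t p = proj (x + t • b) := by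
    rw [proj_add, hx]
    change T p + proj _ = T p + proj _
    congr 2
    funext i
    simp only [b, Pi.smul_apply, smul_eq_mul]
    ring
  have hd : HasFDerivAt (lift f) (fderiv ℝ (lift f) (x + t • b)) (x + t • b) :=
    ((contDiff_lift f).differentiable (by simp) _).hasFDerivAt
  have hl : HasDerivAt (fun t : ℝ => x + t • b) b t := by
    simpa using ((hasDerivAt_id t).smul_const b).const_add x
  have h2 := hd.comp_hasDerivAt t hl
  have h3 : (fun t => f (coupledMap r T β 1 t p)) = lift f ∘ fun t => x + t • b := by
    funext t
    rw [h1]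
    rfl
  have h4 : (∑ k, (β k).1 p * partialFn r k f (coupledMap r T β 1 t p)) =
      fderiv ℝ (lift f) (x + t • b) b := by
    have h6 : b = ∑ k, b k • (Pi.single k 1 : Fin d → ℝ) := by
      funext j
      simp [Finset.sum_apply, Pi.single_apply]
    refine Eq.trans ?_ (congrArg (fderiv ℝ (lift f) (x + t • b)) h6).symm
    rw [map_sum]
    refine Finset.sum_congr rfl fun k _ => ?_
    rw [map_smul, h1]
    have h5 := congrFun (partialDeriv_lift k f) (x + t • b)
    simp only [Function.comp_apply] at h5
    change b k * partialDeriv k f.1 (proj (x + t • b)) = _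
    rw [h5, smul_eq_mul]
  rw [h3, h4]
  exact h2

/-- For a distribution with `C^r` density, `s ↦ 𝓛_{T + s β} u` is weakly differentiable against
`C^{r+1}` functions, with derivative `-∑ ∂_{x_k} 𝓛_{T + s β} (β_k u)`. -/
theorem hasDerivAt_transfer {r : ℕ} (T : TorusMap d ⊤) (β : Fin d → SmoothFn d)
    {u : Dist d r} {w : TestFn d r} (hu : ∀ g : TestFn d r, u g = ∫ x, w x * g x)
    (f : TestFn d (r + 1)) (t : ℝ) :
    HasDerivAt (fun t => transfer (coupledMap r T β 1 t) u (lowerFn d r f))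
      ((-∑ k, partialDist r k (transfer (coupledMap r T β 1 t)
        (mulDist ((β k).toTest r) u))) f) t := by
  have hβ (k : Fin d) : Continuous (β k).1 := (β k).continuous
  have hcont (t : ℝ) : Continuous fun p =>
      w p * ∑ k, (β k).1 p * partialFn r k f (coupledMap r T β 1 t p) :=
    w.continuous.mul (continuous_finsetSum _ fun k _ => (hβ k).mul
      ((partialFn r k f).continuous.comp (coupledMap r T β 1 t).continuous))
  have h1 := (hasDerivAt_integral_of_dominated_loc_of_deriv_le (μ := (volume : Measure (Torus d)))
    (F := fun t p => w p * f (coupledMap r T β 1 t p))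
    (F' := fun t p => w p * ∑ k, (β k).1 p * partialFn r k f (coupledMap r T β 1 t p))
    (bound := fun p => |w p| * ∑ k, |(β k).1 p| * ‖partialFn r k f‖) (x₀ := t) (s := univ)
    univ_mem ?_ ?_ ?_ ?_ ?_ ?_).2
  · have e1 : (fun t => transfer (coupledMap r T β 1 t) u (lowerFn d r f)) =
        fun t => ∫ p, w p * f (coupledMap r T β 1 t p) := by
      funext t
      exact hu _
    have e2 : (-∑ k, partialDist r k (transfer (coupledMap r T β 1 t)
        (mulDist ((β k).toTest r) u))) f =
        ∫ p, w p * ∑ k, (β k).1 p * partialFn r k f (coupledMap r T β 1 t p) := by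
      have e3 (k : Fin d) : partialDist r k (transfer (coupledMap r T β 1 t)
          (mulDist ((β k).toTest r) u)) f =
          -∫ p, w p * ((β k).1 p * partialFn r k f (coupledMap r T β 1 t p)) := by
        exact congrArg Neg.neg
          (hu (mulFn ((β k).toTest r) (pull (coupledMap r T β 1 t) (partialFn r k f))))
      rw [_root_.neg_apply, _root_.sum_apply]
      simp only [e3, Finset.sum_neg_distrib, neg_neg, Finset.mul_sum]
      rw [integral_finsetSum]
      exact fun k _ => integrable_of_continuous (w.continuous.mul ((hβ k).mul
        ((partialFn r k f).continuous.comp (coupledMap r T β 1 t).continuous)))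
    rw [e1, e2]
    exact h1
  · exact Eventually.of_forall fun t => (integrable_of_continuous (w.continuous.mul
      (f.continuous.comp (coupledMap r T β 1 t).continuous))).aestronglyMeasurable
  · exact integrable_of_continuous (w.continuous.mul
      (f.continuous.comp (coupledMap r T β 1 t).continuous))
  · exact (integrable_of_continuous (hcont t)).aestronglyMeasurable
  · refine Eventually.of_forall fun p t _ => ?_
    rw [Real.norm_eq_abs, abs_mul]
    refine mul_le_mul_of_nonneg_left ((Finset.abs_sum_le_sum_abs _ _).trans
      (Finset.sum_le_sum fun k _ => ?_)) (abs_nonneg _)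
    rw [abs_mul]
    exact mul_le_mul_of_nonneg_left (TestFn.abs_le_norm _ _) (abs_nonneg _)
  · exact integrable_of_continuous (w.continuous.abs.mul
      (continuous_finsetSum _ fun k _ => (hβ k).abs.mul continuous_const))
  · exact Eventually.of_forall fun p t _ =>
      (hasDerivAt_comp_coupledMap T β f p t).const_mul _

/-- A distribution of order `r` is determined by its values on `C^{r+1}` functions. -/
theorem raise_injective (d r : ℕ) : Function.Injective (raise d r) := by
  intro u v h
  refine ContinuousLinearMap.ext fun f => ?_
  have h1 : (u : TestFn d r → ℝ) ∘ lowerFn d r = v ∘ lowerFn d r := by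
    funext g
    exact congrArg (fun w : Dist d (r + 1) => w g) h
  exact congrFun ((denseRange_lowerFn d r).equalizer u.continuous v.continuous h1) f

end Family

/-! ### Inverting `1 - L` on the kernel of an invariant functional -/

section Resolvent

variable {E : Type*} [NormedAddCommGroup E] [NormedSpace ℝ E] {L : E →L[ℝ] E} {l : E →L[ℝ] ℝ}
  {A q : ℝ}

/-- An operator that contracts exponentially on the kernel of a functional satisfies the inverse
estimate for `1 - L` there. -/
theorem norm_le_of_pow_contraction (hq : q ∈ Ioo (0 : ℝ) 1) (hl : ∀ v, l (L v) = l v)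
    (hA : ∀ n v, l v = 0 → ‖(L ^ n) v‖ ≤ A * q ^ n * ‖v‖) {v : E} (hv : l v = 0) :
    ‖v‖ ≤ A * (1 - q)⁻¹ * ‖v - L v‖ := by
  have hw : l (v - L v) = 0 := by rw [map_sub, hl, sub_self]
  have h1 (n : ℕ) : v = ∑ j ∈ Finset.range n, (L ^ j) (v - L v) + (L ^ n) v := by
    induction n with
    | zero => simp
    | succ n ih =>
      rw [Finset.sum_range_succ, map_sub, pow_succ]
      simp only [mul_apply_eq_comp]
      conv_lhs => rw [ih]
      abel
  have h2 : ‖v - L v‖ * A ≥ 0 := by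
    have := (norm_nonneg _).trans (hA 0 _ hw)
    rw [pow_zero, mul_one] at this
    linarith
  have h3 (n : ℕ) : ‖v‖ ≤ A * (1 - q)⁻¹ * ‖v - L v‖ + A * q ^ n * ‖v‖ := by
    conv_lhs => rw [h1 n]
    refine (norm_add_le _ _).trans (add_le_add ?_ (hA n v hv))
    refine (norm_sum_le _ _).trans ((Finset.sum_le_sum fun j _ => hA j _ hw).trans ?_)
    rw [← Finset.sum_mul, ← Finset.mul_sum]
    have h4 : ∑ j ∈ Finset.range n, q ^ j ≤ (1 - q)⁻¹ := by
      rw [← tsum_geometric_of_lt_one hq.1.le hq.2]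
      exact (summable_geometric_of_lt_one hq.1.le hq.2).sum_le_tsum _
        fun j _ => pow_nonneg hq.1.le j
    nlinarith
  have h5 : Tendsto (fun n : ℕ => A * (1 - q)⁻¹ * ‖v - L v‖ + A * q ^ n * ‖v‖) atTop
      (𝓝 (A * (1 - q)⁻¹ * ‖v - L v‖ + A * 0 * ‖v‖)) :=
    ((tendsto_pow_atTop_nhds_zero_of_lt_one hq.1.le hq.2).const_mul A |>.mul_const _).const_add _
  have h6 := ge_of_tendsto' h5 h3
  simpa using h6

/-- On the kernel, `1 - L` is inverted by the Neumann series. -/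
theorem exists_sub_apply_eq [CompleteSpace E] (hq : q ∈ Ioo (0 : ℝ) 1)
    (hl : ∀ v, l (L v) = l v)
    (hA : ∀ n v, l v = 0 → ‖(L ^ n) v‖ ≤ A * q ^ n * ‖v‖) {w : E} (hw : l w = 0) :
    ∃ v, l v = 0 ∧ v - L v = w := by
  have hs : Summable fun n => (L ^ n) w :=
    Summable.of_norm_bounded (((summable_geometric_of_lt_one hq.1.le hq.2).mul_left A).mul_right _)
      fun n => hA n w hw
  have h0 (n : ℕ) : l ((L ^ n) w) = 0 := by
    induction n with
    | zero => simpa using hw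
    | succ n ih => rw [pow_succ', mul_apply_eq_comp, hl, ih]
  refine ⟨∑' n, (L ^ n) w, ?_, ?_⟩
  · rw [l.map_tsum hs]
    simp only [h0, tsum_zero]
  · rw [L.map_tsum hs]
    have h1 := hs.tsum_eq_zero_add
    rw [h1]
    simp [pow_succ']

end Resolvent

namespace BanachScale

variable {d r : ℕ} (X : BanachScale.{u} d r)

/-! ### Operators on the scale of Banach spaces -/

/-- The norm on each space of the scale is determined by the `C^{r+1}` test functions. -/
theorem norm_le_of_testFn {i : Fin 4} (v : X.B i) {A : ℝ} (hA : 0 ≤ A)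
    (h : ∀ f : TestFn d (r + 1),
      |X.ι i v (lowerFn d r f)| ≤ A * ‖(X.ι i).flip (lowerFn d r f)‖) : ‖v‖ ≤ A := by
  refine NormedSpace.norm_le_dual_bound ℝ v hA fun l => ?_
  have hd : DenseRange (X.ι i).flip := by
    refine (X.dense_testFn_dual i).mono ?_
    rintro l ⟨f, hf⟩
    exact ⟨f, ContinuousLinearMap.ext fun h => (hf h).symm⟩
  have hd' : DenseRange ((X.ι i).flip ∘ lowerFn d r) :=
    hd.comp (denseRange_lowerFn d r) (X.ι i).flip.continuous
  have hc : IsClosed {l : StrongDual ℝ (X.B i) | ‖l v‖ ≤ A * ‖l‖} :=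
    isClosed_le (by fun_prop) (by fun_prop)
  exact hd'.induction_on (p := fun l : StrongDual ℝ (X.B i) => ‖l v‖ ≤ A * ‖l‖) l hc fun f => h f

/-- The functional `h ↦ ∫ h`. -/
def integralL (i : Fin 4) : X.B i →L[ℝ] ℝ := (X.ι i).flip (oneFn d r)

theorem integralL_apply {i : Fin 4} (h : X.B i) : X.integralL i h = X.integral h := rfl

/-- The transfer operator of `S` on `B i` (meaningful if it is bounded there). -/
def transferOp (S : TorusMap d r) (i : Fin 4) : X.B i →L[ℝ] X.B i :=
  Classical.epsilon fun A => ∀ h, X.ι i (A h) = transfer S (X.ι i h)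

/-- The distributional derivative `∂_{x_k} : B (i+1) → B i` (meaningful if it is bounded). -/
def partialOp (k : Fin d) (i : Fin 3) : X.B i.succ →L[ℝ] X.B i.castSucc :=
  Classical.epsilon fun A => ∀ h,
    raise d r (X.ι i.castSucc (A h)) = partialDist r k (X.ι i.succ h)

/-- Multiplication by a smooth function on `B i` (meaningful if it is bounded there). -/
def mulOp (a : SmoothFn d) (i : Fin 4) : X.B i →L[ℝ] X.B i :=
  Classical.epsilon fun A => ∀ h, X.ι i (A h) = mulDist (a.toTest r) (X.ι i h)

/-- The operator `h ↦ -∑ ∂_{x_k} 𝓛_S (β_k h)` from `B (i+1)` to `B i`. For `S = T + s β` it is the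
derivative in `s` of the transfer operator of `S`. -/
def derivOp (β : Fin d → SmoothFn d) (S : TorusMap d r) (i : Fin 3) :
    X.B i.succ →L[ℝ] X.B i.castSucc :=
  -∑ k, (X.partialOp k i).comp ((X.transferOp S i.succ).comp (X.mulOp (β k) i.succ))

namespace Assumptions

variable {X} {𝒯 : Set (TorusMap d r)} {K C ϑ : ℝ} {c c' : ℕ} (hX : X.Assumptions 𝒯 K C ϑ c c')
include hX

theorem ι_transferOp {S : TorusMap d r} (hS : S ∈ 𝒯) {i : Fin 4} (h : X.B i) :
    X.ι i (X.transferOp S i h) = transfer S (X.ι i h) :=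
  Classical.epsilon_spec (hX.transfer_bounded S hS i) h

theorem raise_partialOp (k : Fin d) {i : Fin 3} (h : X.B i.succ) :
    raise d r (X.ι i.castSucc (X.partialOp k i h)) = partialDist r k (X.ι i.succ h) :=
  Classical.epsilon_spec (hX.partial_bounded k i) h

theorem ι_mulOp (a : SmoothFn d) {i : Fin 4} (h : X.B i) :
    X.ι i (X.mulOp a i h) = mulDist (a.toTest r) (X.ι i h) := by
  refine Classical.epsilon_spec (p := fun A : X.B i →L[ℝ] X.B i => ∀ h,
    X.ι i (A h) = mulDist (a.toTest r) (X.ι i h)) ?_ h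
  choose u hu hn using hX.mul_bounded i (a.toTest r) (a.toTest (c * i + c')) fun _ => rfl
  refine ⟨LinearMap.mkContinuous ⟨⟨u, fun x y => X.ι_injective i ?_⟩, fun t x =>
    X.ι_injective i ?_⟩ _ hn, hu⟩
  · rw [hu, map_add, map_add, map_add, hu, hu]
  · change X.ι i (u (t • x)) = X.ι i (t • u x)
    rw [hu, map_smul, map_smul, map_smul, hu]

theorem raise_derivOp (β : Fin d → SmoothFn d) {S : TorusMap d r} (hS : S ∈ 𝒯) {i : Fin 3}
    (h : X.B i.succ) :
    raise d r (X.ι i.castSucc (X.derivOp β S i h)) =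
      -∑ k, partialDist r k (transfer S (mulDist ((β k).toTest r) (X.ι i.succ h))) := by
  simp only [derivOp, _root_.neg_apply, _root_.sum_apply, map_neg, map_sum,
    ContinuousLinearMap.comp_apply, hX.raise_partialOp, hX.ι_transferOp hS, hX.ι_mulOp]

/-- Elements of the scale act on `C^r` functions, but a distributional derivative is characterized
only by its values on `C^{r+1}` functions. -/
theorem ι_derivOp_lowerFn (β : Fin d → SmoothFn d) {S : TorusMap d r} (hS : S ∈ 𝒯) {i : Fin 3}
    (h : X.B i.succ) (f : TestFn d (r + 1)) :
    X.ι i.castSucc (X.derivOp β S i h) (lowerFn d r f) =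
      (-∑ k, partialDist r k (transfer S (mulDist ((β k).toTest r) (X.ι i.succ h)))) f :=
  congrArg (fun w : Dist d (r + 1) => w f) (hX.raise_derivOp β hS h)

theorem integral_transferOp {S : TorusMap d r} (hS : S ∈ 𝒯) {i : Fin 4} (h : X.B i) :
    X.integralL i (X.transferOp S i h) = X.integralL i h := by
  have h1 := congrArg (fun w : Dist d r => w (oneFn d r)) (hX.ι_transferOp hS h)
  exact h1

theorem integral_derivOp (β : Fin d → SmoothFn d) {S : TorusMap d r} (hS : S ∈ 𝒯) {i : Fin 3}
    (h : X.B i.succ) : X.integralL i.castSucc (X.derivOp β S i h) = 0 := by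
  refine (hX.ι_derivOp_lowerFn β hS h (oneFn d (r + 1))).trans ?_
  have h1 (k : Fin d) : partialFn r k (oneFn d (r + 1)) = 0 := TestFn.ext fun p => by
    change deriv (fun _ : ℝ => (1 : ℝ)) 0 = 0
    simp
  have h2 (k : Fin d) (w : Dist d r) : partialDist r k w (oneFn d (r + 1)) = 0 := by
    change -(w (partialFn r k (oneFn d (r + 1)))) = 0
    rw [h1, map_zero, neg_zero]
  simp [h2]

theorem ι_transferOp_pow {S : TorusMap d r} (hS : S ∈ 𝒯) {i : Fin 4} (n : ℕ) (h : X.B i) :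
    X.ι i ((X.transferOp S i ^ n) h) = transferSeq (fun _ => S) n (X.ι i h) := by
  induction n with
  | zero => rfl
  | succ n ih => rw [pow_succ', mul_apply_eq_comp, hX.ι_transferOp hS, ih]; rfl

theorem norm_transferOp_pow_le {S : TorusMap d r} (hS : S ∈ 𝒯) (i : Fin 3) (n : ℕ)
    (h : X.B i.succ) : ‖(X.transferOp S i.succ ^ n) h‖ ≤ (C + K) * ‖h‖ := by
  obtain ⟨u, hu, hn⟩ := hX.lasota_yorke n (fun _ => S) (fun _ _ => hS) i h
  have h1 : (X.transferOp S i.succ ^ n) h = u :=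
    X.ι_injective _ ((hX.ι_transferOp_pow hS n h).trans hu.symm)
  rw [h1]
  refine hn.trans ?_
  have h2 : ϑ ^ n ≤ 1 := pow_le_one₀ hX.ϑ_mem.1.le hX.ϑ_mem.2.le
  have h3 := X.norm_incl_le i h
  have h4 := hX.one_le_C
  have h5 := hX.one_le_K
  have h6 : C * ϑ ^ n * ‖h‖ ≤ C * 1 * ‖h‖ := by gcongr
  have h7 : K * ‖X.incl i h‖ ≤ K * ‖h‖ := by gcongr
  linarith

theorem norm_transferOp_le {S : TorusMap d r} (hS : S ∈ 𝒯) (i : Fin 3)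
    (h : X.B i.succ) : ‖X.transferOp S i.succ h‖ ≤ (C + K) * ‖h‖ := by
  simpa using hX.norm_transferOp_pow_le hS i 1 h

/-- The contraction of long compositions and the uniform power bound combine to exponential decay
for all `n`, with constants uniform over the class of maps. -/
theorem exists_pow_contraction : ∃ A : ℝ, 0 ≤ A ∧ ∀ S ∈ 𝒯, ∀ (i : Fin 3) (n : ℕ) (v : X.B i.succ),
    X.integralL i.succ v = 0 → ‖(X.transferOp S i.succ ^ n) v‖ ≤ A * ϑ ^ n * ‖v‖ := by
  obtain ⟨N, hN⟩ := hX.contraction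
  have hϑ := hX.ϑ_mem
  have h4 := hX.one_le_C
  have h5 := hX.one_le_K
  have hpos (n : ℕ) : 0 < ϑ ^ n := pow_pos hϑ.1 n
  refine ⟨(C + K) * (ϑ ^ N)⁻¹, by have := hpos N; positivity, fun S hS i n v hv => ?_⟩
  have hone : 1 ≤ (ϑ ^ N)⁻¹ := one_le_inv₀ (hpos N) |>.2 (pow_le_one₀ hϑ.1.le hϑ.2.le)
  rcases le_total N n with hn | hn
  · obtain ⟨q, hq, h⟩ := hN n hn (fun _ => S) (fun _ _ => hS) i
    obtain ⟨u, hu, hb⟩ := h v hv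
    have h1 : (X.transferOp S i.succ ^ n) v = u :=
      X.ι_injective _ ((hX.ι_transferOp_pow hS n v).trans hu.symm)
    rw [h1]
    refine hb.trans (mul_le_mul_of_nonneg_right (hq.le.trans ?_) (norm_nonneg _))
    refine le_mul_of_one_le_left (hpos n).le ?_
    nlinarith
  · refine (hX.norm_transferOp_pow_le hS i n v).trans ?_
    refine mul_le_mul_of_nonneg_right ?_ (norm_nonneg _)
    rw [mul_assoc]
    refine le_mul_of_one_le_right (by linarith) ?_
    rw [inv_mul_eq_div, one_le_div (hpos N)]
    exact pow_le_pow_of_le_one hϑ.1.le hϑ.2.le hn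

theorem exists_resolvent_bound : ∃ A : ℝ, 0 ≤ A ∧ ∀ S ∈ 𝒯, ∀ (i : Fin 3) (v : X.B i.succ),
    X.integralL i.succ v = 0 → ‖v‖ ≤ A * ‖v - X.transferOp S i.succ v‖ := by
  obtain ⟨A, hA0, hA⟩ := hX.exists_pow_contraction
  have := inv_nonneg.2 (sub_nonneg.2 hX.ϑ_mem.2.le)
  exact ⟨A * (1 - ϑ)⁻¹, by positivity, fun S hS i v hv =>
    norm_le_of_pow_contraction hX.ϑ_mem (hX.integral_transferOp hS) (hA S hS i) hv⟩

theorem exists_sub_transferOp {S : TorusMap d r} (hS : S ∈ 𝒯) (i : Fin 3) {w : X.B i.succ}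
    (hw : X.integralL i.succ w = 0) :
    ∃ v, X.integralL i.succ v = 0 ∧ v - X.transferOp S i.succ v = w := by
  obtain ⟨A, -, hA⟩ := hX.exists_pow_contraction
  exact exists_sub_apply_eq hX.ϑ_mem (hX.integral_transferOp hS) (hA S hS i) hw

theorem exists_derivOp_bound (β : Fin d → SmoothFn d) (i : Fin 3) :
    ∃ M : ℝ, 0 ≤ M ∧ ∀ S ∈ 𝒯, ∀ u, ‖X.derivOp β S i u‖ ≤ M * ‖u‖ := by
  have h4 := hX.one_le_C
  have h5 := hX.one_le_K
  refine ⟨∑ k, ‖X.partialOp k i‖ * ((C + K) * ‖X.mulOp (β k) i.succ‖), Finset.sum_nonneg fun k _ =>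
    by positivity, fun S hS u => ?_⟩
  rw [derivOp, _root_.neg_apply, norm_neg, _root_.sum_apply, Finset.sum_mul]
  refine (norm_sum_le _ _).trans (Finset.sum_le_sum fun k _ => ?_)
  rw [ContinuousLinearMap.comp_apply, ContinuousLinearMap.comp_apply]
  refine ((X.partialOp k i).le_opNorm _).trans ?_
  rw [mul_assoc]
  refine mul_le_mul_of_nonneg_left ((hX.norm_transferOp_le hS i _).trans ?_) (norm_nonneg _)
  rw [mul_assoc]
  exact mul_le_mul_of_nonneg_left ((X.mulOp (β k) i.succ).le_opNorm u) (by linarith)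

/-! ### Regularity of `s ↦ 𝓛_{T + s β}` -/

variable {T : TorusMap d ⊤} {β : Fin d → SmoothFn d} {J : Set ℝ} (hJ : Convex ℝ J)
  (hJ𝒯 : ∀ s ∈ J, coupledMap r T β 1 s ∈ 𝒯)
include hJ hJ𝒯

/-- The mean value inequality for `s ↦ 𝓛_{T + s β} u`, where `u` is a `C^r` density; it is proved
by testing against `C^{r+1}` functions. -/
theorem norm_incl_transferOp_sub_le {i : Fin 3} {u : X.B i.succ} {w : TestFn d r}
    (hu : ∀ g : TestFn d r, X.ι i.succ u g = ∫ x, w x * g x) {s s₀ : ℝ} (hs : s ∈ J) (hs₀ : s₀ ∈ J)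
    (V : X.B i.castSucc) {A : ℝ} (hA : 0 ≤ A)
    (hV : ∀ t ∈ J, |t - s₀| ≤ |s - s₀| →
      ‖X.derivOp β (coupledMap r T β 1 t) i u - V‖ ≤ A) :
    ‖X.incl i (X.transferOp (coupledMap r T β 1 s) i.succ u -
      X.transferOp (coupledMap r T β 1 s₀) i.succ u) - (s - s₀) • V‖ ≤ A * |s - s₀| := by
  refine X.norm_le_of_testFn _ (by positivity) fun f => ?_
  set ℓ := (X.ι i.castSucc).flip (lowerFn d r f) with hℓ
  let g : ℝ → ℝ := fun t =>
    transfer (coupledMap r T β 1 t) (X.ι i.succ u) (lowerFn d r f) - t * ℓ V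
  have hsub : uIcc s₀ s ⊆ J := by
    rw [← segment_eq_uIcc]
    exact hJ.segment_subset hs₀ hs
  have hg (t : ℝ) (ht : t ∈ J) :
      HasDerivAt g (ℓ (X.derivOp β (coupledMap r T β 1 t) i u - V)) t := by
    have h1 := hasDerivAt_transfer T β hu f t
    rw [← hX.ι_derivOp_lowerFn β (hJ𝒯 t ht) u f] at h1
    rw [map_sub]
    have h2 := h1.sub ((hasDerivAt_id t).mul_const (ℓ V))
    rw [one_mul] at h2
    exact h2
  have hb : ∀ t ∈ uIcc s₀ s, ‖ℓ (X.derivOp β (coupledMap r T β 1 t) i u - V)‖ ≤ A * ‖ℓ‖ := by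
    intro t ht
    refine (ℓ.le_opNorm _).trans ?_
    rw [mul_comm]
    exact mul_le_mul_of_nonneg_right (hV t (hsub ht) (abs_sub_left_of_mem_uIcc ht)) (norm_nonneg _)
  have h2 := (convex_uIcc s₀ s).norm_image_sub_le_of_norm_hasDerivWithin_le
    (fun t ht => (hg t (hsub ht)).hasDerivWithinAt) hb left_mem_uIcc right_mem_uIcc
  have h3 : X.ι i.castSucc (X.incl i (X.transferOp (coupledMap r T β 1 s) i.succ u -
      X.transferOp (coupledMap r T β 1 s₀) i.succ u) - (s - s₀) • V) (lowerFn d r f) =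
      g s - g s₀ := by
    rw [map_sub, X.ι_incl, map_sub, hX.ι_transferOp (hJ𝒯 s hs), hX.ι_transferOp (hJ𝒯 s₀ hs₀),
      map_smul]
    simp only [g, hℓ, _root_.sub_apply, _root_.smul_apply, ContinuousLinearMap.flip_apply,
      smul_eq_mul]
    ring
  rw [h3]
  refine h2.trans_eq ?_
  rw [Real.norm_eq_abs]
  ring

/-- `s ↦ 𝓛_{T + s β}` is Lipschitz as a map into the operators from `B (i+1)` to `B i`. -/
theorem exists_transferOp_lipschitz (i : Fin 3) : ∃ M : ℝ, 0 ≤ M ∧ ∀ s ∈ J, ∀ s₀ ∈ J, ∀ u,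
    ‖X.incl i (X.transferOp (coupledMap r T β 1 s) i.succ u -
      X.transferOp (coupledMap r T β 1 s₀) i.succ u)‖ ≤ M * |s - s₀| * ‖u‖ := by
  obtain ⟨M, hM0, hM⟩ := hX.exists_derivOp_bound β i
  refine ⟨M, hM0, fun s hs s₀ hs₀ u => ?_⟩
  refine (X.dense_testFn i.succ).induction (P := fun u =>
    ‖X.incl i (X.transferOp (coupledMap r T β 1 s) i.succ u -
      X.transferOp (coupledMap r T β 1 s₀) i.succ u)‖ ≤ M * |s - s₀| * ‖u‖) ?_ ?_ u
  · rintro u ⟨w, hw⟩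
    have h1 := hX.norm_incl_transferOp_sub_le hJ hJ𝒯 hw hs hs₀ 0 (A := M * ‖u‖) (by positivity)
      fun t ht _ => by rw [sub_zero]; exact hM _ (hJ𝒯 t ht) u
    rw [smul_zero, sub_zero] at h1
    exact h1.trans_eq (by ring)
  · exact isClosed_le (by fun_prop) (by fun_prop)

end Assumptions

end BanachScale

namespace BanachScale

variable {d r : ℕ} (X : BanachScale.{u} d r)

/-- The inclusion of `B 3` in `B 2`. -/
def incl₃₂ : X.B 3 →L[ℝ] X.B 2 := X.incl 2

/-- The inclusion of `B 2` in `B 1`. -/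
def incl₂₁ : X.B 2 →L[ℝ] X.B 1 := X.incl 1

/-- `derivOp` as a map from `B 3` to `B 2`. -/
def derivOp₃₂ (β : Fin d → SmoothFn d) (S : TorusMap d r) : X.B 3 →L[ℝ] X.B 2 := X.derivOp β S 2

/-- `derivOp` as a map from `B 2` to `B 1`. -/
def derivOp₂₁ (β : Fin d → SmoothFn d) (S : TorusMap d r) : X.B 2 →L[ℝ] X.B 1 := X.derivOp β S 1

theorem ι_incl₃₂ (h : X.B 3) : X.ι 2 (X.incl₃₂ h) = X.ι 3 h := X.ι_incl 2 h

theorem ι_incl₂₁ (h : X.B 2) : X.ι 1 (X.incl₂₁ h) = X.ι 2 h := X.ι_incl 1 h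

theorem norm_incl₃₂_le (h : X.B 3) : ‖X.incl₃₂ h‖ ≤ ‖h‖ := X.norm_incl_le 2 h

theorem norm_incl₂₁_le (h : X.B 2) : ‖X.incl₂₁ h‖ ≤ ‖h‖ := X.norm_incl_le 1 h

/-- The element of `B 3` with density `f`. -/
def density (f : TestFn d r) : X.B 3 := (X.exists_of_testFn f).choose

theorem ι_density (f g : TestFn d r) : X.ι 3 (X.density f) g = ∫ x, f x * g x :=
  (X.exists_of_testFn f).choose_spec g

theorem integral_density_one : X.integralL 3 (X.density (oneFn d r)) = 1 := by
  refine (X.ι_density _ _).trans ?_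
  have : IsProbabilityMeasure (volume : Measure UnitAddCircle) :=
    ⟨(AddCircle.measure_univ 1).trans ENNReal.ofReal_one⟩
  have : IsProbabilityMeasure (volume : Measure (Torus d)) :=
    inferInstanceAs (IsProbabilityMeasure (Measure.pi fun _ : Fin d =>
      (volume : Measure UnitAddCircle)))
  change ∫ _ : Torus d, (1 : ℝ) * 1 = 1
  simp

namespace Assumptions

variable {X} {𝒯 : Set (TorusMap d r)} {K C ϑ : ℝ} {c c' : ℕ} (hX : X.Assumptions 𝒯 K C ϑ c c')
include hX

theorem incl₃₂_transferOp {S : TorusMap d r} (hS : S ∈ 𝒯) (h : X.B 3) :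
    X.incl₃₂ (X.transferOp S 3 h) = X.transferOp S 2 (X.incl₃₂ h) :=
  X.ι_injective 2 (by rw [X.ι_incl₃₂, hX.ι_transferOp hS, hX.ι_transferOp hS, X.ι_incl₃₂])

theorem incl₂₁_transferOp {S : TorusMap d r} (hS : S ∈ 𝒯) (h : X.B 2) :
    X.incl₂₁ (X.transferOp S 2 h) = X.transferOp S 1 (X.incl₂₁ h) :=
  X.ι_injective 1 (by rw [X.ι_incl₂₁, hX.ι_transferOp hS, hX.ι_transferOp hS, X.ι_incl₂₁])

theorem incl₃₂_mulOp (a : SmoothFn d) (h : X.B 3) :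
    X.incl₃₂ (X.mulOp a 3 h) = X.mulOp a 2 (X.incl₃₂ h) :=
  X.ι_injective 2 (by rw [X.ι_incl₃₂, hX.ι_mulOp, hX.ι_mulOp, X.ι_incl₃₂])

theorem incl₂₁_derivOp₃₂ (β : Fin d → SmoothFn d) {S : TorusMap d r} (hS : S ∈ 𝒯) (h : X.B 3) :
    X.incl₂₁ (X.derivOp₃₂ β S h) = X.derivOp₂₁ β S (X.incl₃₂ h) := by
  refine X.ι_injective 1 (raise_injective d r ?_)
  rw [X.ι_incl₂₁]
  refine (hX.raise_derivOp β hS (i := 2) h).trans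
    (Eq.trans ?_ (hX.raise_derivOp β hS (i := 1) (X.incl₃₂ h)).symm)
  have h1 : X.ι (Fin.succ 1) (X.incl₃₂ h) = X.ι (Fin.succ 2) h := X.ι_incl₃₂ h
  rw [h1]

/-! ### Invariant probability measures -/

theorem tendsto_transferOp_pow {S : TorusMap d r} (hS : S ∈ 𝒯) (i : Fin 3) {v : X.B i.succ}
    (hv : X.integralL i.succ v = 0) :
    Tendsto (fun n => (X.transferOp S i.succ ^ n) v) atTop (𝓝 0) := by
  obtain ⟨A, -, hA⟩ := hX.exists_pow_contraction
  refine squeeze_zero_norm (fun n => hA S hS i n v hv) ?_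
  have h := ((tendsto_pow_atTop_nhds_zero_of_lt_one hX.ϑ_mem.1.le hX.ϑ_mem.2).const_mul A).mul_const
    ‖v‖
  simpa using h

/-- Uniqueness of the invariant measure. -/
theorem eq_zero_of_transfer_eq {S : TorusMap d r} (hS : S ∈ 𝒯) {v : X.B 1}
    (hv : X.integral v = 0) (h : transfer S (X.ι 1 v) = X.ι 1 v) : v = 0 := by
  have h1 : X.transferOp S 1 v = v := X.ι_injective 1 ((hX.ι_transferOp hS v).trans h)
  obtain ⟨A, -, hA⟩ := hX.exists_resolvent_bound
  have h2 : ‖v‖ ≤ A * ‖v - X.transferOp S 1 v‖ := hA S hS 0 v hv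
  rw [h1, sub_self, norm_zero, mul_zero] at h2
  exact norm_le_zero_iff.1 h2

/-- Every map of the class has an invariant probability measure in `B 3`, with a uniform bound on
its norm; it is the limit of the push-forwards of Lebesgue measure. -/
theorem exists_invariant : ∃ A : ℝ, ∀ S ∈ 𝒯, ∃ h : X.B 3, ‖h‖ ≤ A ∧ X.integral h = 1 ∧
    (∀ φ : TestFn d r, (∀ x, 0 ≤ φ x) → 0 ≤ X.pairing h φ) ∧
    transfer S (X.ι 3 h) = X.ι 3 h := by
  obtain ⟨A, hA0, hA⟩ := hX.exists_resolvent_bound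
  let e : X.B 3 := X.density (oneFn d r)
  refine ⟨‖e‖ + A * ((C + K) * ‖e‖ + ‖e‖), fun S hS => ?_⟩
  let L : X.B 3 →L[ℝ] X.B 3 := X.transferOp S 3
  have hw : X.integralL 3 (L e - e) = 0 := by
    rw [map_sub, hX.integral_transferOp hS, sub_self]
  obtain ⟨v, hv, hvL⟩ : ∃ v : X.B 3, X.integralL 3 v = 0 ∧ v - L v = L e - e :=
    hX.exists_sub_transferOp hS 2 hw
  have hfix : L (e + v) = e + v := by
    rw [map_add, ← sub_eq_zero]
    have h1 : L e + L v - (e + v) = (L e - e) - (v - L v) := by abel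
    rw [h1, hvL, sub_self]
  have hpow (n : ℕ) : (L ^ n) (e + v) = e + v := by
    induction n with
    | zero => rfl
    | succ n ih => rw [pow_succ, mul_apply_eq_comp, hfix, ih]
  refine ⟨e + v, (norm_add_le _ _).trans (add_le_add le_rfl ?_), ?_, fun φ hφ => ?_, ?_⟩
  · have h1 : ‖v‖ ≤ A * ‖v - L v‖ := hA S hS 2 v hv
    rw [hvL] at h1
    have h2 : ‖L e‖ ≤ (C + K) * ‖e‖ := hX.norm_transferOp_le hS 2 e
    exact h1.trans (mul_le_mul_of_nonneg_left ((norm_sub_le _ _).trans (by linarith)) hA0)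
  · change X.integralL 3 (e + v) = 1
    rw [map_add, hv, X.integral_density_one, add_zero]
  · have hlim : Tendsto (fun n => X.ι 3 ((L ^ n) e) φ) atTop (𝓝 (X.ι 3 (e + v) φ)) := by
      have h1 : Tendsto (fun n => (L ^ n) v) atTop (𝓝 0) := hX.tendsto_transferOp_pow hS 2 hv
      have h2 : Tendsto (fun n => (e + v) - (L ^ n) v) atTop (𝓝 (e + v - 0)) := h1.const_sub _
      have h3 (n : ℕ) : (L ^ n) e = (e + v) - (L ^ n) v := by
        rw [eq_sub_iff_add_eq, ← map_add, hpow n]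
      rw [sub_zero] at h2
      simp_rw [h3]
      exact (((X.ι 3).flip φ).continuous.tendsto _).comp h2
    refine ge_of_tendsto' hlim fun n => ?_
    rw [hX.ι_transferOp_pow hS]
    have hpos (n : ℕ) : ∀ φ : TestFn d r, (∀ x, 0 ≤ φ x) →
        0 ≤ transferSeq (fun _ => S) n (X.ι 3 e) φ := by
      induction n with
      | zero =>
        intro φ hφ
        change 0 ≤ X.ι 3 (X.density (oneFn d r)) φ
        rw [X.ι_density]
        exact integral_nonneg fun x => mul_nonneg zero_le_one (hφ x)
      | succ n ih => exact fun φ hφ => ih (pull S φ) fun x => hφ _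
    exact hpos n φ hφ
  · rw [← hX.ι_transferOp hS]
    exact congrArg _ hfix

/-! ### Linear response -/

variable {T : TorusMap d ⊤} {β : Fin d → SmoothFn d} {J : Set ℝ} (hJ : Convex ℝ J)
  (hJ𝒯 : ∀ s ∈ J, coupledMap r T β 1 s ∈ 𝒯)
include hJ hJ𝒯

theorem exists_derivOp₂₁_lipschitz : ∃ M : ℝ, 0 ≤ M ∧ ∀ s ∈ J, ∀ s₀ ∈ J, ∀ u : X.B 3,
    ‖X.derivOp₂₁ β (coupledMap r T β 1 s) (X.incl₃₂ u) -
      X.derivOp₂₁ β (coupledMap r T β 1 s₀) (X.incl₃₂ u)‖ ≤ M * |s - s₀| * ‖u‖ := by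
  obtain ⟨M, hM0, hM⟩ := hX.exists_transferOp_lipschitz hJ hJ𝒯 2
  let P : Fin d → X.B 2 →L[ℝ] X.B 1 := fun k => X.partialOp k 1
  let m : Fin d → X.B 3 →L[ℝ] X.B 3 := fun k => X.mulOp (β k) 3
  refine ⟨∑ k, ‖P k‖ * (M * ‖m k‖), Finset.sum_nonneg fun k _ => by positivity,
    fun s hs s₀ hs₀ u => ?_⟩
  have h1 (s : ℝ) (hs : s ∈ J) : X.derivOp₂₁ β (coupledMap r T β 1 s) (X.incl₃₂ u) =
      -∑ k, P k (X.incl₃₂ (X.transferOp (coupledMap r T β 1 s) 3 (m k u))) := by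
    have h2 : X.derivOp₂₁ β (coupledMap r T β 1 s) (X.incl₃₂ u) = -∑ k, P k
        (X.transferOp (coupledMap r T β 1 s) 2 (X.mulOp (β k) 2 (X.incl₃₂ u))) := by
      rw [derivOp₂₁, derivOp, _root_.neg_apply, _root_.sum_apply]
      rfl
    rw [h2]
    simp only [m, hX.incl₃₂_transferOp (hJ𝒯 s hs), hX.incl₃₂_mulOp]
  rw [h1 s hs, h1 s₀ hs₀, neg_sub_neg, ← Finset.sum_sub_distrib, Finset.sum_mul, Finset.sum_mul]
  refine (norm_sum_le _ _).trans (Finset.sum_le_sum fun k _ => ?_)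
  rw [← map_sub, ← map_sub]
  refine ((P k).le_opNorm _).trans ?_
  have h3 := hM s₀ hs₀ s hs (m k u)
  have h4 := (m k).le_opNorm u
  rw [mul_assoc ‖P k‖, mul_assoc ‖P k‖]
  refine mul_le_mul_of_nonneg_left (h3.trans ?_) (norm_nonneg _)
  rw [abs_sub_comm]
  calc M * |s - s₀| * ‖m k u‖ ≤ M * |s - s₀| * (‖m k‖ * ‖u‖) := by gcongr
    _ = _ := by ring

/-- The first-order Taylor formula for `s ↦ 𝓛_{T + s β} u` in `B 1`, for `u` in `B 3`. -/
theorem exists_transferOp_taylor : ∃ M : ℝ, 0 ≤ M ∧ ∀ s ∈ J, ∀ s₀ ∈ J, ∀ u : X.B 3,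
    ‖X.transferOp (coupledMap r T β 1 s) 1 (X.incl₂₁ (X.incl₃₂ u)) -
      X.transferOp (coupledMap r T β 1 s₀) 1 (X.incl₂₁ (X.incl₃₂ u)) -
      (s - s₀) • X.derivOp₂₁ β (coupledMap r T β 1 s₀) (X.incl₃₂ u)‖ ≤
      M * |s - s₀| ^ 2 * ‖u‖ := by
  obtain ⟨M, hM0, hM⟩ := hX.exists_derivOp₂₁_lipschitz (T := T) (β := β) hJ hJ𝒯
  refine ⟨M, hM0, fun s hs s₀ hs₀ u => ?_⟩
  have hd := X.dense_testFn 3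
  refine hd.induction (P := fun u : X.B 3 =>
    ‖X.transferOp (coupledMap r T β 1 s) 1 (X.incl₂₁ (X.incl₃₂ u)) -
      X.transferOp (coupledMap r T β 1 s₀) 1 (X.incl₂₁ (X.incl₃₂ u)) -
      (s - s₀) • X.derivOp₂₁ β (coupledMap r T β 1 s₀) (X.incl₃₂ u)‖ ≤
      M * |s - s₀| ^ 2 * ‖u‖) ?_ (isClosed_le (by fun_prop) (by fun_prop)) u
  rintro u ⟨w, hw⟩
  have hw' : ∀ g : TestFn d r, X.ι (Fin.succ 1) (X.incl₃₂ u) g = ∫ x, w x * g x := fun g => by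
    rw [← hw g]
    exact congrArg (fun D : Dist d r => D g) (X.ι_incl₃₂ u)
  have h1 := hX.norm_incl_transferOp_sub_le (i := 1) hJ hJ𝒯 hw' hs hs₀
    (X.derivOp₂₁ β (coupledMap r T β 1 s₀) (X.incl₃₂ u)) (A := M * |s - s₀| * ‖u‖)
    (by positivity) fun t ht hts => (hM t ht s₀ hs₀ u).trans (by gcongr)
  have h2 : X.transferOp (coupledMap r T β 1 s) 1 (X.incl₂₁ (X.incl₃₂ u)) -
      X.transferOp (coupledMap r T β 1 s₀) 1 (X.incl₂₁ (X.incl₃₂ u)) =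
      X.incl₂₁ (X.transferOp (coupledMap r T β 1 s) 2 (X.incl₃₂ u) -
        X.transferOp (coupledMap r T β 1 s₀) 2 (X.incl₃₂ u)) := by
    rw [map_sub, hX.incl₂₁_transferOp (hJ𝒯 s hs), hX.incl₂₁_transferOp (hJ𝒯 s₀ hs₀)]
  rw [h2]
  exact h1.trans_eq (by ring)

/-- Linear response: the invariant probability measure `η s` of `T + s β` satisfies a uniform
first-order Taylor formula in `B 1`. Its derivative `θ s` solves
`(1 - 𝓛) θ = -∑ ∂_{x_k} 𝓛 (β_k η)`, where `𝓛` is the transfer operator of `T + s β`. -/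
theorem exists_linear_response : ∃ (η θ : ℝ → X.B 1) (A M : ℝ),
    (∀ s ∈ J, ‖η s‖ ≤ A ∧ X.integral (η s) = 1 ∧
      (∀ φ : TestFn d r, (∀ x, 0 ≤ φ x) → 0 ≤ X.pairing (η s) φ) ∧
      transfer (coupledMap r T β 1 s) (X.ι 1 (η s)) = X.ι 1 (η s)) ∧
    (∀ s ∈ J, X.integral (θ s) = 0 ∧
      raise d r (X.ι 1 (θ s) - transfer (coupledMap r T β 1 s) (X.ι 1 (θ s))) =
        -∑ k, partialDist r k (transfer (coupledMap r T β 1 s)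
          (mulDist ((β k).toTest r) (X.ι 1 (η s))))) ∧
    ∀ s ∈ J, ∀ s₀ ∈ J, ‖η s - η s₀ - (s - s₀) • θ s₀‖ ≤ M * |s - s₀| ^ 2 := by
  obtain ⟨A, hA⟩ := hX.exists_invariant
  choose! η₃ hη₃ using fun s hs => hA _ (hJ𝒯 s hs)
  obtain ⟨B, hB0, hB⟩ := hX.exists_resolvent_bound
  obtain ⟨M₁, hM₁0, hM₁⟩ := hX.exists_transferOp_taylor (T := T) (β := β) hJ hJ𝒯
  obtain ⟨M₂, hM₂0, hM₂⟩ := hX.exists_transferOp_lipschitz (T := T) (β := β) hJ hJ𝒯 1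
  obtain ⟨D, hD0, hD⟩ := hX.exists_derivOp_bound β 2
  have hθ (s : ℝ) (hs : s ∈ J) : ∃ v : X.B 2, X.integralL 2 v = 0 ∧
      v - X.transferOp (coupledMap r T β 1 s) 2 v =
        X.derivOp₃₂ β (coupledMap r T β 1 s) (η₃ s) :=
    hX.exists_sub_transferOp (hJ𝒯 s hs) 1 (hX.integral_derivOp β (hJ𝒯 s hs) (i := 2) (η₃ s))
  choose! θ₂ hθ₂ using hθ
  have hθn (s : ℝ) (hs : s ∈ J) : ‖θ₂ s‖ ≤ B * (D * A) := by
    have h1 : ‖θ₂ s‖ ≤ B * ‖θ₂ s - X.transferOp (coupledMap r T β 1 s) 2 (θ₂ s)‖ :=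
      hB _ (hJ𝒯 s hs) 1 (θ₂ s) (hθ₂ s hs).1
    rw [(hθ₂ s hs).2] at h1
    have h2 : ‖X.derivOp₃₂ β (coupledMap r T β 1 s) (η₃ s)‖ ≤ D * ‖η₃ s‖ := hD _ (hJ𝒯 s hs) _
    exact h1.trans (mul_le_mul_of_nonneg_left
      (h2.trans (mul_le_mul_of_nonneg_left (hη₃ s hs).1 hD0)) hB0)
  have hι (s : ℝ) : X.ι 1 (X.incl₂₁ (X.incl₃₂ (η₃ s))) = X.ι 3 (η₃ s) := by
    rw [X.ι_incl₂₁, X.ι_incl₃₂]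
  have hη_int (s : ℝ) (hs : s ∈ J) : X.integral (X.incl₂₁ (X.incl₃₂ (η₃ s))) = 1 := by
    rw [integral, pairing, hι]
    exact (hη₃ s hs).2.1
  have hη_fix (s : ℝ) (hs : s ∈ J) : X.transferOp (coupledMap r T β 1 s) 1
      (X.incl₂₁ (X.incl₃₂ (η₃ s))) = X.incl₂₁ (X.incl₃₂ (η₃ s)) := by
    refine X.ι_injective 1 ?_
    rw [hX.ι_transferOp (hJ𝒯 s hs), hι]
    exact (hη₃ s hs).2.2.2
  have hθ_int (s : ℝ) (hs : s ∈ J) : X.integral (X.incl₂₁ (θ₂ s)) = 0 := by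
    rw [integral, pairing, X.ι_incl₂₁]
    exact (hθ₂ s hs).1
  have hθ_eq (s : ℝ) (hs : s ∈ J) : X.incl₂₁ (θ₂ s) -
      X.transferOp (coupledMap r T β 1 s) 1 (X.incl₂₁ (θ₂ s)) =
      X.derivOp₂₁ β (coupledMap r T β 1 s) (X.incl₃₂ (η₃ s)) := by
    rw [← hX.incl₂₁_transferOp (hJ𝒯 s hs), ← map_sub, (hθ₂ s hs).2,
      hX.incl₂₁_derivOp₃₂ β (hJ𝒯 s hs)]
  refine ⟨fun s => X.incl₂₁ (X.incl₃₂ (η₃ s)), fun s => X.incl₂₁ (θ₂ s), A,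
    B * (M₁ * A + M₂ * (B * (D * A))), fun s hs => ⟨?_, hη_int s hs, ?_, ?_⟩, fun s hs =>
    ⟨hθ_int s hs, ?_⟩, fun s hs s₀ hs₀ => ?_⟩
  · exact ((X.norm_incl₂₁_le _).trans (X.norm_incl₃₂_le _)).trans (hη₃ s hs).1
  · intro φ hφ
    rw [pairing, hι]
    exact (hη₃ s hs).2.2.1 φ hφ
  · rw [hι]
    exact (hη₃ s hs).2.2.2
  · rw [← hX.ι_transferOp (hJ𝒯 s hs), ← map_sub, hθ_eq s hs, hι, ← X.ι_incl₃₂]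
    exact hX.raise_derivOp β (hJ𝒯 s hs) (i := 1) (X.incl₃₂ (η₃ s))
  · -- apply `1 - 𝓛_s` to the remainder
    set L := X.transferOp (coupledMap r T β 1 s) 1 with hL
    set L₀ := X.transferOp (coupledMap r T β 1 s₀) 1 with hL₀
    set a := X.incl₂₁ (X.incl₃₂ (η₃ s)) with ha
    set a₀ := X.incl₂₁ (X.incl₃₂ (η₃ s₀)) with ha₀
    set b₀ := X.incl₂₁ (θ₂ s₀) with hb₀
    have h1 : X.integralL 1 (a - a₀ - (s - s₀) • b₀) = 0 := by
      rw [map_sub, map_sub, map_smul, X.integralL_apply, X.integralL_apply, X.integralL_apply,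
        hη_int s hs, hη_int s₀ hs₀, hθ_int s₀ hs₀]
      simp
    have h2 : (a - a₀ - (s - s₀) • b₀) - L (a - a₀ - (s - s₀) • b₀) =
        (L a₀ - L₀ a₀ - (s - s₀) • X.derivOp₂₁ β (coupledMap r T β 1 s₀) (X.incl₃₂ (η₃ s₀))) +
        (s - s₀) • (L b₀ - L₀ b₀) := by
      rw [← hθ_eq s₀ hs₀, map_sub, map_sub, map_smul, hη_fix s hs, hη_fix s₀ hs₀]
      simp only [smul_sub]
      abel
    have h3 : ‖a - a₀ - (s - s₀) • b₀‖ ≤ B * ‖(a - a₀ - (s - s₀) • b₀) -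
        L (a - a₀ - (s - s₀) • b₀)‖ := hB _ (hJ𝒯 s hs) 0 _ h1
    have h4 : ‖L b₀ - L₀ b₀‖ ≤ M₂ * |s - s₀| * ‖θ₂ s₀‖ := by
      rw [hL, hL₀, hb₀, ← hX.incl₂₁_transferOp (hJ𝒯 s hs),
        ← hX.incl₂₁_transferOp (hJ𝒯 s₀ hs₀), ← map_sub]
      exact hM₂ s hs s₀ hs₀ (θ₂ s₀)
    have h5 := hM₁ s hs s₀ hs₀ (η₃ s₀)
    have h6 := (hη₃ s₀ hs₀).1
    have h7 := hθn s₀ hs₀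
    refine h3.trans ?_
    rw [h2, mul_assoc]
    refine mul_le_mul_of_nonneg_left ((norm_add_le _ _).trans ?_) hB0
    rw [norm_smul, Real.norm_eq_abs]
    calc _ ≤ M₁ * |s - s₀| ^ 2 * ‖η₃ s₀‖ + |s - s₀| * (M₂ * |s - s₀| * ‖θ₂ s₀‖) := by gcongr
      _ ≤ M₁ * |s - s₀| ^ 2 * A + |s - s₀| * (M₂ * |s - s₀| * (B * (D * A))) := by gcongr
      _ = _ := by ring

end Assumptions

end BanachScale

/-! ### Admissible parameters, the set `𝕎` and its tangent directions -/

instance {d : ℕ} : PreconnectedSpace (Torus d) :=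
  ⟨by
    rw [← proj_surjective.range_eq]
    exact isPreconnected_range continuous_proj⟩

namespace BanachScale

variable {d r : ℕ} (X : BanachScale.{u} d r)

theorem convex_W (R : ℝ) : Convex ℝ (X.W R) := by
  intro f hf g hg a b ha hb hab
  refine ⟨?_, fun φ hφ => ?_, ?_⟩
  · have h1 := (convex_closedBall (0 : X.B 1) R) (mem_closedBall_zero_iff.2 hf.1)
      (mem_closedBall_zero_iff.2 hg.1) ha hb hab
    exact mem_closedBall_zero_iff.1 h1
  · have h1 : X.pairing (a • f + b • g) φ = a * X.pairing f φ + b * X.pairing g φ := by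
      simp [pairing]
    rw [h1]
    exact add_nonneg (mul_nonneg ha (hf.2.1 φ hφ)) (mul_nonneg hb (hg.2.1 φ hφ))
  · change X.integralL 1 (a • f + b • g) = 1
    rw [map_add, map_smul, map_smul, X.integralL_apply, X.integralL_apply, hf.2.2, hg.2.2]
    simpa using hab

/-- Lebesgue measure as an element of `B 1`. -/
def lebesgue : X.B 1 := X.incl₂₁ (X.incl₃₂ (X.density (oneFn d r)))

theorem ι_lebesgue (g : TestFn d r) : X.ι 1 X.lebesgue g = ∫ x, g x := by
  rw [lebesgue, X.ι_incl₂₁, X.ι_incl₃₂, X.ι_density]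
  change ∫ x, (1 : ℝ) * g x = _
  simp

theorem integral_lebesgue : X.integral X.lebesgue = 1 := by
  rw [integral, pairing, lebesgue, X.ι_incl₂₁, X.ι_incl₃₂]
  exact X.integral_density_one

/-- The projection `u ↦ u - (∫ u) m` of `B 1` onto `𝕍`. -/
def projV : X.B 1 →L[ℝ] X.V :=
  (ContinuousLinearMap.id ℝ (X.B 1) - (X.integralL 1).smulRight X.lebesgue).codRestrict X.V
    fun u => by
      change X.integralL 1 (u - X.integralL 1 u • X.lebesgue) = 0
      rw [map_sub, map_smul, X.integralL_apply X.lebesgue, X.integral_lebesgue]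
      simp

theorem coe_projV (u : X.B 1) : (X.projV u : X.B 1) = u - X.integral u • X.lebesgue := rfl

theorem projV_coe (v : X.V) : X.projV v = v := by
  refine Subtype.ext ?_
  have hv : X.integral (v : X.B 1) = 0 := v.2
  rw [coe_projV, hv, zero_smul, sub_zero]

/-- Small mean-zero perturbations of Lebesgue measure with a `C^r` density belong to `𝕎`. -/
theorem exists_lebesgue_add_mem_W {R : ℝ} (hR : ‖X.lebesgue‖ < R) {u : X.B 1} {w : TestFn d r}
    (hu : ∀ g : TestFn d r, X.ι 1 u g = ∫ x, w x * g x) :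
    ∃ ε : ℝ, 0 < ε ∧ X.lebesgue + ε • (X.projV u : X.B 1) ∈ X.W R := by
  set a := X.integral u with ha
  set n := ‖(X.projV u : X.B 1)‖ with hn
  have hn0 : 0 ≤ n := norm_nonneg _
  have hA : 0 < 1 + ‖w‖ + |a| := by positivity
  have hgap : 0 < R - ‖X.lebesgue‖ := sub_pos.2 hR
  obtain ⟨ε, hε, h1, h2⟩ : ∃ ε > 0, ε * (‖w‖ + |a|) ≤ 1 ∧ ε * n ≤ R - ‖X.lebesgue‖ := by
    refine ⟨min (1 / (1 + ‖w‖ + |a|)) ((R - ‖X.lebesgue‖) / (1 + n)), by positivity, ?_, ?_⟩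
    · refine (mul_le_mul_of_nonneg_right (min_le_left _ _) (by positivity)).trans ?_
      rw [div_mul_eq_mul_div, one_mul, div_le_one hA]
      linarith
    · refine (mul_le_mul_of_nonneg_right (min_le_right _ _) (by positivity)).trans ?_
      rw [div_mul_eq_mul_div, div_le_iff₀ (by positivity)]
      nlinarith
  refine ⟨ε, hε, ?_, fun φ hφ => ?_, ?_⟩
  · refine (norm_add_le _ _).trans ?_
    rw [norm_smul, Real.norm_of_nonneg hε.le]
    linarith
  · have h3 : X.pairing (X.lebesgue + ε • (X.projV u : X.B 1)) φ =
        ∫ x, (1 + ε * (w x - a)) * φ x := by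
      have h4 : X.pairing (X.lebesgue + ε • (X.projV u : X.B 1)) φ =
          (∫ x, φ x) + ε * ((∫ x, w x * φ x) - a * ∫ x, φ x) := by
        rw [pairing, coe_projV, map_add, map_smul, map_sub, map_smul]
        simp only [_root_.add_apply, _root_.smul_apply, _root_.sub_apply, X.ι_lebesgue, hu,
          smul_eq_mul, ha]
      have i1 : Integrable (fun x => φ x) volume := integrable_of_continuous φ.continuous
      have i2 : Integrable (fun x => w x * φ x) volume :=
        integrable_of_continuous (w.continuous.mul φ.continuous)
      have e (x : Torus d) : (1 + ε * (w x - a)) * φ x =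
          φ x + (ε * (w x * φ x) - ε * a * φ x) := by ring
      have i3 : Integrable (fun x => ε * (w x * φ x) - ε * a * φ x) volume :=
        (i2.const_mul ε).sub (i1.const_mul (ε * a))
      simp only [e]
      rw [h4, integral_add i1 i3, integral_sub (i2.const_mul ε) (i1.const_mul (ε * a)),
        integral_const_mul, integral_const_mul]
      ring
    rw [h3]
    refine integral_nonneg fun x => mul_nonneg ?_ (hφ x)
    have h5 : |ε * (w x - a)| ≤ 1 := by
      rw [abs_mul, abs_of_pos hε]
      exact (mul_le_mul_of_nonneg_left ((abs_sub _ _).trans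
        (add_le_add (TestFn.abs_le_norm w x) le_rfl)) hε.le).trans h1
    linarith [(abs_le.1 h5).1]
  · have h6 : X.integral (X.projV u : X.B 1) = 0 := (X.projV u).2
    change X.integralL 1 _ = 1
    rw [map_add, map_smul, X.integralL_apply, X.integralL_apply, X.integral_lebesgue, h6]
    simp

theorem lebesgue_mem_W {R : ℝ} (hR : ‖X.lebesgue‖ < R) : X.lebesgue ∈ X.W R :=
  ⟨hR.le, fun φ hφ => by
    rw [pairing, X.ι_lebesgue]
    exact integral_nonneg hφ, X.integral_lebesgue⟩

end BanachScale

namespace System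

variable {d r : ℕ} (Y : System.{u} d r)

/-- Derivatives along `𝕎` are unique: the smooth densities in `𝕎` span enough directions. -/
theorem uniqueDiffWithinAt_directions {R : ℝ} (hR : ‖Y.X.lebesgue‖ < R) {h : Y.X.B 1}
    (hh : h ∈ Y.X.W R) : UniqueDiffWithinAt ℝ (Y.directions R h) 0 := by
  have h0 : (0 : Y.X.V) ∈ Y.directions R h := by
    change h + ((0 : Y.X.V) : Y.X.B 1) ∈ Y.X.W R
    simpa using hh
  have hconv : Convex ℝ (Y.directions R h) := by
    intro f hf g hg a b ha hb hab
    have h1 := Y.X.convex_W R hf hg ha hb hab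
    change h + ((a • f + b • g : Y.X.V) : Y.X.B 1) ∈ Y.X.W R
    convert h1 using 1
    rw [smul_add, smul_add, add_add_add_comm, ← add_smul, hab, one_smul]
    rfl
  have htan : ∀ φ ∈ Y.directions R h, φ ∈ tangentConeAt ℝ (Y.directions R h) 0 := by
    intro φ hφ
    have := mem_tangentConeAt_of_segment_subset (hconv.segment_subset h0 hφ)
    simpa using this
  refine ⟨?_, subset_closure h0⟩
  -- `𝕍` contains the projections of the `C^r` densities as a dense subset, and a multiple of each
  -- of these is the difference of two elements of `𝕎`
  have hsurj : Function.Surjective Y.X.projV := fun v => ⟨v, Y.X.projV_coe v⟩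
  refine (hsurj.denseRange.dense_image Y.X.projV.continuous (Y.X.dense_testFn 1)).mono ?_
  rintro _ ⟨u, ⟨w, hw⟩, rfl⟩
  obtain ⟨ε, hε, hmem⟩ := Y.X.exists_lebesgue_add_mem_W hR hw
  have hsub (p : Y.X.B 1) (hp : p ∈ Y.X.W R) : p - h ∈ Y.X.V := by
    change Y.X.integralL 1 (p - h) = 0
    rw [map_sub, Y.X.integralL_apply, Y.X.integralL_apply, hp.2.2, hh.2.2, sub_self]
  have hdir (p : Y.X.B 1) (hp : p ∈ Y.X.W R) :
      (⟨p - h, hsub p hp⟩ : Y.X.V) ∈ Y.directions R h := by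
    change h + (p - h) ∈ Y.X.W R
    simpa using hp
  have hl := Y.X.lebesgue_mem_W hR
  have e : Y.X.projV u = ε⁻¹ • ((⟨_, hsub _ hmem⟩ : Y.X.V) - ⟨_, hsub _ hl⟩) := by
    refine Subtype.ext ?_
    change _ = ε⁻¹ • ((Y.X.lebesgue + ε • (Y.X.projV u : Y.X.B 1) - h) - (Y.X.lebesgue - h))
    rw [sub_sub_sub_cancel_right, add_sub_cancel_left, inv_smul_smul₀ hε.ne']
  rw [SetLike.mem_coe, e]
  exact Submodule.smul_mem _ _ (Submodule.sub_mem _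
    (Submodule.subset_span (htan _ (hdir _ hmem))) (Submodule.subset_span (htan _ (hdir _ hl))))

/-- The values that the effective coupling parameter `ν ∫ α h` can take. -/
def J : Set ℝ := {s | ∃ ν ∈ Icc 0 Y.νmax, ∃ x, s = ν * Y.α.1 x}

theorem convex_J : Convex ℝ Y.J := by
  have h1 : Y.J = (fun p : ℝ × Torus d => p.1 * Y.α.1 p.2) '' (Icc 0 Y.νmax ×ˢ univ) := by
    ext s
    constructor
    · rintro ⟨ν, hν, x, rfl⟩
      exact ⟨(ν, x), ⟨hν, mem_univ _⟩, rfl⟩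
    · rintro ⟨⟨ν, x⟩, ⟨hν, -⟩, rfl⟩
      exact ⟨ν, hν, x, rfl⟩
  rw [h1]
  refine (IsPreconnected.image (isPreconnected_Icc.prod isPreconnected_univ) _
    ?_).ordConnected.convex
  exact (continuous_fst.mul (Y.α.continuous.comp continuous_snd)).continuousOn

/-- The mean of `α` with respect to an element of `𝕎` is a value of `α`. -/
theorem exists_α_eq_Z {R : ℝ} {h : Y.X.B 1} (hh : h ∈ Y.X.W R) : ∃ x, Y.α.1 x = Y.Z h := by
  have hlow (m : ℝ) (hm : ∀ x, m ≤ Y.α.1 x) : m ≤ Y.Z h := by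
    have h1 := hh.2.1 (Y.α.toTest r - m • oneFn d r) fun x => by
      change 0 ≤ Y.α.1 x - m * 1
      linarith [hm x]
    have h2 : Y.X.pairing h (Y.α.toTest r - m • oneFn d r) = Y.Z h - m * Y.X.integral h := by
      simp [BanachScale.pairing, Z, BanachScale.integral]
    rw [h2, hh.2.2] at h1
    linarith
  have hupp (m : ℝ) (hm : ∀ x, Y.α.1 x ≤ m) : Y.Z h ≤ m := by
    have h1 := hh.2.1 (m • oneFn d r - Y.α.toTest r) fun x => by
      change 0 ≤ m * 1 - Y.α.1 x
      linarith [hm x]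
    have h2 : Y.X.pairing h (m • oneFn d r - Y.α.toTest r) = m * Y.X.integral h - Y.Z h := by
      simp [BanachScale.pairing, Z, BanachScale.integral]
    rw [h2, hh.2.2] at h1
    linarith
  obtain ⟨x, -, hx⟩ := isCompact_univ.exists_isMinOn univ_nonempty Y.α.continuous.continuousOn
  obtain ⟨y, -, hy⟩ := isCompact_univ.exists_isMaxOn univ_nonempty Y.α.continuous.continuousOn
  exact mem_range_of_exists_le_of_exists_ge Y.α.continuous
    ⟨x, hlow _ fun z => hx (mem_univ z)⟩ ⟨y, hupp _ fun z => hy (mem_univ z)⟩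

theorem mul_Z_mem_J {R ν : ℝ} (hν : ν ∈ Icc 0 Y.νmax) {h : Y.X.B 1} (hh : h ∈ Y.X.W R) :
    ν * Y.Z h ∈ Y.J := by
  obtain ⟨x, hx⟩ := Y.exists_α_eq_Z hh
  exact ⟨ν, hν, x, by rw [hx]⟩

/-- The reduction to one parameter: invariant measures and their derivatives depend on `(ν, h)`
only through `ν ∫ α h`, by functions `η` and `θ` with `η' = θ` on the admissible parameters. -/
structure LinearResponse (R : ℝ) (η θ : ℝ → Y.X.B 1) (M : ℝ) : Prop where
  η_mem : ∀ s ∈ Y.J, η s ∈ Y.X.W R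
  θ_mem : ∀ s ∈ Y.J, θ s ∈ Y.X.V
  taylor : ∀ s ∈ Y.J, ∀ s₀ ∈ Y.J, ‖η s - η s₀ - (s - s₀) • θ s₀‖ ≤ M * |s - s₀| ^ 2
  H_eq : ∀ ν ∈ Icc 0 Y.νmax, ∀ h ∈ Y.X.W R, Y.H R ν h = η (ν * Y.Z h)
  Θ_eq : ∀ ν ∈ Icc 0 Y.νmax, ∀ h ∈ Y.X.W R, (Y.Θ R ν h : Y.X.B 1) = θ (ν * Y.Z h)
  uniqueDiff : ∀ h ∈ Y.X.W R, UniqueDiffWithinAt ℝ (Y.directions R h) 0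

/-- The reduction holds for all large `R`: the bounds needed are that of the norms of the invariant
measures, for existence, and `‖m‖ < R` for Lebesgue measure `m`, for unique differentiability. -/
theorem exists_linearResponse {𝒯 : Set (TorusMap d r)} {K C ϑ : ℝ} {c c' : ℕ}
    (h_mem : ∀ ν ∈ Icc 0 Y.νmax, ∀ μ : Measure (Torus d), IsProbabilityMeasure μ →
      coupledMap r Y.T Y.β ν (∫ x, Y.α.1 x ∂μ) ∈ 𝒯)
    (hX : Y.X.Assumptions 𝒯 K C ϑ c c') :
    ∃ R₀ : ℝ, ∀ R ≥ R₀, ∃ (η θ : ℝ → Y.X.B 1) (M : ℝ), Y.LinearResponse R η θ M := by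
  -- the Dirac measure at `x` has mean `α x`
  have hJ𝒯 : ∀ s ∈ Y.J, coupledMap r Y.T Y.β 1 s ∈ 𝒯 := by
    rintro s ⟨ν, hν, x, rfl⟩
    have h1 := h_mem ν hν (Measure.dirac x) inferInstance
    rwa [integral_dirac, coupledMap_eq] at h1
  obtain ⟨η, θ, A, M, hη, hθ, hM⟩ := hX.exists_linear_response Y.convex_J hJ𝒯
  refine ⟨max A (‖Y.X.lebesgue‖ + 1), fun R hR => ⟨η, θ, M, ?_⟩⟩
  have hη_mem : ∀ s ∈ Y.J, η s ∈ Y.X.W R := fun s hs =>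
    ⟨(hη s hs).1.trans ((le_max_left _ _).trans hR), (hη s hs).2.2.1, (hη s hs).2.1⟩
  have hmap (ν : ℝ) (h : Y.X.B 1) : Y.map ν h = coupledMap r Y.T Y.β 1 (ν * Y.Z h) :=
    coupledMap_eq r Y.T Y.β ν (Y.Z h)
  have hH : ∀ ν ∈ Icc 0 Y.νmax, ∀ h ∈ Y.X.W R, Y.H R ν h = η (ν * Y.Z h) := by
    intro ν hν h hh
    have hs := Y.mul_Z_mem_J hν hh
    have h1 : Y.H R ν h ∈ Y.X.W R ∧
        transfer (Y.map ν h) (Y.X.ι 1 (Y.H R ν h)) = Y.X.ι 1 (Y.H R ν h) :=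
      Classical.epsilon_spec (p := fun u => u ∈ Y.X.W R ∧
        transfer (Y.map ν h) (Y.X.ι 1 u) = Y.X.ι 1 u)
        ⟨η (ν * Y.Z h), hη_mem _ hs, by rw [hmap]; exact (hη _ hs).2.2.2⟩
    rw [hmap] at h1
    refine sub_eq_zero.1 (hX.eq_zero_of_transfer_eq (hJ𝒯 _ hs) ?_ ?_)
    · change Y.X.integralL 1 (_ - _) = 0
      rw [map_sub, Y.X.integralL_apply, Y.X.integralL_apply, h1.1.2.2, (hη _ hs).2.1, sub_self]
    · rw [map_sub, map_sub, h1.2, (hη _ hs).2.2.2]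
  refine ⟨hη_mem, fun s hs => (hθ s hs).1, hM, hH, ?_, fun h hh => Y.uniqueDiffWithinAt_directions
    (lt_of_lt_of_le (lt_add_one _) ((le_max_right _ _).trans hR)) hh⟩
  intro ν hν h hh
  have hs := Y.mul_Z_mem_J hν hh
  have h1 : raise d r (Y.X.ι 1 (Y.Θ R ν h) - transfer (Y.map ν h) (Y.X.ι 1 (Y.Θ R ν h))) =
      -∑ k, partialDist r k
        (transfer (Y.map ν h) (mulDist ((Y.β k).toTest r) (Y.X.ι 1 (Y.H R ν h)))) :=
    Classical.epsilon_spec (p := fun v : Y.X.V =>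
      raise d r (Y.X.ι 1 v - transfer (Y.map ν h) (Y.X.ι 1 v)) =
      -∑ k, partialDist r k
        (transfer (Y.map ν h) (mulDist ((Y.β k).toTest r) (Y.X.ι 1 (Y.H R ν h)))))
      ⟨⟨θ (ν * Y.Z h), (hθ _ hs).1⟩, by rw [hmap, hH ν hν h hh]; exact (hθ _ hs).2⟩
  rw [hmap, hH ν hν h hh, ← (hθ _ hs).2] at h1
  have h2 := raise_injective d r h1
  refine sub_eq_zero.1 (hX.eq_zero_of_transfer_eq (hJ𝒯 _ hs) ?_ ?_)
  · change Y.X.integralL 1 (_ - _) = 0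
    have h3 : Y.X.integral (Y.Θ R ν h : Y.X.B 1) = 0 := (Y.Θ R ν h).2
    rw [map_sub, Y.X.integralL_apply, Y.X.integralL_apply, h3, (hθ _ hs).1, sub_self]
  · rw [map_sub, map_sub, ← sub_eq_zero]
    rw [← sub_eq_zero] at h2
    rw [← neg_eq_zero, ← h2]
    abel

end System

/-! ### One-dimensional calculus -/

/-- A one- or two-sided interval at `c` is the image of `(-1, 1)` under a differentiable map: an
affine one in the interior of the half-line `0 ≤ s a`, a quadratic one at its end point. -/
theorem exists_parametrization (c a : ℝ) (h : 0 < c * a ∨ (c = 0 ∧ a ≠ 0)) :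
    ∃ ρ₀ > 0, ∀ ρ, 0 < ρ → ρ ≤ ρ₀ → ∃ σ : ℝ → ℝ, Differentiable ℝ σ ∧ σ 0 = c ∧
      (∀ τ ∈ Ioo (-1 : ℝ) 1, |σ τ - c| < ρ ∧ 0 ≤ σ τ * a) ∧
      ∀ s, |s - c| < ρ → 0 ≤ s * a → ∃ τ ∈ Ioo (-1 : ℝ) 1, σ τ = s := by
  rcases h with h | ⟨rfl, ha⟩
  · have hc : c ≠ 0 := by
      rintro rfl
      simp at h
    refine ⟨|c|, abs_pos.2 hc, fun ρ hρ hρc => ⟨fun τ => c + ρ * τ, by fun_prop, by simp, ?_, ?_⟩⟩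
    · intro τ hτ
      have hτ' : |τ| < 1 := abs_lt.2 hτ
      refine ⟨?_, ?_⟩
      · rw [add_sub_cancel_left, abs_mul, abs_of_pos hρ]
        nlinarith
      · have h1 : |ρ * τ * a| ≤ c * a := by
          rw [abs_mul, abs_mul, abs_of_pos hρ, ← abs_of_pos h, abs_mul]
          refine mul_le_mul_of_nonneg_right ?_ (abs_nonneg a)
          nlinarith
        nlinarith [(abs_le.1 h1).1]
    · intro s hs _
      refine ⟨(s - c) / ρ, ?_, by field_simp; ring⟩
      rw [mem_Ioo, ← abs_lt, abs_div, abs_of_pos hρ, div_lt_one hρ]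
      exact hs
  · have ha' : 0 < |a| := abs_pos.2 ha
    refine ⟨1, one_pos, fun ρ hρ _ => ⟨fun τ => a / |a| * ρ * τ ^ 2, by fun_prop, by simp, ?_, ?_⟩⟩
    · intro τ hτ
      have hτ' : τ ^ 2 < 1 := by
        rw [sq_lt_one_iff_abs_lt_one]
        exact abs_lt.2 hτ
      refine ⟨?_, ?_⟩
      · rw [sub_zero, abs_mul, abs_mul, abs_div, abs_abs, div_self ha'.ne', one_mul,
          abs_of_pos hρ, abs_of_nonneg (sq_nonneg τ)]
        nlinarith
      · have h1 : a / |a| * ρ * τ ^ 2 * a = (a ^ 2 / |a|) * (ρ * τ ^ 2) := by ring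
        rw [h1]
        positivity
    · intro s hs hsa
      rw [sub_zero] at hs
      refine ⟨√(|s| / ρ), ?_, ?_⟩
      · rw [mem_Ioo, ← abs_lt, abs_of_nonneg (Real.sqrt_nonneg _), Real.sqrt_lt' one_pos, one_pow,
          div_lt_one hρ]
        exact hs
      · have h1 : |s| * |a| = s * a := by rw [← abs_mul, abs_of_nonneg hsa]
        have h2 : |s| * a = s * |a| := by
          refine mul_right_cancel₀ ha'.ne' ?_
          rw [mul_right_comm, h1, mul_assoc, mul_assoc, abs_mul_abs_self]
        change a / |a| * ρ * √(|s| / ρ) ^ 2 = s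
        rw [Real.sq_sqrt (by positivity)]
        field_simp
        linarith

/-- If `ν₀ g'(s₀) ≠ 1`, the equation `ν g(s) = s` has at most one solution near `(ν₀, s₀)`. The
function `g` is only defined on a set `J`, of which `s₀` may be a boundary point. -/
theorem exists_unique_fixedPoint_near {J : Set ℝ} {g g' : ℝ → ℝ} {ν₀ s₀ B : ℝ}
    (htaylor : ∀ s ∈ J, ∀ t ∈ J, |g s - g t - (s - t) * g' t| ≤ B * |s - t| ^ 2)
    (hg' : ContinuousWithinAt g' J s₀) (hne : ν₀ * g' s₀ ≠ 1) :
    ∃ ρ > 0, ∀ ν, |ν - ν₀| < ρ → ∀ s ∈ J, |s - s₀| < ρ → ∀ t ∈ J, |t - s₀| < ρ →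
      ν * g s = s → ν * g t = t → s = t := by
  have hlim : Tendsto (fun p : ℝ × ℝ × ℝ => |1 - p.1 * g' p.2.2| - |p.1| * B * |p.2.1 - p.2.2|)
      (𝓝 ν₀ ×ˢ 𝓝[J] s₀ ×ˢ 𝓝[J] s₀) (𝓝 (|1 - ν₀ * g' s₀| - |ν₀| * B * |s₀ - s₀|)) := by
    have e1 : Tendsto (fun p : ℝ × ℝ × ℝ => p.1) (𝓝 ν₀ ×ˢ 𝓝[J] s₀ ×ˢ 𝓝[J] s₀) (𝓝 ν₀) :=
      tendsto_fst
    have e2 : Tendsto (fun p : ℝ × ℝ × ℝ => p.2.1) (𝓝 ν₀ ×ˢ 𝓝[J] s₀ ×ˢ 𝓝[J] s₀) (𝓝[J] s₀) :=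
      tendsto_fst.comp tendsto_snd
    have e3 : Tendsto (fun p : ℝ × ℝ × ℝ => p.2.2) (𝓝 ν₀ ×ˢ 𝓝[J] s₀ ×ˢ 𝓝[J] s₀) (𝓝[J] s₀) :=
      tendsto_snd.comp tendsto_snd
    have e4 : Tendsto (fun p : ℝ × ℝ × ℝ => g' p.2.2) (𝓝 ν₀ ×ˢ 𝓝[J] s₀ ×ˢ 𝓝[J] s₀)
      (𝓝 (g' s₀)) := hg'.tendsto.comp e3
    exact ((tendsto_const_nhds.sub (e1.mul e4)).abs).sub ((e1.abs.mul_const B).mul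
      ((e2.mono_right nhdsWithin_le_nhds).sub (e3.mono_right nhdsWithin_le_nhds)).abs)
  rw [sub_self, abs_zero, mul_zero, sub_zero] at hlim
  have hpos : 0 < |1 - ν₀ * g' s₀| := abs_pos.2 (sub_ne_zero.2 hne.symm)
  obtain ⟨pa, ha, pb, hb, h⟩ := eventually_prod_iff.1 (hlim.eventually (lt_mem_nhds hpos))
  obtain ⟨pc, hc, pd, hd, h'⟩ := eventually_prod_iff.1 hb
  obtain ⟨ρ₁, hρ₁, h1⟩ := Metric.eventually_nhds_iff.1 ha
  obtain ⟨ρ₂, hρ₂, h2⟩ := Metric.eventually_nhds_iff.1 (eventually_nhdsWithin_iff.1 hc)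
  obtain ⟨ρ₃, hρ₃, h3⟩ := Metric.eventually_nhds_iff.1 (eventually_nhdsWithin_iff.1 hd)
  refine ⟨min ρ₁ (min ρ₂ ρ₃), lt_min hρ₁ (lt_min hρ₂ hρ₃),
    fun ν hν s hs hsρ t ht htρ hes het => ?_⟩
  have h4 : 0 < |1 - ν * g' t| - |ν| * B * |s - t| :=
    h (h1 (hν.trans_le (min_le_left _ _)))
      (h' (h2 (hsρ.trans_le ((min_le_right _ _).trans (min_le_left _ _))) hs)
        (h3 (htρ.trans_le ((min_le_right _ _).trans (min_le_right _ _))) ht))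
  by_contra hst
  have hst' : 0 < |s - t| := abs_pos.2 (sub_ne_zero.2 hst)
  have h7 : |1 - ν * g' t| * |s - t| ≤ |ν| * B * |s - t| * |s - t| := by
    have h8 : (1 - ν * g' t) * (s - t) = ν * (g s - g t - (s - t) * g' t) := by
      linear_combination (-1 : ℝ) * hes + het
    rw [← abs_mul, h8, abs_mul]
    calc |ν| * _ ≤ |ν| * (B * |s - t| ^ 2) :=
          mul_le_mul_of_nonneg_left (htaylor s hs t ht) (abs_nonneg _)
      _ = _ := by ring
  have := le_of_mul_le_mul_right h7 hst'
  linarith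

/-- The one-sided form of `eventually_fold`. By the mean value theorem the sign of `q b - b` is that
of `q' - 1` at an intermediate point, which is a value of `q`. -/
theorem eventually_fold_right {q q' : ℝ → ℝ} {c κ : ℝ} (hq : ∀ᶠ s in 𝓝 c, HasDerivAt q (q' s) s)
    (hqc : q c = c) (hq'c : q' c = 1) (hp : HasDerivAt (fun s => q' (q s)) κ c) (hκ : κ ≠ 0) :
    ∀ᶠ b in 𝓝[>] c, 0 < (q b - b) * κ := by
  have h1 : ∀ᶠ s in 𝓝[>] c, c < q s := by
    have h := (hasDerivAt_iff_tendsto_slope.1 hq.self_of_nhds).eventually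
      (lt_mem_nhds (by rw [hq'c]; exact one_pos) : ∀ᶠ y in 𝓝 (q' c), 0 < y)
    have h' := h.filter_mono (nhdsWithin_mono c fun x (hx : c < x) => hx.ne')
    filter_upwards [h', self_mem_nhdsWithin] with s hs (hcs : c < s)
    rw [slope_def_field, hqc] at hs
    have := (div_pos_iff_of_pos_right (sub_pos.2 hcs)).1 hs
    linarith
  have h2 : ∀ᶠ s in 𝓝[>] c, 0 < (q' (q s) - 1) * κ := by
    have h := ((hasDerivAt_iff_tendsto_slope.1 hp).mul_const κ).eventually
      (lt_mem_nhds (mul_self_pos.2 hκ) : ∀ᶠ y in 𝓝 (κ * κ), 0 < y)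
    have h' := h.filter_mono (nhdsWithin_mono c fun x (hx : c < x) => hx.ne')
    filter_upwards [h', self_mem_nhdsWithin] with s hs (hcs : c < s)
    rw [slope_def_field, hqc, hq'c, div_mul_eq_mul_div] at hs
    exact (div_pos_iff_of_pos_right (sub_pos.2 hcs)).1 hs
  obtain ⟨u, hcu, hu⟩ := mem_nhdsGT_iff_exists_Ioo_subset.1
    (h1.and (h2.and (hq.filter_mono nhdsWithin_le_nhds)))
  have hcu' : c < u := hcu
  obtain ⟨v, hcv, hvu⟩ := exists_between hcu'
  have hcont (x : ℝ) (hx : c ≤ x) (hxu : x < u) : HasDerivAt q (q' x) x := by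
    rcases hx.eq_or_lt with rfl | hx
    · exact hq.self_of_nhds
    · exact (hu ⟨hx, hxu⟩).2.2
  have hqv : c < q v := (hu ⟨hcv, hvu⟩).1
  filter_upwards [Ioo_mem_nhdsGT (lt_min hqv hcv)] with b hb
  obtain ⟨ξ, hξ, hξ'⟩ := exists_hasDerivAt_eq_slope (fun s => q s - s) (fun s => q' s - 1) hb.1
    (fun x hx => ((hcont x hx.1 (hx.2.trans_lt (hb.2.trans_le (min_le_right _ _)|>.trans
      hvu))).continuousAt.sub continuousAt_id).continuousWithinAt)
    (fun x hx => (hcont x hx.1.le (hx.2.trans (hb.2.trans_le (min_le_right _ _)|>.trans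
      hvu))).sub (hasDerivAt_id x))
  -- the intermediate point is a value of `q`
  obtain ⟨s, hs, hsξ⟩ : ξ ∈ q '' Icc c v := by
    refine intermediate_value_Icc hcv.le (fun x hx =>
      (hcont x hx.1 (hx.2.trans_lt hvu)).continuousAt.continuousWithinAt) ⟨?_, ?_⟩
    · rw [hqc]
      exact hξ.1.le
    · exact (hξ.2.trans (hb.2.trans_le (min_le_left _ _))).le
  have hcs : c < s := by
    refine hs.1.lt_of_ne ?_
    rintro rfl
    rw [hqc] at hsξ
    exact hξ.1.ne hsξ
  have h3 := (hu ⟨hcs, hs.2.trans_lt hvu⟩).2.1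
  rw [hsξ] at h3
  change q' ξ - 1 = ((q b - b) - (q c - c)) / (b - c) at hξ'
  rw [hqc, sub_self, sub_zero] at hξ'
  rw [hξ', div_mul_eq_mul_div] at h3
  exact (div_pos_iff_of_pos_right (sub_pos.2 hb.1)).1 h3

/-- Let `c` be a fixed point of `q` with `q' c = 1`. If `q' ∘ q` has a nonzero derivative at `c`,
then `q b - b` keeps the same strict sign on both sides of `c`. -/
theorem eventually_fold {q q' : ℝ → ℝ} {c κ : ℝ} (hq : ∀ᶠ s in 𝓝 c, HasDerivAt q (q' s) s)
    (hqc : q c = c) (hq'c : q' c = 1) (hp : HasDerivAt (fun s => q' (q s)) κ c) (hκ : κ ≠ 0) :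
    ∀ᶠ b in 𝓝[≠] c, 0 < (q b - b) * κ := by
  rw [← nhdsLT_sup_nhdsGT, eventually_sup]
  refine ⟨?_, eventually_fold_right hq hqc hq'c hp hκ⟩
  -- reflect the line
  have hneg : Tendsto (fun x : ℝ => -x) (𝓝 (-c)) (𝓝 c) := by
    simpa using (continuous_neg (G := ℝ)).tendsto (-c)
  have h1 := eventually_fold_right (q := fun x => -q (-x)) (q' := fun x => q' (-x)) (c := -c)
    (κ := -κ) ?_ (by simp [hqc]) (by simp [hq'c]) ?_ (neg_ne_zero.2 hκ)
  · have hneg' : Tendsto (fun x : ℝ => -x) (𝓝[<] c) (𝓝[>] (-c)) := tendsto_neg_nhdsLT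
    filter_upwards [hneg'.eventually h1] with b hb
    rw [neg_neg] at hb
    linarith
  · filter_upwards [hneg.eventually hq] with x hx
    have h2 := (hx.comp x (hasDerivAt_neg x)).neg
    exact h2.congr_deriv (by ring)
  · have h2 : HasDerivAt (fun s => q' (q s)) κ (-(-c)) := by rwa [neg_neg]
    have h3 := h2.comp (-c) (hasDerivAt_neg (-c))
    simpa [Function.comp_def] using h3

/-- A continuous function that lies strictly on the same side of its value at `c` at both ends of an
interval around `c` takes some value on both sides of `c`. -/
theorem exists_two_preimages {N : ℝ → ℝ} {a b c : ℝ} (hac : a < c) (hcb : c < b)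
    (hN : ContinuousOn N (Icc a b)) (h : 0 < (N a - N c) * (N b - N c)) :
    ∃ x ∈ Icc a b, ∃ y ∈ Icc a b, x ≠ y ∧ N x = N y := by
  wlog hlt : N a < N c generalizing N
  · have h1 : N c < N a := by
      refine lt_of_le_of_ne (not_lt.1 hlt) fun h2 => ?_
      rw [h2, sub_self, zero_mul] at h
      exact h.false
    obtain ⟨x, hx, y, hy, hxy, he⟩ := this (N := fun x => -N x) hN.neg (by linarith)
      (neg_lt_neg h1)
    exact ⟨x, hx, y, hy, hxy, neg_injective he⟩
  have hlt' : N b < N c := by nlinarith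
  have hl : Icc a c ⊆ Icc a b := Icc_subset_Icc_right hcb.le
  have hr : Icc c b ⊆ Icc a b := Icc_subset_Icc_left hac.le
  obtain ⟨x, hx, hxv⟩ := intermediate_value_Icc hac.le (hN.mono hl)
    (⟨le_max_left _ _, (max_lt hlt hlt').le⟩ : max (N a) (N b) ∈ Icc (N a) (N c))
  obtain ⟨y, hy, hyv⟩ := intermediate_value_Icc' hcb.le (hN.mono hr)
    (⟨le_max_right _ _, (max_lt hlt hlt').le⟩ : max (N a) (N b) ∈ Icc (N b) (N c))
  refine ⟨x, hl hx, y, hr hy, fun hxy => ?_, hxv.trans hyv.symm⟩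
  have hxc : x = c := le_antisymm hx.2 (hxy ▸ hy.1)
  rw [hxc] at hxv
  exact (max_lt hlt hlt').ne' hxv

/-! ### The derivative of the fixed point equation -/

namespace System

variable {d r : ℕ} (Y : System.{u} d r)

/-- The functional `h ↦ ∫ α h` as a continuous linear map. -/
def ZL (i : Fin 4) : Y.X.B i →L[ℝ] ℝ := (Y.X.ι i).flip (Y.α.toTest r)

theorem continuous_Z {i : Fin 4} : Continuous fun h : Y.X.B i => Y.Z h := (Y.ZL i).continuous

theorem Z_incl₁₀ (h : Y.X.B 1) : Y.Z (Y.incl₁₀ h) = Y.Z h :=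
  congrArg (fun D : Dist d r => D (Y.α.toTest r)) (Y.X.ι_incl 0 h)

namespace LinearResponse

variable {Y} {R M : ℝ} {η θ : ℝ → Y.X.B 1} (hL : Y.LinearResponse R η θ M)
include hL

theorem hasDerivWithinAt_η {s : ℝ} (hs : s ∈ Y.J) : HasDerivWithinAt η (θ s) Y.J s := by
  rw [hasDerivWithinAt_iff_isLittleO]
  have h1 : (fun t => η t - η s - (t - s) • θ s) =O[𝓝[Y.J] s] fun t => (t - s) ^ 2 := by
    refine Asymptotics.IsBigO.of_bound M ?_
    filter_upwards [self_mem_nhdsWithin] with t ht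
    rw [norm_pow]
    exact hL.taylor t ht s hs
  refine h1.trans_isLittleO (Asymptotics.IsLittleO.mono ?_ nhdsWithin_le_nhds)
  have h2 : Tendsto (fun t : ℝ => t - s) (𝓝 s) (𝓝 0) := by
    simpa using (continuous_sub_right s).tendsto s
  have h3 := (Asymptotics.isLittleO_pow_id (𝕜 := ℝ) one_lt_two).comp_tendsto h2
  exact h3

/-- The Taylor formula with the roles of the two points exchanged makes `θ` Lipschitz. -/
theorem norm_θ_sub_le {s t : ℝ} (hs : s ∈ Y.J) (ht : t ∈ Y.J) :
    ‖θ s - θ t‖ ≤ 2 * M * |s - t| := by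
  rcases eq_or_ne s t with rfl | hne
  · simp
  have hpos : 0 < |s - t| := abs_pos.2 (sub_ne_zero.2 hne)
  have h1 := hL.taylor s hs t ht
  have h2 := hL.taylor t ht s hs
  have h3 : (s - t) • (θ s - θ t) =
      (η s - η t - (s - t) • θ t) + (η t - η s - (t - s) • θ s) := by
    simp only [smul_sub, sub_smul]
    abel
  have h4 := norm_add_le (η s - η t - (s - t) • θ t) (η t - η s - (t - s) • θ s)
  rw [← h3, norm_smul, Real.norm_eq_abs] at h4
  rw [abs_sub_comm t s] at h2
  refine le_of_mul_le_mul_left (a := |s - t|) ?_ hpos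
  nlinarith

theorem continuousWithinAt_θ {s : ℝ} (hs : s ∈ Y.J) : ContinuousWithinAt θ Y.J s := by
  rw [ContinuousWithinAt, tendsto_iff_norm_sub_tendsto_zero]
  refine squeeze_zero' (Eventually.of_forall fun _ => norm_nonneg _)
    (eventually_mem_nhdsWithin.mono fun t ht => hL.norm_θ_sub_le ht hs) ?_
  have h1 : Tendsto (fun t : ℝ => 2 * M * |t - s|) (𝓝 s) (𝓝 (2 * M * |s - s|)) :=
    Continuous.tendsto (by fun_prop) s
  rw [sub_self, abs_zero, mul_zero] at h1
  exact h1.mono_left nhdsWithin_le_nhds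

theorem F_eq {ν : ℝ} (hν : ν ∈ Icc 0 Y.νmax) {h : Y.X.B 1} (hh : h ∈ Y.X.W R) :
    Y.F R ν h = h - η (ν * Y.Z h) := by
  rw [F, hL.H_eq ν hν h hh]

theorem F_eq_zero_iff {ν : ℝ} (hν : ν ∈ Icc 0 Y.νmax) {h : Y.X.B 1} (hh : h ∈ Y.X.W R) :
    Y.F R ν h = 0 ↔ η (ν * Y.Z h) = h := by
  rw [hL.F_eq hν hh, sub_eq_zero, eq_comm]

theorem F_η_eq_zero {ν s : ℝ} (hν : ν ∈ Icc 0 Y.νmax) (hs : s ∈ Y.J) (h : ν * Y.Z (η s) = s) :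
    Y.F R ν (η s) = 0 := by
  rw [hL.F_eq_zero_iff hν (hL.η_mem s hs), h]

/-- `D_h F` is a rank-one perturbation of the identity. -/
theorem DhF_apply {ν : ℝ} (hν : ν ∈ Icc 0 Y.νmax) {h : Y.X.B 1} (hh : h ∈ Y.X.W R) (φ : Y.X.V) :
    Y.DhF R ν h φ = φ - (ν * Y.Z (φ : Y.X.B 1)) • θ (ν * Y.Z h) := by
  let ψ : Y.X.V →L[ℝ] ℝ := ν • (Y.ZL 1).comp Y.X.V.subtypeL
  have h0 : (0 : Y.X.V) ∈ Y.directions R h := by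
    change h + ((0 : Y.X.V) : Y.X.B 1) ∈ Y.X.W R
    simpa using hh
  have hψ (φ : Y.X.V) : ν * Y.Z (h + (φ : Y.X.B 1)) = ν * Y.Z h + ψ φ := by
    change ν * Y.ZL 1 (h + (φ : Y.X.B 1)) = ν * Y.ZL 1 h + ν * Y.ZL 1 φ
    rw [map_add, mul_add]
  have h1 : HasFDerivWithinAt (fun φ : Y.X.V => ν * Y.Z h + ψ φ) ψ (Y.directions R h) 0 :=
    (ψ.hasFDerivAt.const_add _).hasFDerivWithinAt
  have hmaps : MapsTo (fun φ : Y.X.V => ν * Y.Z h + ψ φ) (Y.directions R h) Y.J := fun φ hφ => by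
    change ν * Y.Z h + ψ φ ∈ Y.J
    rw [← hψ]
    exact Y.mul_Z_mem_J hν hφ
  have h2 : HasDerivWithinAt η (θ (ν * Y.Z h)) Y.J (ν * Y.Z h + ψ 0) := by
    rw [map_zero, add_zero]
    exact hL.hasDerivWithinAt_η (Y.mul_Z_mem_J hν hh)
  have h3 := h2.hasFDerivWithinAt.comp (0 : Y.X.V) h1 hmaps
  have h4 : HasFDerivWithinAt (fun φ : Y.X.V => h + (φ : Y.X.B 1)) Y.X.V.subtypeL
      (Y.directions R h) 0 := (Y.X.V.subtypeL.hasFDerivAt.const_add h).hasFDerivWithinAt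
  have h5 := (h4.sub h3).congr (f₁ := fun φ : Y.X.V => Y.F R ν (h + φ))
    (fun φ hφ => (hL.F_eq hν hφ).trans (by rw [hψ]; rfl))
    ((hL.F_eq hν h0).trans (by rw [hψ]; rfl))
  rw [DhF, h5.fderivWithin (hL.uniqueDiff h hh)]
  rfl

/-- `D_h F` is invertible exactly when the linearized scalar equation is. -/
theorem DhFInvertible_iff {ν : ℝ} (hν : ν ∈ Icc 0 Y.νmax) {h : Y.X.B 1} (hh : h ∈ Y.X.W R) :
    Y.DhFInvertible R ν h ↔ ν * Y.Z (θ (ν * Y.Z h)) ≠ 1 := by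
  have hs := Y.mul_Z_mem_J hν hh
  let t : Y.X.V := ⟨θ (ν * Y.Z h), hL.θ_mem _ hs⟩
  let ζ : Y.X.V →L[ℝ] ℝ := ν • (Y.ZL 1).comp Y.X.V.subtypeL
  have hD (φ : Y.X.V) : Y.DhF R ν h φ = ((φ - ζ φ • t : Y.X.V) : Y.X.B 1) := hL.DhF_apply hν hh φ
  have ht : ζ t = ν * Y.Z (θ (ν * Y.Z h)) := rfl
  rw [← ht]
  constructor
  · rintro ⟨e, he⟩ h1
    have h2 : e t = 0 := by
      refine Subtype.ext ?_
      rw [he, hD, h1, one_smul, sub_self]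
    have h3 : t = 0 := by simpa using h2
    rw [h3, map_zero] at h1
    exact zero_ne_one h1
  · intro h1
    have hne : 1 - ζ t ≠ 0 := sub_ne_zero.2 h1.symm
    -- the inverse of `1 - ζ ⊗ t` is `1 + (1 - ζ t)⁻¹ ζ ⊗ t`
    refine ⟨ContinuousLinearEquiv.equivOfInverse
      (ContinuousLinearMap.id ℝ Y.X.V - ζ.smulRight t)
      (ContinuousLinearMap.id ℝ Y.X.V + (1 - ζ t)⁻¹ • ζ.smulRight t) (fun φ => ?_) (fun φ => ?_),
      fun φ => (hD φ).symm⟩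
    · change (φ - ζ φ • t) + (1 - ζ t)⁻¹ • ζ (φ - ζ φ • t) • t = φ
      rw [map_sub, map_smul, smul_smul, sub_add, sub_eq_self, ← sub_smul]
      have h2 : ζ φ - (1 - ζ t)⁻¹ * (ζ φ - ζ φ • ζ t) = 0 := by
        rw [smul_eq_mul]
        field_simp
        ring
      rw [h2, zero_smul]
    · change (φ + (1 - ζ t)⁻¹ • ζ φ • t) - ζ (φ + (1 - ζ t)⁻¹ • ζ φ • t) • t = φ
      rw [map_add, map_smul, map_smul, smul_smul, add_sub_assoc, add_eq_left, ← sub_smul]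
      have h2 : (1 - ζ t)⁻¹ * ζ φ - (ζ φ + (1 - ζ t)⁻¹ • ζ φ • ζ t) = 0 := by
        simp only [smul_eq_mul]
        field_simp
        ring
      rw [h2, zero_smul]

/-- When `D_h F` is invertible, the scalar fixed point equation `ν g(t) = t` has at most one
solution near a given one. -/
theorem exists_unique_near {ν₀ s₀ : ℝ} (hs₀ : s₀ ∈ Y.J) (hne : ν₀ * Y.Z (θ s₀) ≠ 1) :
    ∃ ρ > 0, ∀ ν, |ν - ν₀| < ρ → ∀ s ∈ Y.J, |s - s₀| < ρ → ∀ t ∈ Y.J, |t - s₀| < ρ →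
      ν * Y.Z (η s) = s → ν * Y.Z (η t) = t → s = t := by
  refine exists_unique_fixedPoint_near (g := fun s => Y.Z (η s)) (g' := fun s => Y.Z (θ s))
    (B := ‖Y.ZL 1‖ * M) (fun s hs t ht => ?_)
    (Y.continuous_Z.continuousAt.comp_continuousWithinAt (hL.continuousWithinAt_θ hs₀)) hne
  have h6 : Y.Z (η s) - Y.Z (η t) - (s - t) * Y.Z (θ t) =
      Y.ZL 1 (η s - η t - (s - t) • θ t) := by
    rw [map_sub, map_sub, map_smul]
    rfl
  rw [h6, mul_assoc]
  exact ((Y.ZL 1).le_opNorm _).trans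
    (mul_le_mul_of_nonneg_left (hL.taylor s hs t ht) (norm_nonneg _))

/-- Nonvanishing of `∫ α D_h² F (Θ, Θ)` produces a nonzero derivative of
`s ↦ g'(ν₀ g(s))` at a fixed point, where `g s = ∫ α η(s)`. A nonvanishing `D_h² F` is a genuine
derivative, and it is composed with the curve `η` inside `𝕎`. -/
theorem hasDerivAt_of_H2 {ν₀ : ℝ} (hν₀ : ν₀ ∈ Icc 0 Y.νmax) {h₀ : Y.X.B 1} (hh₀ : h₀ ∈ Y.X.W R)
    (hfix : η (ν₀ * Y.Z h₀) = h₀) (hJ : Y.J ∈ 𝓝 (ν₀ * Y.Z h₀))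
    (hcrit : ν₀ * Y.Z (θ (ν₀ * Y.Z h₀)) = 1) (h2 : Y.H2 R ν₀ h₀) :
    ∃ κ ≠ 0, HasDerivAt (fun s => ν₀ * Y.Z (θ (ν₀ * Y.Z (η s)))) κ (ν₀ * Y.Z h₀) := by
  set s₀ := ν₀ * Y.Z h₀ with hs₀_def
  have hs₀ : s₀ ∈ Y.J := Y.mul_Z_mem_J hν₀ hh₀
  have hdiff : DifferentiableWithinAt ℝ
      (fun φ : Y.X.V => Y.incl₁₀.comp (Y.DhF R ν₀ (h₀ + φ))) (Y.directions R h₀) 0 := by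
    -- otherwise `D_h² F` would have the value `0`
    by_contra hnd
    refine h2 ?_
    rw [DhhF, fderivWithin_zero_of_not_differentiableWithinAt hnd]
    exact (Y.ZL 0).map_zero
  let t : Y.X.V := ⟨θ s₀, hL.θ_mem s₀ hs₀⟩
  have hΘ : Y.Θ R ν₀ h₀ = t := Subtype.ext (hL.Θ_eq ν₀ hν₀ h₀ hh₀)
  have hkey : Y.Z (Y.DhhF R ν₀ h₀ t t) ≠ 0 := by
    rw [← hΘ]
    exact h2
  -- the curve `η - h₀` in `𝕍`; the projection is the identity there and only provides the type
  let γ : ℝ → Y.X.V := fun s => Y.X.projV (η s - h₀)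
  have hγ (s : ℝ) (hs : s ∈ Y.J) : h₀ + (γ s : Y.X.B 1) = η s := by
    have h1 : Y.X.integral (η s - h₀) = 0 := by
      change Y.X.integralL 1 (η s - h₀) = 0
      rw [map_sub, Y.X.integralL_apply, Y.X.integralL_apply, (hL.η_mem s hs).2.2, hh₀.2.2, sub_self]
    rw [BanachScale.coe_projV, h1, zero_smul, sub_zero, add_sub_cancel]
  have hγ₀ : γ s₀ = 0 := by
    change Y.X.projV (η s₀ - h₀) = 0
    rw [hfix, sub_self, map_zero]
  have hγd : HasDerivWithinAt γ t Y.J s₀ := by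
    have h3 := Y.X.projV.hasFDerivAt.comp_hasDerivWithinAt s₀
      ((hL.hasDerivWithinAt_η hs₀).sub_const h₀)
    have h4 : Y.X.projV (θ s₀) = t := Y.X.projV_coe t
    rw [h4] at h3
    exact h3
  have hmaps : MapsTo γ Y.J (Y.directions R h₀) := fun s hs => by
    change h₀ + (γ s : Y.X.B 1) ∈ Y.X.W R
    rw [hγ s hs]
    exact hL.η_mem s hs
  have h5 : HasFDerivWithinAt (fun φ : Y.X.V => Y.incl₁₀.comp (Y.DhF R ν₀ (h₀ + φ)))
      (Y.DhhF R ν₀ h₀) (Y.directions R h₀) (γ s₀) := by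
    rw [hγ₀]
    exact hdiff.hasFDerivWithinAt
  have h6 := HasFDerivWithinAt.comp_hasDerivWithinAt (F := Y.X.V) (E := Y.X.V →L[ℝ] Y.X.B 0)
    s₀ h5 hγd hmaps
  let ev : (Y.X.V →L[ℝ] Y.X.B 0) →L[ℝ] ℝ := (Y.ZL 0).comp (ContinuousLinearMap.apply ℝ _ t)
  have h7 := ev.hasFDerivAt.comp_hasDerivWithinAt s₀ h6
  have h8 : HasDerivAt (ev ∘ (fun φ : Y.X.V => Y.incl₁₀.comp (Y.DhF R ν₀ (h₀ + φ))) ∘ γ)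
      (Y.Z (Y.DhhF R ν₀ h₀ t t)) s₀ := h7.hasDerivAt hJ
  have h9 : ∀ᶠ s in 𝓝 s₀, 1 - ν₀ * (ev ∘ (fun φ : Y.X.V =>
      Y.incl₁₀.comp (Y.DhF R ν₀ (h₀ + φ))) ∘ γ) s = ν₀ * Y.Z (θ (ν₀ * Y.Z (η s))) := by
    filter_upwards [hJ] with s hs
    have h10 : (ev ∘ (fun φ : Y.X.V => Y.incl₁₀.comp (Y.DhF R ν₀ (h₀ + φ))) ∘ γ) s =
        Y.Z (θ s₀) - ν₀ * Y.Z (θ s₀) * Y.Z (θ (ν₀ * Y.Z (η s))) := by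
      change Y.Z (Y.incl₁₀ (Y.DhF R ν₀ (h₀ + (γ s : Y.X.B 1)) t)) = _
      rw [Y.Z_incl₁₀, hγ s hs, hL.DhF_apply hν₀ (hL.η_mem s hs)]
      change Y.ZL 1 (θ s₀ - (ν₀ * Y.Z (θ s₀)) • θ (ν₀ * Y.Z (η s))) = _
      rw [map_sub, map_smul]
      rfl
    rw [h10, mul_sub, hcrit, one_mul]
    ring
  have hν₀' : ν₀ ≠ 0 := by
    rintro rfl
    rw [zero_mul] at hcrit
    exact zero_ne_one hcrit
  refine ⟨-(ν₀ * Y.Z (Y.DhhF R ν₀ h₀ t t)), neg_ne_zero.2 (mul_ne_zero hν₀' hkey), ?_⟩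
  refine ((h8.const_mul ν₀).const_sub 1).congr_of_eventuallyEq (h9.mono fun s hs => hs.symm)

end LinearResponse

end System

/-! ### Solutions near a given one -/

namespace System.LinearResponse

variable {d r : ℕ} {Y : System.{u} d r} {R M : ℝ} {η θ : ℝ → Y.X.B 1}
  (hL : Y.LinearResponse R η θ M)
include hL

theorem continuousWithinAt_Z_η {s : ℝ} (hs : s ∈ Y.J) :
    ContinuousWithinAt (fun t => Y.Z (η t)) Y.J s :=
  Y.continuous_Z.continuousAt.comp_continuousWithinAt (hL.hasDerivWithinAt_η hs).continuousWithinAt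

variable {ν₀ : ℝ} (hν₀ : ν₀ ∈ Ico 0 Y.νmax) {h₀ : Y.X.B 1} (hh₀ : h₀ ∈ Y.X.W R)
  (hfix : η (ν₀ * Y.Z h₀) = h₀)

omit hL in
/-- The solutions close to `(ν₀, h₀)` have a parameter `ν ∫ α h` close to `ν₀ ∫ α h₀`. -/
theorem exists_dist_control (ν₀ : ℝ) (h₀ : Y.X.B 1) {ρ : ℝ} (hρ : 0 < ρ) :
    ∃ δ₀ > 0, ∀ ν h, |ν - ν₀| + ‖h - h₀‖ ≤ δ₀ →
      |ν * Y.Z h - ν₀ * Y.Z h₀| < ρ ∧ |Y.Z h - Y.Z h₀| < ρ ∧ |ν - ν₀| < ρ := by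
  have hZ : Continuous fun p : ℝ × Y.X.B 1 => Y.Z p.2 := Y.continuous_Z.comp continuous_snd
  obtain ⟨δ₁, hδ₁, h1⟩ := Metric.continuousAt_iff.1
    ((continuous_fst.mul hZ).continuousAt (x := (ν₀, h₀))) ρ hρ
  obtain ⟨δ₂, hδ₂, h2⟩ := Metric.continuousAt_iff.1 (hZ.continuousAt (x := (ν₀, h₀))) ρ hρ
  refine ⟨min δ₁ (min δ₂ ρ) / 2, by positivity, fun ν h hd => ?_⟩
  have hm : 0 < min δ₁ (min δ₂ ρ) := by positivity
  have hlt : |ν - ν₀| + ‖h - h₀‖ < min δ₁ (min δ₂ ρ) := hd.trans_lt (half_lt_self hm)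
  have hdist : dist (ν, h) (ν₀, h₀) < min δ₁ (min δ₂ ρ) := by
    rw [Prod.dist_eq, Real.dist_eq, dist_eq_norm]
    refine (max_le ?_ ?_).trans_lt hlt
    · linarith [norm_nonneg (h - h₀)]
    · linarith [abs_nonneg (ν - ν₀)]
  refine ⟨h1 (hdist.trans_le (min_le_left _ _)),
    h2 (hdist.trans_le ((min_le_right _ _).trans (min_le_left _ _))), ?_⟩
  have := (min_le_right δ₁ (min δ₂ ρ)).trans (min_le_right δ₂ ρ)
  linarith [norm_nonneg (h - h₀)]

include hν₀ hh₀ hfix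

/-- When `∫ α h₀ ≠ 0`, the points `s` close to `ν₀ ∫ α h₀`, on the appropriate side if this is `0`,
are admissible and solve the scalar equation with coupling strength `s / ∫ α η(s)`. -/
theorem exists_admissible (ha : Y.Z h₀ ≠ 0) :
    ∃ ρ > 0, ∀ s, |s - ν₀ * Y.Z h₀| < ρ → 0 ≤ s * Y.Z h₀ →
      s ∈ Y.J ∧ 0 < Y.Z (η s) * Y.Z h₀ ∧ s / Y.Z (η s) ∈ Ico 0 Y.νmax := by
  have hs₀ := Y.mul_Z_mem_J ⟨hν₀.1, hν₀.2.le⟩ hh₀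
  set a := Y.Z h₀ with ha_def
  have hc : ContinuousWithinAt (fun s => Y.Z (η s)) Y.J (ν₀ * a) := hL.continuousWithinAt_Z_η hs₀
  have hga : Y.Z (η (ν₀ * a)) = a := by rw [hfix]
  have h1 : ∀ᶠ s in 𝓝[Y.J] (ν₀ * a), 0 < Y.Z (η s) * a := by
    refine (hc.mul_const a).eventually (lt_mem_nhds ?_)
    change 0 < Y.Z (η (ν₀ * a)) * a
    rw [hga]
    exact mul_self_pos.2 ha
  have h2 : ∀ᶠ s in 𝓝[Y.J] (ν₀ * a), s / Y.Z (η s) < Y.νmax := by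
    refine (continuousWithinAt_id.div hc (by rwa [hga])).eventually (gt_mem_nhds ?_)
    change (ν₀ * a) / Y.Z (η (ν₀ * a)) < _
    rw [hga, mul_div_cancel_right₀ _ ha]
    exact hν₀.2
  obtain ⟨ρ₁, hρ₁, h3⟩ := Metric.eventually_nhds_iff.1 (eventually_nhdsWithin_iff.1 (h1.and h2))
  have ha' : 0 < |a| := abs_pos.2 ha
  refine ⟨min ρ₁ (|a| * (Y.νmax - ν₀)), lt_min hρ₁ (mul_pos ha' (sub_pos.2 hν₀.2)),
    fun s hs hsa => ?_⟩
  have hsJ : s ∈ Y.J := by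
    obtain ⟨x, hx⟩ := Y.exists_α_eq_Z hh₀
    have hle : |s / a - ν₀| ≤ Y.νmax - ν₀ := by
      have e : s / a - ν₀ = (s - ν₀ * a) / a := by field_simp
      rw [e, abs_div, div_le_iff₀ ha', mul_comm (Y.νmax - ν₀)]
      exact (hs.trans_le (min_le_right _ _)).le
    refine ⟨s / a, ⟨?_, ?_⟩, x, ?_⟩
    · have e : s / a = s * a / a ^ 2 := by field_simp
      rw [e]
      positivity
    · linarith [(abs_le.1 hle).2]
    · rw [hx, ← ha_def, div_mul_cancel₀ _ ha]
  obtain ⟨h4, h5⟩ := h3 (hs.trans_le (min_le_left _ _)) hsJ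
  refine ⟨hsJ, h4, ?_, h5⟩
  have hg : Y.Z (η s) ≠ 0 := fun h => by simp [h] at h4
  have e : s / Y.Z (η s) = s * a * (Y.Z (η s) * a) / (Y.Z (η s) * a) ^ 2 := by field_simp
  rw [e]
  positivity

/-- When `∫ α h₀ ≠ 0`, the solutions near `(ν₀, h₀)` are parametrized by `s = ν ∫ α h`, through
`ν = s / ∫ α η(s)` and `h = η(s)`. -/
theorem exists_curve_of_Z_ne_zero (ha : Y.Z h₀ ≠ 0) :
    ∃ δ₀ > 0, ∀ δ, 0 < δ → δ ≤ δ₀ → ∃ (G : ℝ → ℝ) (hh : ℝ → Y.X.B 1),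
      (∀ τ ∈ Ioo (-δ) δ, G τ ∈ Icc 0 Y.νmax ∧ hh τ ∈ Y.X.W R ∧ Y.F R (G τ) (hh τ) = 0) ∧
      DifferentiableOn ℝ (fun τ => (G τ, hh τ)) (Ioo (-δ) δ) ∧ G 0 = ν₀ ∧ hh 0 = h₀ ∧
      ∀ ν ∈ Icc 0 Y.νmax, ∀ h ∈ Y.X.W R, |ν - ν₀| + ‖h - h₀‖ ≤ δ → Y.F R ν h = 0 →
        ∃ τ ∈ Ioo (-δ) δ, G τ = ν ∧ hh τ = h := by
  obtain ⟨ρ₁, hρ₁, hadm⟩ := hL.exists_admissible hν₀ hh₀ hfix ha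
  set a := Y.Z h₀ with ha_def
  have hca : 0 < ν₀ * a * a ∨ (ν₀ * a = 0 ∧ a ≠ 0) := by
    rcases hν₀.1.eq_or_lt with h | h
    · exact Or.inr ⟨by rw [← h, zero_mul], ha⟩
    · left
      rw [mul_assoc]
      exact mul_pos h (mul_self_pos.2 ha)
  obtain ⟨ρ₀, hρ₀, hpar⟩ := exists_parametrization (ν₀ * a) a hca
  have hρ : 0 < min ρ₀ ρ₁ := lt_min hρ₀ hρ₁
  obtain ⟨σ, hσd, hσ0, hσ, hσs⟩ := hpar (min ρ₀ ρ₁) hρ (min_le_left _ _)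
  obtain ⟨δ₀, hδ₀, hctl⟩ := exists_dist_control (Y := Y) ν₀ h₀ (lt_min hρ (abs_pos.2 ha))
  refine ⟨δ₀, hδ₀, fun δ hδ hδδ₀ => ?_⟩
  have hscale : ∀ τ ∈ Ioo (-δ) δ, τ / δ ∈ Ioo (-1 : ℝ) 1 := fun τ hτ => by
    rw [mem_Ioo, ← abs_lt, abs_div, abs_of_pos hδ, div_lt_one hδ]
    exact abs_lt.2 hτ
  let S : ℝ → ℝ := fun τ => σ (τ / δ)
  have hS : ∀ τ ∈ Ioo (-δ) δ, S τ ∈ Y.J ∧ 0 < Y.Z (η (S τ)) * a ∧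
      S τ / Y.Z (η (S τ)) ∈ Ico 0 Y.νmax := fun τ hτ =>
    hadm _ ((hσ _ (hscale τ hτ)).1.trans_le (min_le_right _ _)) (hσ _ (hscale τ hτ)).2
  have hg : ∀ τ ∈ Ioo (-δ) δ, Y.Z (η (S τ)) ≠ 0 := fun τ hτ h => by
    have := (hS τ hτ).2.1
    simp [h] at this
  have hSd : Differentiable ℝ S := hσd.comp (differentiable_id.div_const δ)
  have hηd : DifferentiableOn ℝ (fun τ => η (S τ)) (Ioo (-δ) δ) := fun τ hτ =>
    ((hL.hasDerivWithinAt_η (hS τ hτ).1).hasFDerivWithinAt.comp τ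
      (hSd τ).hasFDerivAt.hasFDerivWithinAt fun t ht => (hS t ht).1).differentiableWithinAt
  have hS0 : S 0 = ν₀ * a := by simp only [S, zero_div, hσ0]
  refine ⟨fun τ => S τ / Y.Z (η (S τ)), fun τ => η (S τ), fun τ hτ => ⟨?_, ?_, ?_⟩, ?_, ?_, ?_, ?_⟩
  · exact Ico_subset_Icc_self (hS τ hτ).2.2
  · exact hL.η_mem _ (hS τ hτ).1
  · exact hL.F_η_eq_zero (Ico_subset_Icc_self (hS τ hτ).2.2) (hS τ hτ).1
      (div_mul_cancel₀ _ (hg τ hτ))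
  · exact (hSd.differentiableOn.div ((Y.ZL 1).differentiable.comp_differentiableOn hηd) hg).prodMk
      hηd
  · change S 0 / Y.Z (η (S 0)) = ν₀
    rw [hS0, hfix, mul_div_cancel_right₀ _ ha]
  · change η (S 0) = h₀
    rw [hS0, hfix]
  · intro ν hν h hh hd hF
    obtain ⟨h1, h2, -⟩ := hctl ν h (hd.trans hδδ₀)
    rw [hL.F_eq_zero_iff hν hh] at hF
    have hpos : 0 < Y.Z h * a := by
      have h3 : |(Y.Z h - a) * a| < a * a := by
        rw [abs_mul, ← abs_mul_abs_self a]
        exact mul_lt_mul_of_pos_right (h2.trans_le (min_le_right _ _)) (abs_pos.2 ha)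
      linarith [(abs_lt.1 h3).1]
    have hne : Y.Z h ≠ 0 := fun h => by simp [h] at hpos
    obtain ⟨τ, hτ, hτs⟩ := hσs (ν * Y.Z h) (h1.trans_le (min_le_left _ _))
      (by rw [mul_assoc]; exact mul_nonneg hν.1 hpos.le)
    have hSτ : S (δ * τ) = ν * Y.Z h := by
      simp only [S, mul_div_cancel_left₀ τ hδ.ne', hτs]
    refine ⟨δ * τ, ?_, ?_, ?_⟩
    · rw [mem_Ioo, ← abs_lt, abs_mul, abs_of_pos hδ]
      have : |τ| < 1 := abs_lt.2 hτ
      nlinarith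
    · change S (δ * τ) / Y.Z (η (S (δ * τ))) = ν
      rw [hSτ, hF, mul_div_cancel_right₀ _ hne]
    · change η (S (δ * τ)) = h
      rw [hSτ, hF]

/-- When `∫ α h₀ = 0` and the linearized equation is nondegenerate, all solutions near
`(ν₀, h₀)` are of the form `(ν, h₀)`. -/
theorem exists_curve_of_Z_eq_zero (ha : Y.Z h₀ = 0) (hne : ν₀ * Y.Z (θ (ν₀ * Y.Z h₀)) ≠ 1) :
    ∃ δ₀ > 0, ∀ δ, 0 < δ → δ ≤ δ₀ → ∃ (G : ℝ → ℝ) (hh : ℝ → Y.X.B 1),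
      (∀ τ ∈ Ioo (-δ) δ, G τ ∈ Icc 0 Y.νmax ∧ hh τ ∈ Y.X.W R ∧ Y.F R (G τ) (hh τ) = 0) ∧
      DifferentiableOn ℝ (fun τ => (G τ, hh τ)) (Ioo (-δ) δ) ∧ G 0 = ν₀ ∧ hh 0 = h₀ ∧
      ∀ ν ∈ Icc 0 Y.νmax, ∀ h ∈ Y.X.W R, |ν - ν₀| + ‖h - h₀‖ ≤ δ → Y.F R ν h = 0 →
        ∃ τ ∈ Ioo (-δ) δ, G τ = ν ∧ hh τ = h := by
  have hs₀ := Y.mul_Z_mem_J ⟨hν₀.1, hν₀.2.le⟩ hh₀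
  obtain ⟨ρ₁, hρ₁, huniq⟩ := hL.exists_unique_near hs₀ hne
  have hca : 0 < ν₀ * 1 ∨ (ν₀ = 0 ∧ (1 : ℝ) ≠ 0) := by
    rcases hν₀.1.eq_or_lt with h | h
    · exact Or.inr ⟨h.symm, one_ne_zero⟩
    · exact Or.inl (by rwa [mul_one])
  obtain ⟨ρ₀, hρ₀, hpar⟩ := exists_parametrization ν₀ 1 hca
  have hρ : 0 < min ρ₀ (Y.νmax - ν₀) := lt_min hρ₀ (sub_pos.2 hν₀.2)
  obtain ⟨σ, hσd, hσ0, hσ, hσs⟩ := hpar _ hρ (min_le_left _ _)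
  obtain ⟨δ₀, hδ₀, hctl⟩ := exists_dist_control (Y := Y) ν₀ h₀ (lt_min hρ hρ₁)
  refine ⟨δ₀, hδ₀, fun δ hδ hδδ₀ => ?_⟩
  have hscale : ∀ τ ∈ Ioo (-δ) δ, τ / δ ∈ Ioo (-1 : ℝ) 1 := fun τ hτ => by
    rw [mem_Ioo, ← abs_lt, abs_div, abs_of_pos hδ, div_lt_one hδ]
    exact abs_lt.2 hτ
  rw [ha, mul_zero] at hfix hs₀ huniq
  have hG : ∀ τ ∈ Ioo (-δ) δ, σ (τ / δ) ∈ Icc 0 Y.νmax := fun τ hτ => by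
    obtain ⟨h1, h2⟩ := hσ _ (hscale τ hτ)
    rw [mul_one] at h2
    exact ⟨h2, by linarith [(abs_lt.1 (h1.trans_le (min_le_right _ _))).2]⟩
  refine ⟨fun τ => σ (τ / δ), fun _ => h₀, fun τ hτ => ⟨hG τ hτ, hh₀, ?_⟩, ?_, ?_, rfl, ?_⟩
  · rw [hL.F_eq_zero_iff (hG τ hτ) hh₀, ha, mul_zero, hfix]
  · exact ((hσd.comp (differentiable_id.div_const δ)).prodMk
      (differentiable_const h₀)).differentiableOn
  · simp only [zero_div, hσ0]
  · intro ν hν h hh hd hF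
    obtain ⟨h1, -, h3⟩ := hctl ν h (hd.trans hδδ₀)
    rw [hL.F_eq_zero_iff hν hh] at hF
    rw [ha, mul_zero] at h1
    have hs : ν * Y.Z h = 0 := by
      refine huniq ν (h3.trans_le (min_le_right _ _)) _ (Y.mul_Z_mem_J hν hh)
        (h1.trans_le (min_le_right _ _)) 0 hs₀ (by simpa using hρ₁) ?_ ?_
      · rw [hF]
      · rw [hfix, ha, mul_zero]
    rw [hs, hfix] at hF
    obtain ⟨τ, hτ, hτs⟩ := hσs ν (h3.trans_le (min_le_left _ _)) (by simpa using hν.1)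
    refine ⟨δ * τ, ?_, ?_, hF⟩
    · rw [mem_Ioo, ← abs_lt, abs_mul, abs_of_pos hδ]
      have : |τ| < 1 := abs_lt.2 hτ
      nlinarith
    · simp only [mul_div_cancel_left₀ τ hδ.ne', hτs]

/-- If the linearized equation is nondegenerate, there is a solution near the given one for each
nearby coupling strength. -/
theorem exists_solution_near (hne : ν₀ * Y.Z (θ (ν₀ * Y.Z h₀)) ≠ 1) {ρ : ℝ} (hρ : 0 < ρ) :
    ∃ ε > 0, ∀ ν ∈ Icc 0 Y.νmax, |ν - ν₀| < ε →
      ∃ s ∈ Y.J, |s - ν₀ * Y.Z h₀| < ρ ∧ ν * Y.Z (η s) = s := by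
  have hs₀ := Y.mul_Z_mem_J ⟨hν₀.1, hν₀.2.le⟩ hh₀
  by_cases ha : Y.Z h₀ = 0
  · rw [ha, mul_zero] at hs₀ hfix ⊢
    exact ⟨1, one_pos, fun ν _ _ => ⟨0, hs₀, by simpa using hρ, by rw [hfix, ha, mul_zero]⟩⟩
  obtain ⟨ρ₁, hρ₁, hadm⟩ := hL.exists_admissible hν₀ hh₀ hfix ha
  set a := Y.Z h₀ with ha_def
  have ha' : 0 < |a| := abs_pos.2 ha
  let N : ℝ → ℝ := fun s => s / Y.Z (η s)
  have hNc {t : Set ℝ} (ht : t ⊆ Y.J) (hg : ∀ s ∈ t, 0 < Y.Z (η s) * a) : ContinuousOn N t :=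
    fun s hs => continuousWithinAt_id.div ((hL.continuousWithinAt_Z_η (ht hs)).mono ht) fun h => by
      have := hg s hs
      simp [h] at this
  have hN (s : ℝ) (hs : 0 < Y.Z (η s) * a) : N s * Y.Z (η s) = s :=
    div_mul_cancel₀ _ fun h => by simp [h] at hs
  rcases hν₀.1.eq_or_lt with h0 | h0
  · -- one-sided neighbourhood of `s = 0`
    subst h0
    rw [zero_mul] at *
    let b := a / |a| * (min ρ ρ₁ / 2)
    have hm : 0 < min ρ ρ₁ := lt_min hρ hρ₁
    have hb_abs : |b| = min ρ ρ₁ / 2 := by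
      rw [abs_mul, abs_div, abs_abs, div_self ha'.ne', one_mul, abs_of_pos (half_pos hm)]
    have hba : 0 < b * a := by
      have : b * a = a ^ 2 / |a| * (min ρ ρ₁ / 2) := by ring
      rw [this]
      positivity
    have hseg : ∀ s ∈ uIcc 0 b, |s| ≤ min ρ ρ₁ / 2 ∧ 0 ≤ s * a := by
      intro s hs
      refine ⟨?_, ?_⟩
      · have := abs_sub_left_of_mem_uIcc hs
        rw [sub_zero, sub_zero, hb_abs] at this
        exact this
      · rw [← segment_eq_uIcc] at hs
        obtain ⟨x, y, hx, hy, -, rfl⟩ := hs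
        have : (x • (0 : ℝ) + y • b) * a = y * (b * a) := by
          simp only [smul_eq_mul]
          ring
        rw [this]
        positivity
    have hseg' : ∀ s ∈ uIcc 0 b, |s - 0| < ρ ∧ s ∈ Y.J ∧ 0 < Y.Z (η s) * a := by
      intro s hs
      obtain ⟨h1, h2⟩ := hseg s hs
      have h3 : |s - 0| < min ρ ρ₁ := by
        rw [sub_zero]
        exact h1.trans_lt (half_lt_self hm)
      have h4 := hadm s (h3.trans_le (min_le_right _ _)) h2
      exact ⟨h3.trans_le (min_le_left _ _), h4.1, h4.2.1⟩
    have hNb : 0 < N b := by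
      have h1 := (hseg' b right_mem_uIcc).2.2
      have hg : Y.Z (η b) ≠ 0 := fun h => by simp [h] at h1
      have e : N b = b * a * (Y.Z (η b) * a) / (Y.Z (η b) * a) ^ 2 := by
        simp only [N]
        field_simp
      rw [e]
      positivity
    refine ⟨N b, hNb, fun ν hν hνε => ?_⟩
    have hN0 : N 0 = 0 := zero_div _
    have h5 : ν ∈ uIcc (N 0) (N b) := by
      rw [hN0, uIcc_of_le hNb.le]
      rw [sub_zero] at hνε
      exact ⟨hν.1, (le_abs_self ν).trans hνε.le⟩
    obtain ⟨s, hs, hsν⟩ := intermediate_value_uIcc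
      (hNc (fun s hs => (hseg' s hs).2.1) fun s hs => (hseg' s hs).2.2) h5
    exact ⟨s, (hseg' s hs).2.1, (hseg' s hs).1, by rw [← hsν]; exact hN s (hseg' s hs).2.2⟩
  · -- two-sided neighbourhood: `N` is injective there, so it crosses `ν₀`
    obtain ⟨ρ₂, hρ₂, huniq⟩ := hL.exists_unique_near hs₀ hne
    have hs₀a : 0 < ν₀ * a * a := by
      rw [mul_assoc]
      exact mul_pos h0 (mul_self_pos.2 ha)
    have hgood : ∀ᶠ s in 𝓝 (ν₀ * a), s ∈ Y.J ∧ 0 < Y.Z (η s) * a := by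
      have h1 : ∀ᶠ s in 𝓝 (ν₀ * a), 0 < s * a :=
        (continuous_mul_const a).continuousAt.eventually (lt_mem_nhds hs₀a)
      have h2 : ∀ᶠ s in 𝓝 (ν₀ * a), |s - ν₀ * a| < ρ₁ :=
        Metric.eventually_nhds_iff.2 ⟨ρ₁, hρ₁, fun _ h => h⟩
      filter_upwards [h1, h2] with s h1 h2
      exact ⟨(hadm s h2 h1.le).1, (hadm s h2 h1.le).2.1⟩
    have hNs₀ : N (ν₀ * a) = ν₀ := by
      change ν₀ * a / Y.Z (η (ν₀ * a)) = ν₀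
      rw [hfix, ← ha_def, mul_div_cancel_right₀ _ ha]
    have hclose : ∀ᶠ s in 𝓝 (ν₀ * a), |N s - ν₀| < ρ₂ := by
      have h1 : ContinuousAt N (ν₀ * a) :=
        (hNc (t := {s | s ∈ Y.J ∧ 0 < Y.Z (η s) * a}) (fun s hs => hs.1)
          fun s hs => hs.2).continuousAt hgood
      have h2 := Metric.continuousAt_iff'.1 h1 ρ₂ hρ₂
      rw [hNs₀] at h2
      exact h2
    obtain ⟨ρ₃, hρ₃, h3⟩ := Metric.eventually_nhds_iff.1 (hgood.and hclose)
    set m := min (min ρ ρ₂) ρ₃ / 2 with hm_def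
    have hm' : 0 < min (min ρ ρ₂) ρ₃ := by positivity
    have hm : 0 < m := half_pos hm'
    have hIcc : ∀ s ∈ Icc (ν₀ * a - m) (ν₀ * a + m), |s - ν₀ * a| < min (min ρ ρ₂) ρ₃ := by
      intro s hs
      refine lt_of_le_of_lt (abs_le.2 ⟨?_, ?_⟩) (half_lt_self hm')
      · linarith [hs.1]
      · linarith [hs.2]
    have hprop : ∀ s ∈ Icc (ν₀ * a - m) (ν₀ * a + m), |s - ν₀ * a| < ρ ∧ |s - ν₀ * a| < ρ₂ ∧
        s ∈ Y.J ∧ 0 < Y.Z (η s) * a ∧ |N s - ν₀| < ρ₂ := fun s hs => by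
      have h4 := hIcc s hs
      obtain ⟨⟨h5, h6⟩, h7⟩ := h3 (h4.trans_le (min_le_right _ _))
      have h8 := h4.trans_le (min_le_left _ _)
      exact ⟨h8.trans_le (min_le_left _ _), h8.trans_le (min_le_right _ _), h5, h6, h7⟩
    have hinj : InjOn N (Icc (ν₀ * a - m) (ν₀ * a + m)) := by
      intro s hs t ht hst
      obtain ⟨-, h4, h5, h6, h7⟩ := hprop s hs
      obtain ⟨-, h4', h5', h6', -⟩ := hprop t ht
      exact huniq (N s) h7 s h5 h4 t h5' h4' (hN s h6) (by rw [hst]; exact hN t h6')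
    have hcont : ContinuousOn N (Icc (ν₀ * a - m) (ν₀ * a + m)) :=
      hNc (fun s hs => (hprop s hs).2.2.1) fun s hs => (hprop s hs).2.2.2.1
    have hl : ν₀ * a - m ∈ Icc (ν₀ * a - m) (ν₀ * a + m) := ⟨le_rfl, by linarith⟩
    have hr : ν₀ * a + m ∈ Icc (ν₀ * a - m) (ν₀ * a + m) := ⟨by linarith, le_rfl⟩
    have hc : ν₀ * a ∈ Icc (ν₀ * a - m) (ν₀ * a + m) := ⟨by linarith, by linarith⟩
    have hl' : N (ν₀ * a - m) - ν₀ ≠ 0 := fun h => by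
      have := hinj hl hc ((sub_eq_zero.1 h).trans hNs₀.symm)
      linarith
    have hr' : N (ν₀ * a + m) - ν₀ ≠ 0 := fun h => by
      have := hinj hr hc ((sub_eq_zero.1 h).trans hNs₀.symm)
      linarith
    have hcross : (N (ν₀ * a - m) - ν₀) * (N (ν₀ * a + m) - ν₀) < 0 := by
      refine lt_of_le_of_ne (not_lt.1 fun hpos => ?_) (mul_ne_zero hl' hr')
      obtain ⟨x, hx, y, hy, hxy, he⟩ := exists_two_preimages (N := N) (c := ν₀ * a)
        (by linarith : ν₀ * a - m < ν₀ * a) (by linarith) hcont (by rwa [hNs₀])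
      exact hxy (hinj hx hy he)
    refine ⟨min |N (ν₀ * a - m) - ν₀| |N (ν₀ * a + m) - ν₀|,
      lt_min (abs_pos.2 hl') (abs_pos.2 hr'), fun ν hν hνε => ?_⟩
    have h4 := abs_lt.1 (hνε.trans_le (min_le_left _ _))
    have h5 := abs_lt.1 (hνε.trans_le (min_le_right _ _))
    have hmem : ν ∈ uIcc (N (ν₀ * a - m)) (N (ν₀ * a + m)) := by
      rcases mul_neg_iff.1 hcross with ⟨h6, h7⟩ | ⟨h6, h7⟩
      · rw [abs_of_pos h6] at h4
        rw [abs_of_neg h7] at h5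
        exact mem_uIcc.2 (Or.inr ⟨by linarith, by linarith⟩)
      · rw [abs_of_neg h6] at h4
        rw [abs_of_pos h7] at h5
        exact mem_uIcc.2 (Or.inl ⟨by linarith, by linarith⟩)
    have hu : uIcc (ν₀ * a - m) (ν₀ * a + m) = Icc (ν₀ * a - m) (ν₀ * a + m) :=
      uIcc_of_le (by linarith)
    obtain ⟨s, hs, hsν⟩ := intermediate_value_uIcc (by rwa [hu]) hmem
    rw [hu] at hs
    obtain ⟨h6, -, h7, h8, -⟩ := hprop s hs
    exact ⟨s, h7, h6, by rw [← hsν]; exact hN s h8⟩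

/-- If the linearized equation is nondegenerate, exactly one solution lies within `δ` of the given
one for each nearby coupling strength, for every small `δ`. -/
theorem exists_existsUnique (hne : ν₀ * Y.Z (θ (ν₀ * Y.Z h₀)) ≠ 1) :
    ∃ δ₀ > 0, ∀ δ, 0 < δ → δ ≤ δ₀ → ∃ ε > 0, ∀ ν ∈ Icc 0 Y.νmax, |ν - ν₀| < ε →
      ∃! h, h ∈ Y.X.W R ∧ |ν - ν₀| + ‖h - h₀‖ ≤ δ ∧ Y.F R ν h = 0 := by
  have hs₀ := Y.mul_Z_mem_J ⟨hν₀.1, hν₀.2.le⟩ hh₀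
  obtain ⟨ρ₁, hρ₁, huniq⟩ := hL.exists_unique_near hs₀ hne
  obtain ⟨δ₀, hδ₀, hctl⟩ := exists_dist_control (Y := Y) ν₀ h₀ hρ₁
  refine ⟨δ₀, hδ₀, fun δ hδ hδδ₀ => ?_⟩
  obtain ⟨ρ₂, hρ₂, hη⟩ := Metric.continuousWithinAt_iff.1
    (hL.hasDerivWithinAt_η hs₀).continuousWithinAt (δ / 2) (half_pos hδ)
  obtain ⟨ε, hε, hex⟩ := hL.exists_solution_near hν₀ hh₀ hfix hne hρ₂
  refine ⟨min ε (δ / 2), lt_min hε (half_pos hδ), fun ν hν hνε => ?_⟩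
  obtain ⟨s, hs, hsρ, hsol⟩ := hex ν hν (hνε.trans_le (min_le_left _ _))
  refine ⟨η s, ⟨hL.η_mem s hs, ?_, hL.F_η_eq_zero hν hs hsol⟩, ?_⟩
  · have h1 := hη hs hsρ
    rw [hfix, dist_eq_norm] at h1
    linarith [hνε.trans_le (min_le_right _ _)]
  · rintro h ⟨hh, hd, hF⟩
    obtain ⟨h1, -, h2⟩ := hctl ν h (hd.trans hδδ₀)
    have h3 : |s - ν₀ * Y.Z h₀| < ρ₁ := by
      have h4 := hη hs hsρ
      rw [hfix, dist_eq_norm] at h4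
      have h5 := (hctl ν (η s) (le_trans (by linarith [hνε.trans_le (min_le_right ε (δ / 2))])
        hδδ₀)).1
      rwa [hsol] at h5
    rw [hL.F_eq_zero_iff hν hh] at hF
    have h6 := huniq ν h2 _ (Y.mul_Z_mem_J hν hh) h1 s hs h3 (by rw [hF]) hsol
    rw [← hF, h6]

/-- At a nondegenerate fold the coupling strength `s / ∫ α η(s)` has a strict local extremum, so
nearby values on one side are taken twice. -/
theorem exists_two_solutions (hpos : 0 < ν₀) (ha : Y.Z h₀ ≠ 0)
    (hcrit : ν₀ * Y.Z (θ (ν₀ * Y.Z h₀)) = 1) (h2 : Y.H2 R ν₀ h₀) :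
    ∃ ν ∈ Ioo 0 Y.νmax, ∃ h₁ ∈ Y.X.W R, ∃ h₂ ∈ Y.X.W R,
      h₁ ≠ h₂ ∧ Y.F R ν h₁ = 0 ∧ Y.F R ν h₂ = 0 := by
  have hν₀' : ν₀ ∈ Icc 0 Y.νmax := ⟨hν₀.1, hν₀.2.le⟩
  obtain ⟨ρ₁, hρ₁, hadm⟩ := hL.exists_admissible hν₀ hh₀ hfix ha
  set a := Y.Z h₀ with ha_def
  have hs₀a : 0 < ν₀ * a * a := by
    rw [mul_assoc]
    exact mul_pos hpos (mul_self_pos.2 ha)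
  have hgood : ∀ᶠ s in 𝓝 (ν₀ * a), s ∈ Y.J ∧ 0 < Y.Z (η s) * a ∧ 0 < s * a ∧
      s / Y.Z (η s) < Y.νmax := by
    have h1 : ∀ᶠ s in 𝓝 (ν₀ * a), 0 < s * a :=
      (continuous_mul_const a).continuousAt.eventually (lt_mem_nhds hs₀a)
    have h2 : ∀ᶠ s in 𝓝 (ν₀ * a), |s - ν₀ * a| < ρ₁ :=
      Metric.eventually_nhds_iff.2 ⟨ρ₁, hρ₁, fun _ h => h⟩
    filter_upwards [h1, h2] with s h1 h2
    obtain ⟨h3, h4, h5⟩ := hadm s h2 h1.le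
    exact ⟨h3, h4, h1, h5.2⟩
  have hJ : Y.J ∈ 𝓝 (ν₀ * a) := hgood.mono fun s hs => hs.1
  obtain ⟨κ, hκ, hp⟩ := hL.hasDerivAt_of_H2 hν₀' hh₀ hfix hJ hcrit h2
  have hq : ∀ᶠ s in 𝓝 (ν₀ * a), HasDerivAt (fun s => ν₀ * Y.Z (η s)) (ν₀ * Y.Z (θ s)) s := by
    filter_upwards [eventually_mem_nhds_iff.2 hJ] with s hs
    exact ((Y.ZL 1).hasFDerivAt.comp_hasDerivAt s
      ((hL.hasDerivWithinAt_η (mem_of_mem_nhds hs)).hasDerivAt hs)).const_mul ν₀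
  have hfold := eventually_fold (q := fun s => ν₀ * Y.Z (η s)) (q' := fun s => ν₀ * Y.Z (θ s))
    hq (by rw [hfix]) hcrit hp hκ
  obtain ⟨ρ, hρ, h3⟩ := Metric.eventually_nhds_iff.1 (hgood.and (eventually_nhdsWithin_iff.1 hfold))
  set m := ρ / 2 with hm_def
  have hm : 0 < m := half_pos hρ
  have hprop : ∀ s ∈ Icc (ν₀ * a - m) (ν₀ * a + m), (s ∈ Y.J ∧ 0 < Y.Z (η s) * a ∧ 0 < s * a ∧
      s / Y.Z (η s) < Y.νmax) ∧ (s ≠ ν₀ * a → 0 < (ν₀ * Y.Z (η s) - s) * κ) := fun s hs => by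
    refine h3 ?_
    rw [Real.dist_eq]
    refine lt_of_le_of_lt (abs_le.2 ⟨?_, ?_⟩) (half_lt_self hρ)
    · linarith [hs.1]
    · linarith [hs.2]
  let N : ℝ → ℝ := fun s => s / Y.Z (η s)
  have hg : ∀ s ∈ Icc (ν₀ * a - m) (ν₀ * a + m), Y.Z (η s) ≠ 0 := fun s hs h => by
    have := (hprop s hs).1.2.1
    simp [h] at this
  have hNs₀ : N (ν₀ * a) = ν₀ := by
    change ν₀ * a / Y.Z (η (ν₀ * a)) = ν₀
    rw [hfix, ← ha_def, mul_div_cancel_right₀ _ ha]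
  have hcont : ContinuousOn N (Icc (ν₀ * a - m) (ν₀ * a + m)) := fun s hs =>
    continuousWithinAt_id.div ((hL.continuousWithinAt_Z_η (hprop s hs).1.1).mono
      fun t ht => (hprop t ht).1.1) (hg s hs)
  have hl : ν₀ * a - m ∈ Icc (ν₀ * a - m) (ν₀ * a + m) := ⟨le_rfl, by linarith⟩
  have hr : ν₀ * a + m ∈ Icc (ν₀ * a - m) (ν₀ * a + m) := ⟨by linarith, le_rfl⟩
  have hside (s : ℝ) (hs : s ∈ Icc (ν₀ * a - m) (ν₀ * a + m)) (hne : s ≠ ν₀ * a) :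
      0 < (N s - N (ν₀ * a)) * -(κ * a) := by
    have hgs := hg s hs
    have e : (N s - N (ν₀ * a)) * -(κ * a) =
        (ν₀ * Y.Z (η s) - s) * κ * (Y.Z (η s) * a) / Y.Z (η s) ^ 2 := by
      rw [hNs₀]
      simp only [N]
      field_simp
      ring
    rw [e]
    have h4 := (hprop s hs).2 hne
    have h5 := (hprop s hs).1.2.1
    positivity
  have hsame : 0 < (N (ν₀ * a - m) - N (ν₀ * a)) * (N (ν₀ * a + m) - N (ν₀ * a)) := by
    have h4 := mul_pos (hside _ hl (by linarith)) (hside _ hr (by linarith))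
    have h5 : 0 < (κ * a) ^ 2 := by positivity
    refine pos_of_mul_pos_left (b := (κ * a) ^ 2) ?_ h5.le
    linarith
  obtain ⟨x, hx, y, hy, hxy, he⟩ := exists_two_preimages (N := N) (c := ν₀ * a)
    (by linarith : ν₀ * a - m < ν₀ * a) (by linarith) hcont hsame
  have hNmem : N x ∈ Ioo 0 Y.νmax := by
    refine ⟨?_, (hprop x hx).1.2.2.2⟩
    have hgx := hg x hx
    have e : N x = x * a * (Y.Z (η x) * a) / (Y.Z (η x) * a) ^ 2 := by
      simp only [N]
      field_simp
    rw [e]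
    have h4 := (hprop x hx).1.2.1
    have h5 := (hprop x hx).1.2.2.1
    positivity
  have hNx : N x * Y.Z (η x) = x := div_mul_cancel₀ _ (hg x hx)
  have hNy : N x * Y.Z (η y) = y := by
    rw [he]
    exact div_mul_cancel₀ _ (hg y hy)
  refine ⟨N x, hNmem, η x, hL.η_mem x (hprop x hx).1.1, η y, hL.η_mem y (hprop y hy).1.1, ?_,
    hL.F_η_eq_zero (Ioo_subset_Icc_self hNmem) (hprop x hx).1.1 hNx,
    hL.F_η_eq_zero (Ioo_subset_Icc_self hNmem) (hprop y hy).1.1 hNy⟩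
  intro hxy'
  refine hxy ?_
  rw [← hNx, ← hNy, hxy']

end System.LinearResponse

end

end MeanField

theorem mainTheorem1 (d r : ℕ) (hr : 12 < r) (Y : MeanField.System.{u} d r)
    (𝒯 : Set (MeanField.TorusMap d r)) (K C ϑ : ℝ) (c c' : ℕ)
    (h_surj : ∀ S ∈ 𝒯, Function.Surjective S.toFun)
    (h_comp : ∀ S ∈ 𝒯, ∀ S' ∈ 𝒯, S.comp S' ∈ 𝒯)
    (h_pos : 0 < Y.νmax)
    (h_mem : ∀ ν ∈ Icc 0 Y.νmax, ∀ μ : Measure (MeanField.Torus d), IsProbabilityMeasure μ →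
      MeanField.coupledMap r Y.T Y.β ν (∫ x, Y.α.1 x ∂μ) ∈ 𝒯)
    (h_spaces : Y.X.Assumptions 𝒯 K C ϑ c c') :
    ∃ R₀ : ℝ, ∀ R ≥ R₀, ∀ ν₀ ∈ Ico 0 Y.νmax, ∀ h₀ ∈ Y.X.W R, Y.F R ν₀ h₀ = 0 →
      (Y.DhFInvertible R ν₀ h₀ ∨ (Y.H1 R ν₀ h₀ ∧ Y.H2 R ν₀ h₀ ∧ Y.H3 h₀)) →
      ∃ δ > 0, ∃ (G : ℝ → ℝ) (hh : ℝ → Y.X.B 1),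
        (∀ τ ∈ Ioo (-δ) δ, G τ ∈ Icc 0 Y.νmax ∧ hh τ ∈ Y.X.W R ∧ Y.F R (G τ) (hh τ) = 0) ∧
        DifferentiableOn ℝ (fun τ => (G τ, hh τ)) (Ioo (-δ) δ) ∧
        G 0 = ν₀ ∧ hh 0 = h₀ ∧
        (∀ ν ∈ Icc 0 Y.νmax, ∀ h ∈ Y.X.W R, |ν - ν₀| + ‖h - h₀‖ ≤ δ → Y.F R ν h = 0 →
          ∃ τ ∈ Ioo (-δ) δ, G τ = ν ∧ hh τ = h) ∧
        (Y.DhFInvertible R ν₀ h₀ → ∃ ε > 0, ∀ ν ∈ Icc 0 Y.νmax, |ν - ν₀| < ε →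
          ∃! h, h ∈ Y.X.W R ∧ |ν - ν₀| + ‖h - h₀‖ ≤ δ ∧ Y.F R ν h = 0) ∧
        (0 < ν₀ → ¬ Y.DhFInvertible R ν₀ h₀ → ∃ ν ∈ Ioo 0 Y.νmax, ∃ h₁ ∈ Y.X.W R,
          ∃ h₂ ∈ Y.X.W R, h₁ ≠ h₂ ∧ Y.F R ν h₁ = 0 ∧ Y.F R ν h₂ = 0) := by

  obtain ⟨R₀, hR₀⟩ := Y.exists_linearResponse h_mem h_spaces
  refine ⟨R₀, fun R hR ν₀ hν₀ h₀ hh₀ hF hyp => ?_⟩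
  obtain ⟨η, θ, M, hL⟩ := hR₀ R hR
  have hν₀' : ν₀ ∈ Icc 0 Y.νmax := ⟨hν₀.1, hν₀.2.le⟩
  have hfix := (hL.F_eq_zero_iff hν₀' hh₀).1 hF
  have hinv := hL.DhFInvertible_iff hν₀' hh₀
  have hcurve : ∃ δ₀ > 0, ∀ δ, 0 < δ → δ ≤ δ₀ → ∃ (G : ℝ → ℝ) (hh : ℝ → Y.X.B 1),
      (∀ τ ∈ Ioo (-δ) δ, G τ ∈ Icc 0 Y.νmax ∧ hh τ ∈ Y.X.W R ∧ Y.F R (G τ) (hh τ) = 0) ∧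
      DifferentiableOn ℝ (fun τ => (G τ, hh τ)) (Ioo (-δ) δ) ∧ G 0 = ν₀ ∧ hh 0 = h₀ ∧
      ∀ ν ∈ Icc 0 Y.νmax, ∀ h ∈ Y.X.W R, |ν - ν₀| + ‖h - h₀‖ ≤ δ → Y.F R ν h = 0 →
        ∃ τ ∈ Ioo (-δ) δ, G τ = ν ∧ hh τ = h := by
    by_cases ha : Y.Z h₀ = 0
    · have h1 : Y.DhFInvertible R ν₀ h₀ := hyp.resolve_right fun h => h.2.2 ha
      exact hL.exists_curve_of_Z_eq_zero hν₀ hh₀ hfix ha (hinv.1 h1)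
    · exact hL.exists_curve_of_Z_ne_zero hν₀ hh₀ hfix ha
  have hunique : ∃ δ₀ > 0, ∀ δ, 0 < δ → δ ≤ δ₀ → Y.DhFInvertible R ν₀ h₀ → ∃ ε > 0,
      ∀ ν ∈ Icc 0 Y.νmax, |ν - ν₀| < ε →
        ∃! h, h ∈ Y.X.W R ∧ |ν - ν₀| + ‖h - h₀‖ ≤ δ ∧ Y.F R ν h = 0 := by
    by_cases h1 : Y.DhFInvertible R ν₀ h₀
    · obtain ⟨δ₀, hδ₀, h⟩ := hL.exists_existsUnique hν₀ hh₀ hfix (hinv.1 h1)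
      exact ⟨δ₀, hδ₀, fun δ hδ hδδ₀ _ => h δ hδ hδδ₀⟩
    · exact ⟨1, one_pos, fun _ _ _ h => absurd h h1⟩
  obtain ⟨δ₁, hδ₁, hcurve⟩ := hcurve
  obtain ⟨δ₂, hδ₂, hunique⟩ := hunique
  have hδ : 0 < min δ₁ δ₂ := lt_min hδ₁ hδ₂
  obtain ⟨G, hh, h1, h2, h3, h4, h5⟩ := hcurve _ hδ (min_le_left _ _)
  refine ⟨min δ₁ δ₂, hδ, G, hh, h1, h2, h3, h4, h5, hunique _ hδ (min_le_right _ _), ?_⟩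
  intro hpos hnot
  obtain ⟨-, hH2, hH3⟩ := hyp.resolve_left hnot
  exact hL.exists_two_solutions hν₀ hh₀ hfix hpos hH3 (not_not.1 (hinv.not.1 hnot)) hH2
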